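/- Let $n_2\ge n_1\ge 1$ be integers and let $z,\alpha,t>0$, $t\ne 1$. Let $x_{i,j}$ ($1\le i\le n_1$, $1\le j\le n_2+1$) be independent non-negative integer random variables with $$\Pr(x_{i,j}=k)=(1-z^2t^{i+j-2})(z^2t^{i+j-2})^k\quad(j\le n_2),\qquad \Pr(x_{i,n_2+1}=k)=(1-\alpha z t^{i-1})(\alpha z t^{i-1})^k ,$$ all the parameters $z^2t^{i+j-2}$, $\alpha z t^{i-1}$ being less than $1$. For partitions $\mu,\kappa$ consider the joint probability that the matrix $[x_{i,j}]$ corresponds under the Robinson–Schensted–Knuth (RSK) correspondence to a pair of tableaux of shape $\mu$, and that the submatrix formed by its first $n_2$ columns corresponds to a pair of tableaux of shape $\kappa$. This probability is non-zero if and only if $\mu$ and $\kappa$ have at most $n_1$ parts and, with $h_j:=\mu_j+n_1-j$, $r_j:=\kappa_j+n_1-j$, $$h_1\ge r_1>h_2\ge r_2>\cdots>h_{n_1}\ge r_{n_1}\ge 0 .$$ In that case it equals $$k_{n_1,n_2}(z,\alpha,t)\,z^{\sum_{j=1}^{n_1}(h_j+r_j)}\alpha^{\sum_{j=1}^{n_1}(h_j-r_j)}\prod_{i=1}^{n_1}\frac{(t;t)_{r_i+n_2-n_1}}{(t;t)_{r_i}}\prod_{1\le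 i<j\le n_1}(t^{h_j}-t^{h_i})(t^{r_j}-t^{r_i}),\qquad(1)$$ where $(t;t)_l=(1-t)(1-t^2)\cdots(1-t^l)$, empty products are $1$, and $$k_{n_1,n_2}(z,\alpha,t)=z^{-2\sum_{j=1}^{n_1}(n_1-j)}\frac{t^{-\sum_{j=1}^{n_1}(j-1)(n_1-j)}}{\prod_{l=1}^{n_1-1}(t;t)_l}\;t^{-\sum_{j=1}^{n_2-n_1}j(j-1)}\,t^{-n_1\sum_{j=1}^{n_2-n_1}j}\;\frac{t^{-\sum_{j=1}^{n_2}(j-1)(n_1-j)}}{\prod_{l=1}^{n_2-1}(t;t)_l}$$ $$\qquad\times\prod_{l=1}^{n_2-n_1-1}(t;t)_l\;\prod_{i=1}^{n_1}\prod_{j=1}^{n_2}(1-z^2t^{i+j-2})\prod_{i=1}^{n_1}(1-\alpha z t^{i-1}).$$ Jacobi limit. Let $a>0$ and $a+a_1>0$, and put $t=e^{-1/L}$, $z=e^{-a/L}$, $\alpha=e^{-a_1/L}$. If $h_j=h_j(L)$, $r_j=r_j(L)$ are non-negative integers with $h_j/L\to x_j$ and $r_j/L\to y_j$ as $L\to\infty$,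 where $$x_1>y_1>x_2>y_2>\cdots>x_{n_1}>y_{n_1}>0,\qquad(2)$$ then $L^{2n_1}$ times (1) tends to $$\tilde k_{n_1,n_2}(a,a_1)\prod_{i=1}^{n_1}(1-e^{-y_i})^{n_2-n_1}\prod_{1\le i<j\le n_1}(e^{-y_j}-e^{-y_i})(e^{-x_j}-e^{-x_i})\;e^{-a\sum_{j=1}^{n_1}(x_j+y_j)}\,e^{-a_1\sum_{j=1}^{n_1}(x_j-y_j)},\qquad(3)$$ $$\tilde k_{n_1,n_2}(a,a_1)=\frac{\prod_{l=1}^{n_2-n_1-1}l!}{\left(\prod_{l=1}^{n_1-1}l!\right)\left(\prod_{l=1}^{n_2-1}l!\right)}\;\frac{\Gamma(a+a_1+n_1)}{\Gamma(a+a_1)}\prod_{i=1}^{n_1}\frac{\Gamma(2a+i-1+n_2)}{\Gamma(2a+i-1)} ,$$ and (3), supported on the region (2), is a probability density: it is non-negative and has total integral $1$. Finally let $n_1=n_2=n$, and let $a>-1$, $A<a+1$. Replace $a$ by $(a+1)/2$ and $a_1$ by $-A/2$ in (3). Under the change of variables $u_{2n+2-2j}=e^{-x_j}$, $u_{2n+1-2j}=e^{-y_j}$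 ($1\le j\le n$), the probability measure with density (3) is carried to the one with density $$\frac1C\prod_{j=1}^{2n}u_j^{(a-1)/2}\prod_{l=1}^n\Big(\frac{u_{2l}}{u_{2l-1}}\Big)^{-A/2}\prod_{1\le j<k\le n}(u_{2j-1}-u_{2k-1})(u_{2j}-u_{2k}),\qquad 1>u_1>u_2>\cdots>u_{2n}>0,$$ where $C$ is the normalization. -/

import Mathlib

open MeasureTheory ProbabilityTheory

noncomputable section

namespace LPP

/-! ## The Robinson-Schensted-Knuth correspondence (row insertion)

A tableau is the list of its rows, from the top; the entries lie in a linear order. -/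

/-- Insert `a` into a row: the leftmost entry larger than `a` is replaced by `a` and bumped out;
if there is none, `a` is put at the end of the row and nothing is bumped. -/
def rowInsert {β : Type*} [LinearOrder β] (a : β) : List β → List β × Option β
  | [] => ([a], none)
  | b :: R => if a < b then (a :: R, some b) else (b :: (rowInsert a R).1, (rowInsert a R).2)

/-- Insert `a` into a tableau, a bumped entry being inserted into the next row. Returns the new
tableau and the (0-based) index of the row that has gained a box. -/
def tableauInsert {β : Type*} [LinearOrder β] : List (List β) → β → List (List β) × ℕ
  | [], a => ([[a]], 0)
  | R :: T, a =>
    match rowInsert a R with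
    | (R', none) => (R' :: T, 0)
    | (R', some b) => (R' :: (tableauInsert T b).1, (tableauInsert T b).2 + 1)

/-- Add a box with entry `c` at the end of row number `k` (0-based). -/
def recordBox {γ : Type*} : List (List γ) → ℕ → γ → List (List γ)
  | [], _, c => [[c]]
  | R :: T, 0, c => (R ++ [c]) :: T
  | R :: T, k + 1, c => R :: recordBox T k c

/-- The lexicographically ordered two-line array of a non-negative integer matrix: the pair
`(i, j)` is listed `x i j` times. -/
def biword {m n : ℕ} (x : Matrix (Fin m) (Fin n) ℕ) : List (Fin m × Fin n) :=
  (List.finRange m).flatMap fun i =>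
    (List.finRange n).flatMap fun j => List.replicate (x i j) (i, j)

/-- The RSK correspondence: the pair of the insertion tableau (of content `n`, i.e. with entries in
`Fin n`) and the recording tableau (of content `m`, i.e. with entries in `Fin m`). -/
def rsk {m n : ℕ} (x : Matrix (Fin m) (Fin n) ℕ) : List (List (Fin n)) × List (List (Fin m)) :=
  (biword x).foldl
    (fun PQ p =>
      ((tableauInsert PQ.1 p.2).1, recordBox PQ.2 (tableauInsert PQ.1 p.2).2 p.1))
    ([], [])

/-- The matrix `x` gives, under RSK, a pair of tableaux of shape `μ`. -/
def HasRSKShape {m n : ℕ} (x : Matrix (Fin m) (Fin n) ℕ) (μ : YoungDiagram) : Prop :=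
  (rsk x).1.map List.length = μ.rowLens ∧ (rsk x).2.map List.length = μ.rowLens

/-! ## The percolation model -/

/-- The parameter of the geometric variable at site `(i, j)` of the `n₁ × (n₂ + 1)` lattice; with
0-based indices it is `z² t^(i+j)`, and `α z t^i` in the last column. -/
def siteParam {n₁ n₂ : ℕ} (z α t : ℝ) (i : Fin n₁) (j : Fin (n₂ + 1)) : ℝ :=
  if j = Fin.last n₂ then α * z * t ^ (i : ℕ) else z ^ 2 * t ^ ((i : ℕ) + (j : ℕ))

/-- The joint probability that the whole configuration has RSK shape `μ` and that its first `n₂`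
columns have RSK shape `κ`. -/
def jointProb {Ω : Type*} [MeasurableSpace Ω] (P : Measure Ω) {n₁ n₂ : ℕ}
    (X : Fin n₁ → Fin (n₂ + 1) → Ω → ℕ) (μ κ : YoungDiagram) : ℝ :=
  P.real {ω | HasRSKShape (Matrix.of fun i j => X i j ω) μ ∧
    HasRSKShape (Matrix.of fun (i : Fin n₁) (j : Fin n₂) => X i j.castSucc ω) κ}

/-- `μ_j + n - j` for the 1-based index `j = i + 1`. -/
def shiftedParts (n : ℕ) (μ : YoungDiagram) (i : Fin n) : ℕ :=
  μ.rowLen i + (n - 1 - i)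

/-- `h₁ ≥ r₁ > h₂ ≥ r₂ > ⋯ > hₙ ≥ rₙ ≥ 0`. -/
def DiscreteInterlace {n : ℕ} (h r : Fin n → ℕ) : Prop :=
  (∀ i, r i ≤ h i) ∧ ∀ i j : Fin n, (j : ℕ) = i + 1 → h j < r i

/-- `(t;t)_l = (1 - t)(1 - t²)⋯(1 - t^l)`. -/
def qPoch (t : ℝ) (l : ℕ) : ℝ := ∏ k ∈ Finset.Icc 1 l, (1 - t ^ k)

/-- The constant `k_{n₁,n₂}(z,α,t)`. -/
def jointConst (n₁ n₂ : ℕ) (z α t : ℝ) : ℝ :=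
  z ^ (-2 * ∑ j ∈ Finset.Icc 1 n₁, ((n₁ : ℤ) - j))
  * (t ^ (-∑ j ∈ Finset.Icc 1 n₁, ((j : ℤ) - 1) * ((n₁ : ℤ) - j))
      / ∏ l ∈ Finset.Icc 1 (n₁ - 1), qPoch t l)
  * t ^ (-∑ j ∈ Finset.Icc 1 (n₂ - n₁), (j : ℤ) * ((j : ℤ) - 1))
  * t ^ (-(n₁ : ℤ) * ∑ j ∈ Finset.Icc 1 (n₂ - n₁), (j : ℤ))
  * (t ^ (-∑ j ∈ Finset.Icc 1 n₂, ((j : ℤ) - 1) * ((n₁ : ℤ) - j))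
      / ∏ l ∈ Finset.Icc 1 (n₂ - 1), qPoch t l)
  * (∏ l ∈ Finset.Icc 1 (n₂ - n₁ - 1), qPoch t l)
  * (∏ i ∈ Finset.Icc 1 n₁, ∏ j ∈ Finset.Icc 1 n₂, (1 - z ^ 2 * t ^ (i + j - 2)))
  * ∏ i ∈ Finset.Icc 1 n₁, (1 - α * z * t ^ (i - 1))

/-- The explicit form of the joint probability. -/
def jointFormula (n₁ n₂ : ℕ) (z α t : ℝ) (h r : Fin n₁ → ℕ) : ℝ :=
  jointConst n₁ n₂ z α t
  * z ^ (∑ j, (h j + r j))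
  * α ^ (∑ j, ((h j : ℤ) - r j))
  * (∏ i, qPoch t (r i + n₂ - n₁) / qPoch t (r i))
  * ∏ i, ∏ j ∈ Finset.Ioi i, (t ^ h j - t ^ h i) * (t ^ r j - t ^ r i)

/-! ## The Jacobi limit -/

/-- `x₁ > y₁ > x₂ > y₂ > ⋯ > xₙ > yₙ > 0`. -/
def Interlace {n : ℕ} (x y : Fin n → ℝ) : Prop :=
  (∀ i, y i < x i) ∧ (∀ i j : Fin n, (j : ℕ) = i + 1 → x j < y i) ∧ ∀ i, 0 < y i

/-- The constant `k̃_{n₁,n₂}(a,a₁)`. -/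
def limitConst (n₁ n₂ : ℕ) (a a₁ : ℝ) : ℝ :=
  (∏ l ∈ Finset.Icc 1 (n₂ - n₁ - 1), (l.factorial : ℝ))
    / ((∏ l ∈ Finset.Icc 1 (n₁ - 1), (l.factorial : ℝ))
      * ∏ l ∈ Finset.Icc 1 (n₂ - 1), (l.factorial : ℝ))
  * (Real.Gamma (a + a₁ + n₁) / Real.Gamma (a + a₁))
  * ∏ i ∈ Finset.Icc 1 n₁,
      Real.Gamma (2 * a + i - 1 + n₂) / Real.Gamma (2 * a + i - 1)

open Classical in
/-- The limiting density of `(x, y)`, supported on the interlacing region. -/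
def limitDensity (n₁ n₂ : ℕ) (a a₁ : ℝ) (x y : Fin n₁ → ℝ) : ℝ :=
  if Interlace x y then
    limitConst n₁ n₂ a a₁
    * (∏ i, (1 - Real.exp (-y i)) ^ (n₂ - n₁))
    * (∏ i, ∏ j ∈ Finset.Ioi i,
        (Real.exp (-y j) - Real.exp (-y i)) * (Real.exp (-x j) - Real.exp (-x i)))
    * Real.exp (-a * ∑ j, (x j + y j))
    * Real.exp (-a₁ * ∑ j, (x j - y j))
  else 0

/-! ## The parameter dependent Jacobi ensemble -/

/-- The entry `u_{2l-1}` of `u = (u₁,…,u_{2n})`, for the 1-based index `l = i + 1`. -/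
def oddEntry {n : ℕ} (u : Fin (2 * n) → ℝ) (i : Fin n) : ℝ := u ⟨2 * i, by omega⟩

/-- The entry `u_{2l}` of `u = (u₁,…,u_{2n})`, for the 1-based index `l = i + 1`. -/
def evenEntry {n : ℕ} (u : Fin (2 * n) → ℝ) (i : Fin n) : ℝ := u ⟨2 * i + 1, by omega⟩

open Classical in
/-- The unnormalised density, on `1 > u₁ > ⋯ > u_{2n} > 0`. -/
def jacobiWeight (n : ℕ) (a A : ℝ) (u : Fin (2 * n) → ℝ) : ℝ :=
  if StrictAnti u ∧ ∀ k, 0 < u k ∧ u k < 1 then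
    (∏ k, u k ^ ((a - 1) / 2))
    * (∏ l, (evenEntry u l / oddEntry u l) ^ (-A / 2))
    * ∏ j, ∏ k ∈ Finset.Ioi j,
        (oddEntry u j - oddEntry u k) * (evenEntry u j - evenEntry u k)
  else 0

/-- The density `C⁻¹ · jacobiWeight`, where `C` is the normalization. -/
def jacobiDensity (n : ℕ) (a A : ℝ) (u : Fin (2 * n) → ℝ) : ℝ :=
  jacobiWeight n a A u / ∫ v, jacobiWeight n a A v

/-- The change of variables `u_{2n+2-2j} = exp (-x_j)`, `u_{2n+1-2j} = exp (-y_j)`. -/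
def toJacobi (n : ℕ) (p : (Fin n → ℝ) × (Fin n → ℝ)) (k : Fin (2 * n)) : ℝ :=
  if (k : ℕ) % 2 = 0 then Real.exp (-p.2 (Fin.rev ⟨k / 2, by omega⟩))
  else Real.exp (-p.1 (Fin.rev ⟨k / 2, by omega⟩))

end LPP

end

/-! The discrete law is a statement about RSK as a growth diagram. Let `cntLT` count the letters
below `l` in a row of the insertion tableau. Inserting a weakly increasing word changes these counts
by a max-plus recursion, and the word bumped into the next row is again increasing, with
multiplicities given by a min. Hence the shapes of the subtableaux obey the local rule `loc` at each
lattice square (`cntLT_row_rsk`). For fixed neighbours `m`, `v` the rule is a bijection between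
pairs `(l, x)` and shapes `ν` for which `ν / m` and `ν / v` are horizontal strips. With weights this
is the one-variable skew Cauchy identity `tsum_loc`.

The site parameters factor as `a i * b j`, so `tsum_loc` can be applied square by square. A column
of the diagram is a semistandard tableau recorded as a chain of shapes, and `tsum_colChain_pair`
shows that, up to normalisation, the joint law of the last two shapes `κ`, `μ` is `schur b n₂ κ * b
n₂ ^ (|μ| - |κ|) * schur a n₁ μ` on horizontal strips and zero elsewhere. Schur polynomials are
defined here by branching. The bialternant formula follows by peeling one variable off the alternant
(`det_alternant_succ`). For `a k = z t ^ k` the alternant becomes a Vandermonde determinant, so the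
specialised Schur polynomial is an explicit product. Passing from `n₁` to `n₂` variables produces
the ratios of `qPoch`. Collecting constants gives (1).

In the limit every factor `1 - t ^ c` with `c` fixed is asymptotic to `c / L`. Counting such factors
above and below shows that exactly `L ^ (2 n₁)` is needed (`power_count`).

For the total mass, the points `x` interlacing with a given `y` form a product of intervals, and the
`x`-dependence of the density is a determinant of exponentials. Row operations turn its integral
into the same determinant at `y` (`integral_det_exp_box`). What remains is the Jacobi weight with a
squared Vandermonde product. Andréief's identity reduces this to a determinant of Beta integrals,
which a suitable polynomial basis turns into a determinant of Gamma values (`det_beta`). The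
constant obtained is the inverse of `limitConst` after the factor of the first integration is
included.

The last claim is the substitution `u = exp (-v)` in every coordinate. Its normalisation costs
nothing, since the mass is already known to be `1`. -/

open scoped ENNReal

namespace LPP

/-- Row number `k` of a tableau; it is empty beyond the last row. -/
def row {β : Type*} (T : List (List β)) (k : ℕ) : List β := T.getD k []

theorem row_tail {β : Type*} (T : List (List β)) (k : ℕ) : row T.tail k = row T (k + 1) := by
  cases T <;> simp [row]

/-! ### Inserting words into rows and tableaux. -/

section RowInsertion

variable {β : Type*} [LinearOrder β]

theorem rowInsert_cases (a : β) (R : List β) :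
    ((∀ c ∈ R, c ≤ a) ∧ rowInsert a R = (R ++ [a], none)) ∨
    ∃ R₁ b R₂, R = R₁ ++ b :: R₂ ∧ (∀ c ∈ R₁, c ≤ a) ∧ a < b ∧
      rowInsert a R = (R₁ ++ a :: R₂, some b) := by
  induction R with
  | nil => left; simp [rowInsert]
  | cons c R ih =>
    by_cases h : a < c
    · right
      exact ⟨[], c, R, by simp, by simp, h, by simp [rowInsert, h]⟩
    · rcases ih with ⟨h1, h2⟩ | ⟨R₁, b, R₂, h1, h2, h3, h4⟩
      · left
        refine ⟨by simpa using ⟨not_lt.1 h, h1⟩, by simp [rowInsert, h, h2]⟩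
      · right
        refine ⟨c :: R₁, b, R₂, by simp [h1], by simpa using ⟨not_lt.1 h, h2⟩, h3, ?_⟩
        simp only [rowInsert, h, if_false, h4, List.cons_append]

theorem rowInsert_ne_nil (a : β) (R : List β) : (rowInsert a R).1 ≠ [] := by
  rcases rowInsert_cases a R with ⟨-, h⟩ | ⟨R₁, b, R₂, -, -, -, h⟩ <;> simp [h]

theorem rowInsert_perm (a : β) (R : List β) :
    (a :: R).Perm ((rowInsert a R).1 ++ (rowInsert a R).2.toList) := by
  rcases rowInsert_cases a R with ⟨-, h⟩ | ⟨R₁, b, R₂, hR, -, -, h⟩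
  · simpa [h] using (List.perm_append_singleton a R).symm
  · rw [h, hR, List.perm_iff_count]
    intro x
    simp only [List.count_append, List.count_cons, Option.toList, List.count_nil]
    omega

theorem pairwise_rowInsert (a : β) {R : List β} (hR : R.Pairwise (· ≤ ·)) :
    (rowInsert a R).1.Pairwise (· ≤ ·) := by
  rcases rowInsert_cases a R with ⟨h1, h⟩ | ⟨R₁, b, R₂, rfl, h1, h2, h⟩
  · rw [h, List.pairwise_append]
    exact ⟨hR, by simp, by simpa using h1⟩
  · rw [h]
    simp only [List.pairwise_append, List.pairwise_cons, List.mem_cons] at hR ⊢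
    refine ⟨hR.1, ⟨fun c hc => (h2.le.trans (hR.2.1.1 c hc)), hR.2.1.2⟩, ?_⟩
    rintro c hc d (rfl | hd)
    · exact h1 c hc
    · exact hR.2.2 c hc d (Or.inr hd)

theorem mem_rowInsert {a c : β} {R : List β} (h : c ∈ (rowInsert a R).1) : c = a ∨ c ∈ R := by
  have := (rowInsert_perm a R).mem_iff (a := c)
  simp only [List.mem_cons, List.mem_append] at this
  exact this.2 (Or.inl h)

/-- Row insertion of a word; the second component is the word bumped out. -/
def rowWord : List β → List β → List β × List β
  | R, [] => (R, [])
  | R, a :: w => ((rowWord (rowInsert a R).1 w).1,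
      (rowInsert a R).2.toList ++ (rowWord (rowInsert a R).1 w).2)

theorem rowWord_perm (R w : List β) :
    (R ++ w).Perm ((rowWord R w).1 ++ (rowWord R w).2) := by
  induction w generalizing R with
  | nil => simp [rowWord]
  | cons a w ih =>
    have h1 := rowInsert_perm a R
    have h2 := ih (rowInsert a R).1
    rw [List.perm_iff_count] at h1 h2 ⊢
    intro x
    have h1 := h1 x
    have h2 := h2 x
    simp only [rowWord, List.count_append, List.count_cons] at *
    omega

theorem pairwise_rowWord_fst {R : List β} (w : List β) (hR : R.Pairwise (· ≤ ·)) :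
    (rowWord R w).1.Pairwise (· ≤ ·) := by
  induction w generalizing R with
  | nil => simpa [rowWord]
  | cons a w ih => exact ih (pairwise_rowInsert a hR)

/-- A letter bumped by a later `a'` exceeds `a'`, hence exceeds `a`. It cannot be a letter of the
word inserted earlier, because the word is weakly increasing, so it was already in `R`. -/
theorem rowWord_snd_of_forall {p : β → Prop} {a : β} {R w : List β}
    (hw : (a :: w).Pairwise (· ≤ ·)) (hp : ∀ c ∈ R, a < c → p c) :
    ∀ c ∈ (rowWord R w).2, p c := by
  induction w generalizing R a with
  | nil => simp [rowWord]
  | cons a' w ih =>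
    have haa : a ≤ a' := by
      rw [List.pairwise_cons] at hw; exact hw.1 a' (by simp)
    intro c hc
    simp only [rowWord, List.mem_append] at hc
    rcases hc with hc | hc
    · rcases rowInsert_cases a' R with ⟨-, h⟩ | ⟨R₁, b, R₂, hR, -, hb, h⟩
      · simp [h] at hc
      · simp only [h, Option.toList_some, List.mem_singleton] at hc
        subst hc
        exact hp c (by simp [hR]) (haa.trans_lt hb)
    · refine ih (a := a') (List.pairwise_cons.1 hw).2 ?_ c hc
      intro d hd had
      rcases mem_rowInsert hd with rfl | hd
      · exact absurd had (lt_irrefl _)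
      · exact hp d hd (haa.trans_lt had)

/-- After `a` has bumped `b`, every entry of the new row exceeding `a` stands to the right of that
place and is at least `b`, so later bumped letters are at least `b`. Thus the next row again
receives an increasing word, and the analysis of one row iterates. -/
theorem pairwise_rowWord_snd {R w : List β} (hR : R.Pairwise (· ≤ ·))
    (hw : w.Pairwise (· ≤ ·)) : (rowWord R w).2.Pairwise (· ≤ ·) := by
  induction w generalizing R with
  | nil => simp [rowWord]
  | cons a w ih =>
    have ih' := ih (pairwise_rowInsert a hR) (List.pairwise_cons.1 hw).2
    rcases rowInsert_cases a R with ⟨-, h⟩ | ⟨R₁, b, R₂, hR', h1, hb, h⟩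
    · simpa [rowWord, h] using ih'
    · simp only [rowWord, h] at ih' ⊢
      simp only [Option.toList_some, List.singleton_append, List.pairwise_cons]
      refine ⟨rowWord_snd_of_forall (p := fun c => b ≤ c) hw ?_, ih'⟩
      intro c hc hac
      simp only [List.mem_append, List.mem_cons] at hc
      subst hR'
      simp only [List.pairwise_append, List.pairwise_cons] at hR
      rcases hc with hc | rfl | hc
      · exact absurd hac (not_lt.2 (h1 c hc))
      · exact absurd hac (lt_irrefl _)
      · exact hR.2.1.1 c hc

/-- The tableau obtained by inserting a word letter by letter. -/
def tabWord (T : List (List β)) (w : List β) : List (List β) :=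
  w.foldl (fun T a => (tableauInsert T a).1) T

theorem tableauInsert_fst (T : List (List β)) (a : β) :
    (tableauInsert T a).1 = (rowInsert a (row T 0)).1 :: tabWord T.tail
      (rowInsert a (row T 0)).2.toList := by
  cases T with
  | nil => simp [tableauInsert, rowInsert, row, tabWord]
  | cons R T =>
    have : row (R :: T) 0 = R := by simp [row]
    rw [tableauInsert, this]
    rcases rowInsert a R with ⟨R', _ | b⟩ <;> simp [tabWord]

/-- The rows below the first see only the word bumped out of it, in the same order, so insertion can
be reorganised row by row. The word must be nonempty: inserting nothing into the empty tableau
creates no first row. -/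
theorem tabWord_cons (T : List (List β)) (a : β) (w : List β) :
    tabWord T (a :: w) = (rowWord (row T 0) (a :: w)).1 ::
      tabWord T.tail (rowWord (row T 0) (a :: w)).2 := by
  induction w generalizing T a with
  | nil =>
    have : tabWord T [a] = (tableauInsert T a).1 := rfl
    rw [this, tableauInsert_fst]
    simp [rowWord]
  | cons b w ih =>
    have : tabWord T (a :: b :: w) = tabWord (tableauInsert T a).1 (b :: w) := by simp [tabWord]
    rw [this, ih, tableauInsert_fst]
    simp [row, rowWord, tabWord, List.foldl_append]

theorem row_tabWord_zero (T : List (List β)) (w : List β) :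
    row (tabWord T w) 0 = (rowWord (row T 0) w).1 := by
  cases w with
  | nil => simp [tabWord, rowWord]
  | cons a w => rw [tabWord_cons]; simp [row]

theorem row_tabWord_succ (T : List (List β)) (w : List β) (k : ℕ) :
    row (tabWord T w) (k + 1) = row (tabWord T.tail (rowWord (row T 0) w).2) k := by
  cases w with
  | nil => simp [tabWord, rowWord, row_tail]
  | cons a w => rw [tabWord_cons]; simp [row]

theorem pairwise_row_tabWord {T : List (List β)} {w : List β}
    (hT : ∀ k, (row T k).Pairwise (· ≤ ·)) (k : ℕ) :
    (row (tabWord T w) k).Pairwise (· ≤ ·) := by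
  induction k generalizing T w with
  | zero => rw [row_tabWord_zero]; exact pairwise_rowWord_fst _ (hT 0)
  | succ k ih =>
    rw [row_tabWord_succ]
    exact ih fun k => by rw [row_tail]; exact hT _

theorem tabWord_ne_nil {T : List (List β)} {w : List β} (hT : ∀ R ∈ T, R ≠ []) :
    ∀ R ∈ tabWord T w, R ≠ [] := by
  have key : ∀ (T : List (List β)) (a : β), (∀ R ∈ T, R ≠ []) →
      ∀ R ∈ (tableauInsert T a).1, R ≠ [] := by
    intro T
    induction T with
    | nil => simp [tableauInsert]
    | cons R T ih =>
      intro a hT S hS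
      rw [tableauInsert_fst] at hS
      rcases List.mem_cons.1 hS with rfl | hS
      · exact rowInsert_ne_nil _ _
      · simp only [List.mem_cons, forall_eq_or_imp] at hT
        cases hb : (rowInsert a (row (R :: T) 0)).2 with
        | none => rw [hb] at hS; exact hT.2 S hS
        | some b => rw [hb] at hS; exact ih b hT.2 S hS
  induction w generalizing T with
  | nil => exact hT
  | cons a w ih => exact ih (key T a hT)

theorem map_length_recordBox {γ : Type*} (P : List (List β)) (Q : List (List γ)) (a : β) (c : γ)
    (h : Q.map List.length = P.map List.length) :
    (recordBox Q (tableauInsert P a).2 c).map List.length =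
      (tableauInsert P a).1.map List.length := by
  induction P generalizing Q a with
  | nil =>
    have : Q = [] := by simpa using h
    subst this; simp [tableauInsert, recordBox]
  | cons R P ih =>
    cases Q with
    | nil => simp at h
    | cons S Q =>
      simp only [List.map_cons, List.cons.injEq] at h
      have hp := (rowInsert_perm a R).length_eq
      rw [tableauInsert]
      rcases hr : rowInsert a R with ⟨R', _ | b⟩
      · rw [hr] at hp
        simp [recordBox, h] at hp ⊢
        omega
      · rw [hr] at hp
        simp [recordBox, h, ih Q b h.2] at hp ⊢
        omega

end RowInsertion

/-! ### Letter counts and the max-plus recursion for insertion. -/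

section Counts

variable {n : ℕ}

/-- The number of letters of a word that are less than `l`. -/
def cntLT (R : List (Fin n)) (l : ℕ) : ℕ := R.countP fun b : Fin n => decide ((b : ℕ) < l)

/-- The number of letters of a word that are equal to `l`. -/
def cntEq (R : List (Fin n)) (l : ℕ) : ℕ := R.countP fun b : Fin n => decide ((b : ℕ) = l)

@[simp] theorem cntLT_cons (a : Fin n) (R : List (Fin n)) (l : ℕ) :
    cntLT (a :: R) l = cntLT R l + if (a : ℕ) < l then 1 else 0 := by
  simp [cntLT, List.countP_cons]

@[simp] theorem cntEq_cons (a : Fin n) (R : List (Fin n)) (l : ℕ) :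
    cntEq (a :: R) l = cntEq R l + if (a : ℕ) = l then 1 else 0 := by
  simp [cntEq, List.countP_cons]

@[simp] theorem cntLT_nil (l : ℕ) : cntLT ([] : List (Fin n)) l = 0 := rfl

@[simp] theorem cntEq_nil (l : ℕ) : cntEq ([] : List (Fin n)) l = 0 := rfl

@[simp] theorem cntLT_append (R S : List (Fin n)) (l : ℕ) :
    cntLT (R ++ S) l = cntLT R l + cntLT S l := List.countP_append

@[simp] theorem cntEq_append (R S : List (Fin n)) (l : ℕ) :
    cntEq (R ++ S) l = cntEq R l + cntEq S l := List.countP_append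

theorem cntLT_succ (R : List (Fin n)) (l : ℕ) : cntLT R (l + 1) = cntLT R l + cntEq R l := by
  induction R with
  | nil => rfl
  | cons a R ih => simp only [cntLT_cons, cntEq_cons, ih]; split_ifs <;> omega

theorem cntLT_mono (R : List (Fin n)) : Monotone (cntLT R) :=
  monotone_nat_of_le_succ fun l => by rw [cntLT_succ]; omega

@[simp] theorem cntLT_zero (R : List (Fin n)) : cntLT R 0 = 0 := by simp [cntLT]

theorem cntLT_eq_length (R : List (Fin n)) : cntLT R n = R.length := by
  simp [cntLT]

theorem cntLT_eq_length_of_forall {R : List (Fin n)} {l : ℕ} (h : ∀ b ∈ R, (b : ℕ) < l) :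
    cntLT R l = R.length := by
  rw [cntLT, List.countP_eq_length]; simpa using h

theorem cntLT_eq_zero_of_forall {R : List (Fin n)} {l : ℕ} (h : ∀ b ∈ R, l ≤ (b : ℕ)) :
    cntLT R l = 0 := by
  rw [cntLT, List.countP_eq_zero]; simpa using h

theorem cntEq_eq_zero_of_forall {R : List (Fin n)} {l : ℕ} (h : ∀ b ∈ R, (b : ℕ) ≠ l) :
    cntEq R l = 0 := by
  rw [cntEq, List.countP_eq_zero]; simpa using h

/-- For `l > a` the count rises exactly when the row has no letter strictly between `a` and `l`,
that is, when `cntLT R l = cntLT R (a + 1)`. Otherwise `a` replaces a letter that was already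
counted. -/
theorem cntLT_rowInsert {R : List (Fin n)} (hR : R.Pairwise (· ≤ ·)) (a : Fin n) (l : ℕ) :
    cntLT (rowInsert a R).1 l =
      if l ≤ a then cntLT R l else max (cntLT R l) (cntLT R (a + 1) + 1) := by
  rcases rowInsert_cases a R with ⟨h1, h⟩ | ⟨R₁, b, R₂, rfl, h1, h2, h⟩
  · rw [h]
    split_ifs with hl
    · simp [hl]
    · have e1 : cntLT R l = R.length := cntLT_eq_length_of_forall fun c hc =>
        lt_of_le_of_lt (Fin.le_def.1 (h1 c hc)) (not_le.1 hl)
      have e2 : cntLT R (a + 1) = R.length := cntLT_eq_length_of_forall fun c hc =>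
        Nat.lt_succ_of_le (Fin.le_def.1 (h1 c hc))
      have : (a : ℕ) < l := not_le.1 hl
      simp [e1, e2, this]
  · rw [h]
    have hab : (a : ℕ) < b := h2
    simp only [List.pairwise_append, List.pairwise_cons] at hR
    have e0 : ∀ c ∈ R₂, (b : ℕ) ≤ c := fun c hc => hR.2.1.1 c hc
    have e1 : ∀ l, (a : ℕ) < l → cntLT R₁ l = R₁.length := fun l hl =>
      cntLT_eq_length_of_forall fun c hc => lt_of_le_of_lt (Fin.le_def.1 (h1 c hc)) hl
    have e2 : ∀ l, l ≤ (b : ℕ) → cntLT R₂ l = 0 := fun l hl =>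
      cntLT_eq_zero_of_forall fun c hc => hl.trans (e0 c hc)
    simp only [cntLT_append, cntLT_cons]
    split_ifs <;> try omega
    · rw [e1 l (by omega), e1 (a + 1) (by omega), e2 (a + 1) (by omega)]
      omega
    · rw [e1 l (by omega), e1 (a + 1) (by omega), e2 (a + 1) (by omega), e2 l (by omega)]
      omega

/-- The last-passage recursion, by induction on the word. Its first letter `a` is the smallest:
counts up to level `a` never change (`hlow`), the new letter is absorbed at `l = a`, and above `a`
the increment from `cntLT_rowInsert` is already dominated by the count of the final row at `l`. -/
theorem cntLT_rowWord {R w : List (Fin n)} (hR : R.Pairwise (· ≤ ·)) (hw : w.Pairwise (· ≤ ·))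
    (l : ℕ) :
    cntLT (rowWord R w).1 (l + 1) =
      max (cntLT R (l + 1)) (cntLT (rowWord R w).1 l) + cntEq w l := by
  induction w generalizing R l with
  | nil =>
    simp only [rowWord, cntEq_nil, add_zero]
    exact (max_eq_left (cntLT_mono R (Nat.le_succ l))).symm
  | cons a w ih =>
    rw [List.pairwise_cons] at hw
    have ih := ih (pairwise_rowInsert a hR) hw.2
    simp only [rowWord, cntEq_cons]
    set R₁ := (rowInsert a R).1 with hR₁
    set R' := (rowWord R₁ w).1
    have hwz : ∀ l, l < (a : ℕ) → cntEq w l = 0 := fun l hl =>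
      cntEq_eq_zero_of_forall fun b hb => by
        have := Fin.le_def.1 (hw.1 b hb); omega
    have hR1 := cntLT_rowInsert hR a
    rw [← hR₁] at hR1
    have hlow : ∀ l, l ≤ (a : ℕ) → cntLT R' l = cntLT R l := by
      intro l
      induction l with
      | zero => simp
      | succ l ihl =>
        intro hl
        rw [ih, ihl (by omega), hwz l (by omega), hR1, if_pos hl]
        have := cntLT_mono R (Nat.le_succ l)
        simp only [Nat.succ_eq_add_one] at this
        omega
    have hm := cntLT_mono R (Nat.le_succ l)
    simp only [Nat.succ_eq_add_one] at hm
    have h1 := hR1 (l + 1)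
    rw [ih l]
    rcases lt_trichotomy l (a : ℕ) with hl | hl | hl
    · rw [h1, if_pos (by omega), if_neg (by omega), add_zero]
    · rw [h1, if_neg (by omega), if_pos hl.symm, hlow l hl.le]
      subst hl; omega
    · rw [h1, if_neg (by omega), if_neg (by omega)]
      have h2 := ih a
      have h3 := hR1 (a + 1)
      rw [if_neg (by omega)] at h3
      have h4 := cntLT_mono R' (Nat.succ_le_of_lt hl)
      simp only [Nat.succ_eq_add_one] at h4
      omega

/-- Letters are conserved: the `l`'s of the row and of the word are those of the new row and of the
bumped word. Combined with `cntLT_rowWord`, the maximum turns into a minimum. -/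
theorem cntEq_rowWord_snd {R w : List (Fin n)} (hR : R.Pairwise (· ≤ ·))
    (hw : w.Pairwise (· ≤ ·)) (l : ℕ) :
    cntEq (rowWord R w).2 l =
      min (cntLT R (l + 1)) (cntLT (rowWord R w).1 l) - cntLT R l := by
  have h1 := cntLT_rowWord hR hw l
  have h2 : cntEq (R ++ w) l = cntEq ((rowWord R w).1 ++ (rowWord R w).2) l :=
    (rowWord_perm R w).countP_eq _
  rw [cntEq_append, cntEq_append] at h2
  have h3 := cntLT_succ R l
  have h4 := cntLT_succ (rowWord R w).1 l
  omega

theorem cntLT_row_tabWord_zero {T : List (List (Fin n))} {w : List (Fin n)}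
    (hT : ∀ k, (row T k).Pairwise (· ≤ ·)) (hw : w.Pairwise (· ≤ ·)) (l : ℕ) :
    cntLT (row (tabWord T w) 0) (l + 1) =
      max (cntLT (row T 0) (l + 1)) (cntLT (row (tabWord T w) 0) l) + cntEq w l := by
  rw [row_tabWord_zero]; exact cntLT_rowWord (hT 0) hw l

theorem cntLT_row_tabWord_succ {T : List (List (Fin n))} {w : List (Fin n)}
    (hT : ∀ k, (row T k).Pairwise (· ≤ ·)) (hw : w.Pairwise (· ≤ ·)) (k l : ℕ) :
    cntLT (row (tabWord T w) (k + 1)) (l + 1) =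
      max (cntLT (row T (k + 1)) (l + 1)) (cntLT (row (tabWord T w) (k + 1)) l) +
        (min (cntLT (row T k) (l + 1)) (cntLT (row (tabWord T w) k) l) - cntLT (row T k) l) := by
  induction k generalizing T w with
  | zero =>
    rw [row_tabWord_succ, row_tabWord_zero, row_tabWord_zero, ← row_tail,
      cntLT_rowWord (by rw [row_tail]; exact hT _) (pairwise_rowWord_snd (hT 0) hw),
      cntEq_rowWord_snd (hT 0) hw]
  | succ k ih =>
    rw [row_tabWord_succ T w (k + 1), row_tabWord_succ T w k, ← row_tail T (k + 1), ← row_tail T k]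
    exact ih (fun k => by rw [row_tail]; exact hT _) (pairwise_rowWord_snd (hT 0) hw)

end Counts

/-! ### RSK shapes as the vertices of a growth diagram. -/

section Grid

/-- The local rule of the RSK growth diagram. -/
noncomputable def loc (l m v : ℕ →₀ ℕ) (x : ℕ) : ℕ →₀ ℕ :=
  m ⊔ v + Finsupp.single 0 x + Finsupp.mapDomain Nat.succ (m ⊓ v - l)

theorem loc_zero (l m v : ℕ →₀ ℕ) (x : ℕ) : loc l m v x 0 = max (m 0) (v 0) + x := by
  simp [loc, Finsupp.mapDomain_of_notMem_range]

theorem loc_succ (l m v : ℕ →₀ ℕ) (x k : ℕ) :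
    loc l m v x (k + 1) = max (m (k + 1)) (v (k + 1)) + (min (m k) (v k) - l k) := by
  simp [loc, ← Nat.succ_eq_add_one, Finsupp.mapDomain_apply Nat.succ_injective]

/-- The RSK growth diagram of an array. -/
noncomputable def grid (X : ℕ → ℕ → ℕ) : ℕ → ℕ → (ℕ →₀ ℕ)
  | 0, _ => 0
  | _ + 1, 0 => 0
  | i + 1, j + 1 => loc (grid X i j) (grid X i (j + 1)) (grid X (i + 1) j) (X i j)

theorem grid_zero_right (X : ℕ → ℕ → ℕ) (i : ℕ) : grid X i 0 = 0 := by
  cases i <;> simp [grid]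

theorem grid_succ_succ (X : ℕ → ℕ → ℕ) (i j : ℕ) : grid X (i + 1) (j + 1) =
    loc (grid X i j) (grid X i (j + 1)) (grid X (i + 1) j) (X i j) := by
  rw [grid]

/-- The word of a row of the matrix. -/
def rowLetters {n : ℕ} (f : Fin n → ℕ) : List (Fin n) :=
  (List.finRange n).flatMap fun j => List.replicate (f j) j

theorem pairwise_rowLetters {n : ℕ} (f : Fin n → ℕ) : (rowLetters f).Pairwise (· ≤ ·) := by
  rw [rowLetters, List.pairwise_flatMap]
  refine ⟨fun j _ => by simp [List.pairwise_replicate], ?_⟩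
  refine (List.pairwise_lt_finRange n).imp ?_
  intro a b hab x hx y hy
  rw [List.eq_of_mem_replicate hx, List.eq_of_mem_replicate hy]
  exact hab.le

theorem cntEq_rowLetters {n : ℕ} (f : Fin n → ℕ) (l : Fin n) : cntEq (rowLetters f) l = f l := by
  have h : cntEq (rowLetters f) l = ((List.finRange n).map fun j => if j = l then f j else 0).sum := by
    rw [cntEq, rowLetters, List.countP_flatMap]
    congr 1
    refine List.map_congr_left fun j _ => ?_
    simp [List.countP_replicate, Fin.ext_iff]
  rw [h, ← Fin.sum_univ_def]
  simp

theorem map_snd_biword {m n : ℕ} (x : Matrix (Fin m) (Fin n) ℕ) :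
    (biword x).map Prod.snd = (List.finRange m).flatMap fun i => rowLetters (x i) := by
  simp [biword, rowLetters, List.map_flatMap]

theorem rsk_fst {m n : ℕ} (x : Matrix (Fin m) (Fin n) ℕ) :
    (rsk x).1 = tabWord [] ((biword x).map Prod.snd) := by
  rw [rsk, tabWord, List.foldl_map]
  suffices ∀ (l : List (Fin m × Fin n)) (PQ : List (List (Fin n)) × List (List (Fin m))),
      (l.foldl (fun PQ p =>
        ((tableauInsert PQ.1 p.2).1, recordBox PQ.2 (tableauInsert PQ.1 p.2).2 p.1)) PQ).1 =
      l.foldl (fun T p => (tableauInsert T p.2).1) PQ.1 from this _ _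
  intro l
  induction l with
  | nil => simp
  | cons p l ih => intro PQ; simp [ih]

theorem rsk_shape_eq {m n : ℕ} (x : Matrix (Fin m) (Fin n) ℕ) :
    (rsk x).2.map List.length = (rsk x).1.map List.length := by
  rw [rsk]
  suffices ∀ (l : List (Fin m × Fin n)) (PQ : List (List (Fin n)) × List (List (Fin m))),
      PQ.2.map List.length = PQ.1.map List.length →
      (l.foldl (fun PQ p =>
        ((tableauInsert PQ.1 p.2).1, recordBox PQ.2 (tableauInsert PQ.1 p.2).2 p.1)) PQ).2.map
          List.length =
      (l.foldl (fun PQ p =>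
        ((tableauInsert PQ.1 p.2).1, recordBox PQ.2 (tableauInsert PQ.1 p.2).2 p.1)) PQ).1.map
          List.length from this _ _ rfl
  intro l
  induction l with
  | nil => intro PQ h; simpa using h
  | cons p l ih =>
    intro PQ h
    exact ih _ (map_length_recordBox PQ.1 PQ.2 p.2 p.1 h)

theorem rsk_fst_succ {m n : ℕ} (x : Matrix (Fin (m + 1)) (Fin n) ℕ) :
    (rsk x).1 = tabWord (rsk (Matrix.of fun (i : Fin m) j => x i.castSucc j)).1
      (rowLetters (x (Fin.last m))) := by
  simp only [rsk_fst, map_snd_biword, List.finRange_succ_last, List.flatMap_append,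
    List.flatMap_map, tabWord, List.foldl_append]
  simp only [List.flatMap_cons, List.flatMap_nil, List.append_nil]
  rfl

theorem pairwise_row_rsk {m n : ℕ} (x : Matrix (Fin m) (Fin n) ℕ) (k : ℕ) :
    (row (rsk x).1 k).Pairwise (· ≤ ·) := by
  rw [rsk_fst]
  exact pairwise_row_tabWord (by simp [row]) k

/-- The vertex `(m, l)` of the growth diagram is the shape formed by the entries below `l` after `m`
rows of the matrix. The induction runs over rows and then over letters. The array `X` may be
anything outside the matrix, which is why `l ≤ n` is required. -/
theorem cntLT_row_rsk {m n : ℕ} (x : Matrix (Fin m) (Fin n) ℕ) (X : ℕ → ℕ → ℕ)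
    (hX : ∀ i j, x i j = X i j) (l : ℕ) (hl : l ≤ n) (k : ℕ) :
    cntLT (row (rsk x).1 k) l = grid X m l k := by
  induction m generalizing l k with
  | zero =>
    have : (rsk x).1 = [] := by simp [rsk_fst, map_snd_biword, tabWord]
    simp [this, row, grid]
  | succ m ih =>
    have ih := ih (Matrix.of fun i j => x i.castSucc j) (by simp [hX])
    have hT := pairwise_row_rsk (Matrix.of fun (i : Fin m) j => x i.castSucc j)
    rw [rsk_fst_succ]
    set T := (rsk (Matrix.of fun (i : Fin m) j => x i.castSucc j)).1
    have hw := pairwise_rowLetters (x (Fin.last m))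
    induction l generalizing k with
    | zero => simp [grid_zero_right]
    | succ l ihl =>
      rw [grid_succ_succ]
      cases k with
      | zero =>
        rw [cntLT_row_tabWord_zero hT hw, loc_zero, ihl (by omega), ih _ hl]
        have := cntEq_rowLetters (x (Fin.last m)) ⟨l, by omega⟩
        simp only at this
        rw [this, hX]; simp
      | succ k =>
        rw [cntLT_row_tabWord_succ hT hw, loc_succ, ihl (by omega), ih _ hl, ihl (by omega), ih _ hl,
          ih _ (by omega)]

theorem length_row_rsk {m n : ℕ} (x : Matrix (Fin m) (Fin n) ℕ) (X : ℕ → ℕ → ℕ)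
    (hX : ∀ i j, x i j = X i j) (k : ℕ) : (row (rsk x).1 k).length = grid X m n k := by
  rw [← cntLT_row_rsk x X hX n le_rfl, cntLT_eq_length]

/-- The row lengths of a Young diagram. -/
noncomputable def parts (μ : YoungDiagram) : ℕ →₀ ℕ :=
  Finsupp.onFinset (Finset.range (μ.colLen 0)) μ.rowLen fun k hk => by
    rw [Finset.mem_range, ← YoungDiagram.mem_iff_lt_colLen, YoungDiagram.mem_iff_lt_rowLen]
    omega

@[simp] theorem parts_apply (μ : YoungDiagram) (k : ℕ) : parts μ k = μ.rowLen k := rfl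

/-- `getD` with default `0` does not distinguish the end of a list from trailing zeros, and
positivity of the entries excludes the latter. For tableaux this is the absence of empty rows
(`tabWord_ne_nil`). -/
theorem list_eq_of_getD_eq {l₁ l₂ : List ℕ} (h₁ : ∀ a ∈ l₁, a ≠ 0) (h₂ : ∀ a ∈ l₂, a ≠ 0)
    (h : ∀ k, l₁.getD k 0 = l₂.getD k 0) : l₁ = l₂ := by
  have key : ∀ (l₁ l₂ : List ℕ), (∀ a ∈ l₁, a ≠ 0) → (∀ k, l₁.getD k 0 = l₂.getD k 0) →
      l₁.length ≤ l₂.length := by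
    intro l₁ l₂ h₁ h
    by_contra! hlt
    have h' := h l₂.length
    rw [List.getD_eq_getElem _ _ hlt, List.getD_eq_default _ _ le_rfl] at h'
    exact h₁ _ (List.getElem_mem hlt) h'
  refine List.ext_getElem (le_antisymm (key _ _ h₁ h) (key _ _ h₂ fun k => (h k).symm)) ?_
  intro k hk₁ hk₂
  have := h k
  rwa [List.getD_eq_getElem _ _ hk₁, List.getD_eq_getElem _ _ hk₂] at this

theorem getD_rowLens (μ : YoungDiagram) (k : ℕ) : μ.rowLens.getD k 0 = μ.rowLen k := by
  by_cases hk : k < μ.rowLens.length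
  · rw [List.getD_eq_getElem _ _ hk, YoungDiagram.get_rowLens]
  · rw [List.getD_eq_default _ _ (not_lt.1 hk)]
    rw [YoungDiagram.length_rowLens, ← YoungDiagram.mem_iff_lt_colLen,
      YoungDiagram.mem_iff_lt_rowLen] at hk
    omega

theorem hasRSKShape_iff {m n : ℕ} (x : Matrix (Fin m) (Fin n) ℕ) (X : ℕ → ℕ → ℕ)
    (hX : ∀ i j, x i j = X i j) (μ : YoungDiagram) :
    HasRSKShape x μ ↔ grid X m n = parts μ := by
  rw [HasRSKShape, rsk_shape_eq, and_self]
  have hrow : ∀ k, ((rsk x).1.map List.length).getD k 0 = grid X m n k := by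
    intro k
    rw [← length_row_rsk x X hX, row]
    have := List.getD_map (l := (rsk x).1) (d := []) (n := k) (f := List.length)
    simpa using this
  constructor
  · intro h
    ext k
    rw [← hrow, h, getD_rowLens, parts_apply]
  · intro h
    refine list_eq_of_getD_eq ?_ ?_ fun k => ?_
    · intro a ha
      rw [List.mem_map] at ha
      obtain ⟨R, hR, rfl⟩ := ha
      rw [rsk_fst] at hR
      have := tabWord_ne_nil (by simp) R hR
      simpa using this
    · intro a ha
      exact (YoungDiagram.pos_of_mem_rowLens μ a ha).ne'
    · rw [hrow, h, getD_rowLens, parts_apply]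

end Grid

end LPP

namespace LPP

/-! ### Horizontal strips and the local bijection. -/

section Strips

/-- The shape obtained by deleting the first row. -/
noncomputable def deleteRow (μ : ℕ →₀ ℕ) : ℕ →₀ ℕ :=
  Finsupp.comapDomain Nat.succ μ Nat.succ_injective.injOn

theorem deleteRow_apply (μ : ℕ →₀ ℕ) (k : ℕ) : deleteRow μ k = μ (k + 1) := rfl

/-- The shapes `l` such that `μ / l` is a horizontal strip. -/
noncomputable def strips (μ : ℕ →₀ ℕ) : Finset (ℕ →₀ ℕ) := Finset.Icc (deleteRow μ) μ

theorem mem_strips {l μ : ℕ →₀ ℕ} : l ∈ strips μ ↔ ∀ k, μ (k + 1) ≤ l k ∧ l k ≤ μ k := by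
  rw [strips, Finset.mem_Icc, Finsupp.le_def, Finsupp.le_def, ← forall_and]
  rfl

theorem mem_strips_zero {l : ℕ →₀ ℕ} : l ∈ strips 0 ↔ l = 0 := by
  rw [mem_strips]
  constructor
  · intro h; ext k; simpa using (h k).2
  · rintro rfl; simp

theorem degree_le_of_mem_strips {l μ : ℕ →₀ ℕ} (h : l ∈ strips μ) : l.degree ≤ μ.degree :=
  Finsupp.degree_mono (Finset.mem_Icc.1 h).2

theorem loc_comm (l m v : ℕ →₀ ℕ) (x : ℕ) : loc l m v x = loc l v m x := by
  rw [loc, loc, sup_comm, inf_comm]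

theorem mem_strips_loc_left {l m v : ℕ →₀ ℕ} (hm : l ∈ strips m) (hv : l ∈ strips v) (x : ℕ) :
    m ∈ strips (loc l m v x) := by
  rw [mem_strips] at *
  intro k
  have h1 := hm k
  have h2 := hv k
  rw [loc_succ]
  cases k with
  | zero => rw [loc_zero]; omega
  | succ k => rw [loc_succ]; omega

theorem mem_strips_loc_right {l m v : ℕ →₀ ℕ} (hm : l ∈ strips m) (hv : l ∈ strips v) (x : ℕ) :
    v ∈ strips (loc l m v x) := by
  rw [mem_strips] at *
  intro k
  have h1 := hm k
  have h2 := hv k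
  rw [loc_succ]
  cases k with
  | zero => rw [loc_zero]; omega
  | succ k => rw [loc_succ]; omega

theorem degree_loc {l m v : ℕ →₀ ℕ} (hm : l ∈ strips m) (hv : l ∈ strips v) (x : ℕ) :
    (loc l m v x).degree + l.degree = m.degree + v.degree + x := by
  have h1 : l ≤ m ⊓ v := le_inf (Finset.mem_Icc.1 hm).2 (Finset.mem_Icc.1 hv).2
  have h2 : (m ⊓ v - l).degree + l.degree = (m ⊓ v).degree := by
    rw [← map_add, tsub_add_cancel_of_le h1]
  have h3 : (m ⊔ v).degree + (m ⊓ v).degree = m.degree + v.degree := by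
    rw [← map_add, ← map_add]
    congr 1
    ext k
    simp
  rw [loc, map_add, map_add, Finsupp.degree_single, Finsupp.degree_mapDomain]
  omega

/-- With `m` and `v` known, coordinate `k + 1` of the new shape determines `l k` and coordinate `0`
determines `x`. The subtraction in `loc` loses nothing because `l ≤ m ⊓ v`. -/
theorem loc_injective {l l' m v : ℕ →₀ ℕ} {x x' : ℕ} (hm : l ∈ strips m) (hv : l ∈ strips v)
    (hm' : l' ∈ strips m) (hv' : l' ∈ strips v) (h : loc l m v x = loc l' m v x') :
    l = l' ∧ x = x' := by
  rw [mem_strips] at *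
  constructor
  · ext k
    have := DFunLike.congr_fun h (k + 1)
    rw [loc_succ, loc_succ] at this
    have h1 := hm k
    have h2 := hv k
    have h3 := hm' k
    have h4 := hv' k
    omega
  · have := DFunLike.congr_fun h 0
    rw [loc_zero, loc_zero] at this
    omega

theorem exists_loc_eq {m v ν : ℕ →₀ ℕ} (hm : m ∈ strips ν) (hv : v ∈ strips ν) :
    ∃ l x, l ∈ strips m ∧ l ∈ strips v ∧ loc l m v x = ν := by
  rw [mem_strips] at hm hv
  have hl : ∀ k, ((m ⊓ v) - deleteRow (ν - m ⊔ v)) k =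
      min (m k) (v k) - (ν (k + 1) - max (m (k + 1)) (v (k + 1))) := by
    intro k; simp [deleteRow_apply]
  -- The local rule solved for its unknowns: coordinate `k + 1` gives `l k`, coordinate `0` gives
  -- `x`.
  refine ⟨(m ⊓ v) - deleteRow (ν - m ⊔ v), ν 0 - max (m 0) (v 0), ?_, ?_, ?_⟩
  · rw [mem_strips]; intro k; rw [hl]
    have := hm k; have := hv k; have := hm (k + 1); have := hv (k + 1); omega
  · rw [mem_strips]; intro k; rw [hl]
    have := hm k; have := hv k; have := hm (k + 1); have := hv (k + 1); omega
  · ext k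
    cases k with
    | zero => rw [loc_zero]; have := hm 0; have := hv 0; omega
    | succ k =>
      rw [loc_succ, hl]
      have := hm k; have := hv k; have := hm (k + 1); have := hv (k + 1); omega

/-- The weight of a horizontal strip in one variable. -/
noncomputable def stripWt (a : ℝ≥0∞) (l μ : ℕ →₀ ℕ) : ℝ≥0∞ :=
  if l ∈ strips μ then a ^ (μ.degree - l.degree) else 0

theorem stripWt_zero (a : ℝ≥0∞) (l : ℕ →₀ ℕ) : stripWt a l 0 = if l = 0 then 1 else 0 := by
  rw [stripWt]
  simp only [mem_strips_zero]
  split_ifs with h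
  · simp
  · rfl

/-- The skew Cauchy identity in one variable on each side. `(l, x) ↦ loc l m v x` is a bijection
between the supports, and `degree_loc` shows that it preserves weights. The values lie in `ℝ≥0∞`, so
no convergence condition is needed. -/
theorem tsum_loc (m v : ℕ →₀ ℕ) (a b : ℝ≥0∞) (G : (ℕ →₀ ℕ) → ℝ≥0∞) :
    ∑' l, ∑' x : ℕ, stripWt b l v * stripWt a l m * (a * b) ^ x * G (loc l m v x) =
      ∑' ν, stripWt a v ν * stripWt b m ν * G ν := by
  set f : (ℕ →₀ ℕ) → ℝ≥0∞ := fun ν => stripWt a v ν * stripWt b m ν * G ν with hf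
  set g : (ℕ →₀ ℕ) × ℕ → ℝ≥0∞ := fun p =>
    stripWt b p.1 v * stripWt a p.1 m * (a * b) ^ p.2 * G (loc p.1 m v p.2) with hg
  have hgs : ∀ p, g p ≠ 0 → p.1 ∈ strips m ∧ p.1 ∈ strips v := by
    intro p hp
    constructor
    · by_contra h; apply hp; simp [hg, stripWt, h]
    · by_contra h; apply hp; simp [hg, stripWt, h]
  have hfs : ∀ p, f p ≠ 0 → m ∈ strips p ∧ v ∈ strips p := by
    intro p hp
    constructor
    · by_contra h; apply hp; simp [hf, stripWt, h]
    · by_contra h; apply hp; simp [hf, stripWt, h]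
  have hfg : ∀ l x, l ∈ strips m → l ∈ strips v → f (loc l m v x) = g (l, x) := by
    intro l x hm hv
    have hd := degree_loc hm hv x
    have h1 := degree_le_of_mem_strips hm
    have h2 := degree_le_of_mem_strips hv
    simp only [hf, hg, stripWt, hm, hv, mem_strips_loc_left hm hv x,
      mem_strips_loc_right hm hv x, if_true]
    congr 1
    have e1 : (loc l m v x).degree - v.degree = m.degree - l.degree + x := by omega
    have e2 : (loc l m v x).degree - m.degree = v.degree - l.degree + x := by omega
    rw [e1, e2, pow_add, pow_add, mul_pow]
    ring
  rw [← ENNReal.tsum_prod (f := fun l x =>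
    stripWt b l v * stripWt a l m * (a * b) ^ x * G (loc l m v x))]
  refine (tsum_eq_tsum_of_ne_zero_bij (f := f) (g := g)
    (fun p => loc p.1.1 m v p.1.2) ?_ ?_ ?_).symm
  · rintro ⟨⟨l, x⟩, hp⟩ ⟨⟨l', x'⟩, hp'⟩ h
    obtain ⟨h1, h2⟩ := hgs _ hp
    obtain ⟨h3, h4⟩ := hgs _ hp'
    obtain ⟨rfl, rfl⟩ := loc_injective h1 h2 h3 h4 h
    rfl
  · intro ν hν
    obtain ⟨h1, h2⟩ := hfs ν hν
    obtain ⟨l, x, h3, h4, rfl⟩ := exists_loc_eq h1 h2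
    refine ⟨⟨(l, x), ?_⟩, rfl⟩
    rw [Function.mem_support, ← hfg l x h3 h4]
    exact hν
  · rintro ⟨⟨l, x⟩, hp⟩
    obtain ⟨h1, h2⟩ := hgs _ hp
    exact hfg l x h1 h2

end Strips

/-! ### Propagating weights through the columns of the growth diagram. -/

section Chains

theorem tsum_fin_succ {α : Type*} {m : ℕ} (f : (Fin (m + 1) → α) → ℝ≥0∞) :
    ∑' C, f C = ∑' C : Fin m → α, ∑' c : α, f (Fin.snoc (α := fun _ => α) C c) := by
  rw [← (Fin.snocEquiv fun _ : Fin (m + 1) => α).tsum_eq f]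
  change ∑' p : α × (Fin m → α), f (Fin.snoc (α := fun _ => α) p.2 p.1) = _
  rw [ENNReal.tsum_prod (f := fun c (C : Fin m → α) => f (Fin.snoc (α := fun _ => α) C c)),
    ENNReal.tsum_comm]

/-- The last shape of a chain, the chain starting at `0`. -/
noncomputable def lastShape : {m : ℕ} → (Fin m → (ℕ →₀ ℕ)) → (ℕ →₀ ℕ)
  | 0, _ => 0
  | m + 1, C => C (Fin.last m)

theorem lastShape_succ {m : ℕ} (C : Fin (m + 1) → (ℕ →₀ ℕ)) : lastShape C = C (Fin.last m) := rfl

/-- The chain of shapes in the next column of the growth diagram. -/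
noncomputable def colStep : {m : ℕ} → (Fin m → (ℕ →₀ ℕ)) → (Fin m → ℕ) → (Fin m → (ℕ →₀ ℕ))
  | 0, C, _ => C
  | m + 1, C, x => Fin.snoc (α := fun _ => ℕ →₀ ℕ)
      (colStep (fun i : Fin m => C i.castSucc) (fun i : Fin m => x i.castSucc))
      (loc (lastShape fun i : Fin m => C i.castSucc) (C (Fin.last m))
        (lastShape (colStep (fun i : Fin m => C i.castSucc) (fun i : Fin m => x i.castSucc)))
        (x (Fin.last m)))

/-- The weight of a chain of shapes: the monomial of the semistandard tableau it encodes. -/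
noncomputable def chainWt (a : ℕ → ℝ≥0∞) : {m : ℕ} → (Fin m → (ℕ →₀ ℕ)) → ℝ≥0∞
  | 0, _ => 1
  | m + 1, C => chainWt a (fun i : Fin m => C i.castSucc) *
      stripWt (a m) (lastShape fun i : Fin m => C i.castSucc) (C (Fin.last m))

/-- `tsum_loc` applied square by square along a column. The chain weight moves from the old column
to the new one, and of the old column only the last shape `κ` survives, joined to the new last shape
by a strip of weight `b`. -/
theorem tsum_colStep (a : ℕ → ℝ≥0∞) (b : ℝ≥0∞) (m : ℕ)
    (H : (ℕ →₀ ℕ) → (Fin m → (ℕ →₀ ℕ)) → ℝ≥0∞) :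
    ∑' C : Fin m → (ℕ →₀ ℕ), ∑' x : Fin m → ℕ,
      chainWt a C * (∏ i : Fin m, (a i * b) ^ x i) * H (lastShape C) (colStep C x) =
    ∑' D : Fin m → (ℕ →₀ ℕ), chainWt a D * ∑' κ, stripWt b κ (lastShape D) * H κ D := by
  induction m with
  | zero =>
    rw [tsum_eq_single default (fun C hC => absurd (Subsingleton.elim _ _) hC),
      tsum_eq_single default (fun C hC => absurd (Subsingleton.elim _ _) hC),
      tsum_eq_single default (fun C hC => absurd (Subsingleton.elim _ _) hC)]
    simp [lastShape, stripWt_zero, chainWt, colStep]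
  | succ m ih =>
    rw [tsum_fin_succ, tsum_fin_succ]
    have hL : ∀ C : Fin m → (ℕ →₀ ℕ), (∑' c : ℕ →₀ ℕ, ∑' x : Fin (m + 1) → ℕ,
        chainWt a (Fin.snoc (α := fun _ => ℕ →₀ ℕ) C c) * (∏ i : Fin (m + 1), (a i * b) ^ x i) *
          H (lastShape (Fin.snoc (α := fun _ => ℕ →₀ ℕ) C c))
            (colStep (Fin.snoc (α := fun _ => ℕ →₀ ℕ) C c) x)) =
        ∑' x : Fin m → ℕ, chainWt a C * (∏ i : Fin m, (a i * b) ^ x i) *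
          (fun l D => ∑' c, ∑' y : ℕ, stripWt (a m) l c * (a m * b) ^ y *
            H c (Fin.snoc (α := fun _ => ℕ →₀ ℕ) D (loc l c (lastShape D) y)))
            (lastShape C) (colStep C x) := by
      intro C
      simp only
      rw [ENNReal.tsum_comm, tsum_fin_succ]
      refine tsum_congr fun x => ?_
      rw [ENNReal.tsum_comm, ← ENNReal.tsum_mul_left]
      refine tsum_congr fun c => ?_
      rw [← ENNReal.tsum_mul_left]
      refine tsum_congr fun y => ?_
      simp only [chainWt, lastShape_succ, colStep, Fin.snoc_castSucc, Fin.snoc_last,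
        Fin.prod_univ_castSucc, Fin.val_castSucc, Fin.val_last]
      ring
    -- The induction hypothesis treats all squares but the last. The last shape and the last entry
    -- of the column are summed inside the test function.
    refine (tsum_congr hL).trans ((ih (fun l D => ∑' c, ∑' y : ℕ, stripWt (a m) l c *
      (a m * b) ^ y * H c (Fin.snoc (α := fun _ => ℕ →₀ ℕ) D (loc l c (lastShape D) y)))).trans ?_)
    refine tsum_congr fun D => ?_
    have h1 : ∀ d, chainWt a (Fin.snoc (α := fun _ => ℕ →₀ ℕ) D d) *
        ∑' κ, stripWt b κ (lastShape (Fin.snoc (α := fun _ => ℕ →₀ ℕ) D d)) *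
          H κ (Fin.snoc (α := fun _ => ℕ →₀ ℕ) D d) =
        chainWt a D * ∑' κ, stripWt (a m) (lastShape D) d * stripWt b κ d *
          H κ (Fin.snoc (α := fun _ => ℕ →₀ ℕ) D d) := by
      intro d
      simp only [chainWt, lastShape_succ, Fin.snoc_castSucc, Fin.snoc_last]
      rw [mul_assoc, ← ENNReal.tsum_mul_left]
      simp only [mul_assoc]
    rw [tsum_congr h1, ENNReal.tsum_mul_left]
    congr 1
    rw [ENNReal.tsum_comm]
    simp only [← ENNReal.tsum_mul_left]
    rw [ENNReal.tsum_comm]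
    refine tsum_congr fun c => ?_
    -- In the last square the old shape `c` and the preceding new shape `lastShape D` are fixed, and
    -- the corner `l` and the matrix entry are traded for the new shape.
    rw [← tsum_loc c (lastShape D) (a m) b
      (fun ν => H c (Fin.snoc (α := fun _ => ℕ →₀ ℕ) D ν))]
    refine tsum_congr fun l => tsum_congr fun x => ?_
    ring

/-- Schur polynomials, through their branching rule. -/
noncomputable def schur {R : Type*} [CommSemiring R] (a : ℕ → R) : ℕ → (ℕ →₀ ℕ) → R
  | 0, μ => if μ = 0 then 1 else 0
  | m + 1, μ => ∑ l ∈ strips μ, a m ^ (μ.degree - l.degree) * schur a m l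

theorem schur_succ_eq_tsum (a : ℕ → ℝ≥0∞) (m : ℕ) (μ : ℕ →₀ ℕ) :
    schur a (m + 1) μ = ∑' l, stripWt (a m) l μ * schur a m l := by
  rw [schur, tsum_eq_sum (s := strips μ)]
  · refine Finset.sum_congr rfl fun l hl => ?_
    rw [stripWt, if_pos hl]
  · intro l hl
    rw [stripWt, if_neg hl, zero_mul]

theorem schur_eq_zero {R : Type*} [CommSemiring R] (a : ℕ → R) {m : ℕ} {μ : ℕ →₀ ℕ}
    (h : μ m ≠ 0) : schur a m μ = 0 := by
  induction m generalizing μ with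
  | zero =>
    rw [schur, if_neg]; rintro rfl; simp at h
  | succ m ih =>
    rw [schur]
    refine Finset.sum_eq_zero fun l hl => ?_
    rw [ih, mul_zero]
    have := (mem_strips.1 hl m).1
    omega

/-- Chains ending at `μ` are the semistandard tableaux of shape `μ`, so their weights add up to the
Schur polynomial. -/
theorem tsum_chainWt (a : ℕ → ℝ≥0∞) (m : ℕ) (G : (ℕ →₀ ℕ) → ℝ≥0∞) :
    ∑' D : Fin m → (ℕ →₀ ℕ), chainWt a D * G (lastShape D) = ∑' μ, schur a m μ * G μ := by
  induction m generalizing G with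
  | zero =>
    rw [tsum_eq_single default (fun C hC => absurd (Subsingleton.elim _ _) hC)]
    simp [chainWt, lastShape, schur]
  | succ m ih =>
    rw [tsum_fin_succ]
    simp only [chainWt, lastShape_succ, Fin.snoc_castSucc, Fin.snoc_last, mul_assoc,
      ENNReal.tsum_mul_left]
    rw [ih fun l => ∑' d, stripWt (a m) l d * G d]
    simp only [schur_succ_eq_tsum, ← ENNReal.tsum_mul_left, ← ENNReal.tsum_mul_right]
    rw [ENNReal.tsum_comm]
    refine tsum_congr fun c => tsum_congr fun l => ?_
    ring

/-- The chain of shapes in the last column of the growth diagram of a matrix given by columns. -/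
noncomputable def colChain {m : ℕ} : {n : ℕ} → (Fin n → Fin m → ℕ) → (Fin m → (ℕ →₀ ℕ))
  | 0, _ => 0
  | n + 1, x => colStep (colChain fun j : Fin n => x j.castSucc) (x (Fin.last n))

/-- A chain of nonzero weight ending at the empty shape is empty throughout. This is the case of a
matrix without columns in `tsum_colChain`, where `schur b 0` is the indicator of the shape `0`. -/
theorem tsum_chainWt_zero (a : ℕ → ℝ≥0∞) (m : ℕ) (H : (Fin m → (ℕ →₀ ℕ)) → ℝ≥0∞) :
    ∑' D : Fin m → (ℕ →₀ ℕ), chainWt a D * (if lastShape D = 0 then 1 else 0) * H D = H 0 := by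
  induction m with
  | zero =>
    rw [tsum_eq_single default (fun C hC => absurd (Subsingleton.elim _ _) hC)]
    simp [chainWt, lastShape]
    congr 1
    exact Subsingleton.elim _ _
  | succ m ih =>
    rw [tsum_fin_succ]
    have h0 : H 0 = H (Fin.snoc (α := fun _ => ℕ →₀ ℕ) (0 : Fin m → (ℕ →₀ ℕ)) 0) := by
      congr 1
      ext1 i
      refine Fin.lastCases ?_ (fun i => ?_) i <;> simp
    rw [h0, ← ih fun D => H (Fin.snoc (α := fun _ => ℕ →₀ ℕ) D 0)]
    refine tsum_congr fun D => ?_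
    rw [tsum_eq_single 0]
    · simp [chainWt, lastShape_succ, stripWt_zero]
    · intro d hd
      simp [lastShape, hd]

/-- RSK in weighted form: one tableau survives as the chain `D`, while summing the other, one column
at a time, rebuilds the branching rule of `schur b`. -/
theorem tsum_colChain (a b : ℕ → ℝ≥0∞) (m n : ℕ) (H : (Fin m → (ℕ →₀ ℕ)) → ℝ≥0∞) :
    ∑' x : Fin n → Fin m → ℕ, (∏ j : Fin n, ∏ i : Fin m, (a i * b j) ^ x j i) * H (colChain x) =
      ∑' D : Fin m → (ℕ →₀ ℕ), chainWt a D * schur b n (lastShape D) * H D := by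
  induction n generalizing H with
  | zero =>
    rw [tsum_eq_single default (fun C hC => absurd (Subsingleton.elim _ _) hC)]
    simp only [schur]
    rw [tsum_chainWt_zero]
    simp [colChain]
  | succ n ih =>
    rw [tsum_fin_succ]
    have h1 : ∀ x : Fin n → Fin m → ℕ, (∑' y : Fin m → ℕ,
        (∏ j : Fin (n + 1), ∏ i : Fin m, (a i * b j) ^ (Fin.snoc (α := fun _ => Fin m → ℕ) x y : Fin (n + 1) → Fin m → ℕ) j i) *
          H (colChain (Fin.snoc (α := fun _ => Fin m → ℕ) x y))) =
        (∏ j : Fin n, ∏ i : Fin m, (a i * b j) ^ x j i) *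
          (fun C => ∑' y : Fin m → ℕ, (∏ i : Fin m, (a i * b n) ^ y i) * H (colStep C y)) (colChain x) := by
      intro x
      simp only
      rw [← ENNReal.tsum_mul_left]
      refine tsum_congr fun y => ?_
      simp only [colChain, Fin.snoc_castSucc, Fin.snoc_last, Fin.prod_univ_castSucc,
        Fin.val_castSucc, Fin.val_last]
      ring
    refine (tsum_congr h1).trans ((ih (fun C => ∑' y : Fin m → ℕ,
      (∏ i : Fin m, (a i * b n) ^ y i) * H (colStep C y))).trans ?_)
    simp only [← ENNReal.tsum_mul_left]
    have h2 := tsum_colStep a (b n) m fun κ D => schur b n κ * H D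
    simp only [schur_succ_eq_tsum]
    refine Eq.trans ?_ (h2.trans ?_)
    · refine tsum_congr fun C => tsum_congr fun x => ?_
      ring
    · refine tsum_congr fun D => ?_
      rw [mul_assoc, ← ENNReal.tsum_mul_right]
      congr 1
      refine tsum_congr fun κ => ?_
      ring

/-- In the last column the shape `κ` before the step is kept rather than summed out, so one factor
of the branching rule stays visible as a strip weight. -/
theorem tsum_colChain_pair (a b : ℕ → ℝ≥0∞) (m n : ℕ) (κ μ : ℕ →₀ ℕ) :
    ∑' x : Fin (n + 1) → Fin m → ℕ, (∏ j : Fin (n + 1), ∏ i : Fin m, (a i * b j) ^ x j i) *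
      (if lastShape (colChain x) = μ ∧ lastShape (colChain fun j : Fin n => x j.castSucc) = κ
        then 1 else 0) =
    schur b n κ * stripWt (b n) κ μ * schur a m μ := by
  classical
  rw [tsum_fin_succ]
  have h1 : ∀ x : Fin n → Fin m → ℕ, (∑' y : Fin m → ℕ,
      (∏ j : Fin (n + 1), ∏ i : Fin m, (a i * b j) ^ (Fin.snoc (α := fun _ => Fin m → ℕ) x y : Fin (n + 1) → Fin m → ℕ) j i) *
      (if lastShape (colChain (Fin.snoc (α := fun _ => Fin m → ℕ) x y)) = μ ∧
        lastShape (colChain fun j : Fin n =>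
          (Fin.snoc (α := fun _ => Fin m → ℕ) x y : Fin (n + 1) → Fin m → ℕ) j.castSucc) = κ
        then 1 else 0)) =
      (∏ j : Fin n, ∏ i : Fin m, (a i * b j) ^ x j i) *
        (fun C => ∑' y : Fin m → ℕ, (∏ i : Fin m, (a i * b n) ^ y i) *
          (if lastShape (colStep C y) = μ ∧ lastShape C = κ then 1 else 0)) (colChain x) := by
    intro x
    simp only
    rw [← ENNReal.tsum_mul_left]
    refine tsum_congr fun y => ?_
    simp only [colChain, Fin.snoc_castSucc, Fin.snoc_last, Fin.prod_univ_castSucc,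
      Fin.val_castSucc, Fin.val_last]
    ring
  refine (tsum_congr h1).trans ((tsum_colChain a b m n (fun C => ∑' y : Fin m → ℕ,
    (∏ i : Fin m, (a i * b n) ^ y i) *
      (if lastShape (colStep C y) = μ ∧ lastShape C = κ then 1 else 0))).trans ?_)
  simp only [← ENNReal.tsum_mul_left]
  have h2 := tsum_colStep a (b n) m fun l D => schur b n l *
    (if lastShape D = μ ∧ l = κ then 1 else 0)
  refine Eq.trans ?_ (h2.trans ?_)
  · refine tsum_congr fun C => tsum_congr fun x => ?_
    ring
  · have h3 := tsum_chainWt a m fun ν => ∑' l, stripWt (b n) l ν *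
      (schur b n l * if ν = μ ∧ l = κ then 1 else 0)
    rw [h3, tsum_eq_single μ, tsum_eq_single κ]
    · simp; ring
    · intro l hl; simp [hl]
    · intro ν hν; simp [hν]

theorem lastShape_eq {m : ℕ} {C : Fin m → (ℕ →₀ ℕ)} {c : ℕ → (ℕ →₀ ℕ)} (h0 : c 0 = 0)
    (h : ∀ i : Fin m, C i = c (i + 1)) : lastShape C = c m := by
  cases m with
  | zero => simp [lastShape, h0]
  | succ m => simp [lastShape, h]

theorem colStep_eq {m : ℕ} {C : Fin m → (ℕ →₀ ℕ)} {x : Fin m → ℕ} {c d : ℕ → (ℕ →₀ ℕ)}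
    {X : ℕ → ℕ} (hc0 : c 0 = 0) (hd0 : d 0 = 0)
    (hd : ∀ i, d (i + 1) = loc (c i) (c (i + 1)) (d i) (X i))
    (hC : ∀ i : Fin m, C i = c (i + 1)) (hx : ∀ i : Fin m, x i = X i) (i : Fin m) :
    colStep C x i = d (i + 1) := by
  induction m with
  | zero => exact i.elim0
  | succ m ih =>
    have ih := ih (C := fun i => C i.castSucc) (x := fun i => x i.castSucc)
      (fun i => by simp [hC]) (fun i => by simp [hx])
    rw [colStep]
    refine Fin.lastCases ?_ (fun i => ?_) i
    · rw [Fin.snoc_last, lastShape_eq hc0 (fun i => by simp [hC]), lastShape_eq hd0 ih, hC, hx]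
      simp [hd]
    · rw [Fin.snoc_castSucc, ih]; simp

theorem colChain_eq_grid {m n : ℕ} (x : Fin n → Fin m → ℕ) (X : ℕ → ℕ → ℕ)
    (hX : ∀ j i, x j i = X i j) (i : Fin m) : colChain x i = grid X (i + 1) n := by
  induction n generalizing i with
  | zero => simp [colChain, grid]
  | succ n ih =>
    rw [colChain]
    -- `colStep` and `grid` list the two neighbours of a square in opposite orders, hence
    -- `loc_comm`.
    exact colStep_eq (c := fun i => grid X i n) (d := fun i => grid X i (n + 1))
      (X := fun i => X i n) (by simp [grid]) (by simp [grid]) (fun i => by rw [grid_succ_succ, loc_comm])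
      (fun i => ih _ (fun j i => by simp [hX]) i) (fun i => by simp [hX]) i

theorem lastShape_colChain {m n : ℕ} (x : Fin n → Fin m → ℕ) (X : ℕ → ℕ → ℕ)
    (hX : ∀ j i, x j i = X i j) : lastShape (colChain x) = grid X m n :=
  lastShape_eq (c := fun i => grid X i n) (by simp [grid]) (colChain_eq_grid x X hX)

end Chains

end LPP

namespace LPP

/-! ### The bialternant formula and its geometric specialisation. -/

section Determinants

variable {R : Type*} [CommRing R]

theorem det_eq_of_row_eq_smul_add_succ {n : ℕ} {A B : Matrix (Fin (n + 1)) (Fin (n + 1)) R}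
    (c : Fin n → R) (hlast : ∀ j, A (Fin.last n) j = B (Fin.last n) j)
    (h : ∀ i j, A (Fin.castSucc i) j = B (Fin.castSucc i) j + c i * A (Fin.succ i) j) :
    A.det = B.det := by
  rw [← Matrix.det_submatrix_equiv_self Fin.revPerm A, ← Matrix.det_submatrix_equiv_self Fin.revPerm B]
  refine Matrix.det_eq_of_forall_row_eq_smul_add_pred (fun i => c i.rev) ?_ ?_
  · intro j; simpa using hlast _
  · intro i j
    simpa [Fin.rev_succ, Fin.rev_castSucc] using h i.rev j.rev

theorem det_eq_of_last_column {n : ℕ} {A : Matrix (Fin (n + 1)) (Fin (n + 1)) R}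
    (h : ∀ i : Fin n, A i.castSucc (Fin.last n) = 0) :
    A.det = A (Fin.last n) (Fin.last n) *
      (Matrix.of fun i j : Fin n => A i.castSucc j.castSucc).det := by
  rw [Matrix.det_succ_column A (Fin.last n), Fin.sum_univ_castSucc]
  simp only [h, mul_zero, zero_mul, Finset.sum_const_zero, zero_add, Fin.val_last]
  rw [Even.neg_one_pow ⟨n, rfl⟩, one_mul]
  congr 2
  ext i j
  simp [Matrix.submatrix]

theorem sum_Icc_pow_mul_pow (x y : R) {u v : ℕ} (huv : u ≤ v) (c : ℕ) :
    (x - y) * ∑ p ∈ Finset.Icc u v, y ^ (v - p) * x ^ (p + c) =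
      x ^ (v + c + 1) - y ^ (v + 1 - u) * x ^ (u + c) := by
  induction v, huv using Nat.le_induction with
  | base => simp; ring
  | succ v hv ih =>
    rw [Finset.sum_Icc_succ_top (by omega), mul_add]
    have : ∑ p ∈ Finset.Icc u v, y ^ (v + 1 - p) * x ^ (p + c) =
        y * ∑ p ∈ Finset.Icc u v, y ^ (v - p) * x ^ (p + c) := by
      rw [Finset.mul_sum]
      refine Finset.sum_congr rfl fun p hp => ?_
      rw [Finset.mem_Icc] at hp
      rw [Nat.succ_sub hp.2, pow_succ]; ring
    rw [this, mul_left_comm, ih, show v + 1 + 1 - u = (v + 1 - u) + 1 by omega]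
    simp only [Nat.sub_self, pow_zero]
    ring

theorem degree_eq_sum_fin {μ : ℕ →₀ ℕ} {m : ℕ} (h : ∀ k, m ≤ k → μ k = 0) :
    μ.degree = ∑ i : Fin m, μ i := by
  rw [Finsupp.degree_apply, Fin.sum_univ_eq_sum_range (fun i => μ i) m]
  refine Finset.sum_subset ?_ ?_
  · intro k hk
    rw [Finsupp.mem_support_iff] at hk
    rw [Finset.mem_range]
    by_contra hlt
    exact hk (h k (not_lt.1 hlt))
  · intro k _ hk
    simpa using hk

theorem apply_eq_zero_of_antitone {μ : ℕ →₀ ℕ} (hμ : Antitone μ) {m k : ℕ} (h : μ m = 0)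
    (hk : m ≤ k) : μ k = 0 := by
  have := hμ hk; omega

theorem antitone_of_mem_strips {l μ : ℕ →₀ ℕ} (h : l ∈ strips μ) : Antitone l :=
  antitone_nat_of_succ_le fun k => by
    have h1 := mem_strips.1 h k
    have h2 := mem_strips.1 h (k + 1)
    omega

/-- The shape with prescribed first `m` parts. -/
noncomputable def ofFin {m : ℕ} (r : Fin m → ℕ) : ℕ →₀ ℕ :=
  Finsupp.onFinset (Finset.range m) (fun k => if h : k < m then r ⟨k, h⟩ else 0) fun k hk => by
    rw [Finset.mem_range]; by_contra h; simp [h] at hk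

theorem ofFin_apply {m : ℕ} (r : Fin m → ℕ) (i : Fin m) : ofFin r i = r i := by
  simp [ofFin]

theorem ofFin_apply_of_le {m : ℕ} (r : Fin m → ℕ) {k : ℕ} (hk : m ≤ k) : ofFin r k = 0 := by
  simp [ofFin, hk]

theorem sum_strips {M : Type*} [AddCommMonoid M] {m : ℕ} {μ : ℕ →₀ ℕ}
    (hm : μ (m + 1) = 0) (hμ : Antitone μ) (F : (Fin m → ℕ) → M) :
    ∑ l ∈ strips μ with l m = 0, F (fun i => l i) =
      ∑ r ∈ Fintype.piFinset fun i : Fin m => Finset.Icc (μ (i + 1)) (μ i), F r := by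
  have hz : ∀ l ∈ (strips μ).filter (fun l => l m = 0), ∀ k, m ≤ k → l k = 0 := by
    intro l hl k hk
    rw [Finset.mem_filter] at hl
    exact apply_eq_zero_of_antitone (antitone_of_mem_strips hl.1) hl.2 hk
  refine Finset.sum_nbij' (fun l i => l i) ofFin ?_ ?_ ?_ ?_ ?_
  · intro l hl
    rw [Finset.mem_filter, mem_strips] at hl
    simpa [Fintype.mem_piFinset] using fun i : Fin m => hl.1 i
  · intro r hr
    simp only [Fintype.mem_piFinset, Finset.mem_Icc] at hr
    rw [Finset.mem_filter, mem_strips]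
    refine ⟨fun k => ?_, ofFin_apply_of_le r le_rfl⟩
    rcases lt_or_ge k m with hk | hk
    · have := hr ⟨k, hk⟩
      rw [← ofFin_apply r] at this
      exact this
    · rw [ofFin_apply_of_le r hk, apply_eq_zero_of_antitone hμ hm (by omega)]
      simp
  · intro l hl
    ext k
    rcases lt_or_ge k m with hk | hk
    · exact ofFin_apply _ ⟨k, hk⟩
    · rw [ofFin_apply_of_le _ hk, hz l hl k hk]
  · intro r _
    ext i
    exact ofFin_apply r i
  · intros; rfl

/-- The branching rule for alternants. Subtracting a multiple of the next row clears the last column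
above the corner. Each remaining entry is `a k - a m` times a geometric sum over the interval from
`μ (i + 1)` to `μ i`, and choosing one term in each row chooses a shape interlacing with `μ`. -/
theorem det_alternant_succ (a : ℕ → R) {m : ℕ} {μ : ℕ →₀ ℕ} (hμ : Antitone μ)
    (hm : μ (m + 1) = 0) :
    (Matrix.of fun i k : Fin (m + 1) => a k ^ (μ i + (m + 1 - 1 - i))).det =
      (∏ k : Fin m, (a k - a m)) * ∑ l ∈ strips μ with l m = 0,
        a m ^ (μ.degree - l.degree) *
          (Matrix.of fun i k : Fin m => a k ^ (l i + (m - 1 - i))).det := by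
  -- The exponents of rows `i` and `i + 1` differ by `μ i + 1 - μ (i + 1)`, so this multiple makes
  -- the entry at `k = m` vanish.
  set B : Matrix (Fin (m + 1)) (Fin (m + 1)) R := Matrix.of fun i k =>
    if (i : ℕ) < m then a k ^ (μ i + (m - i)) -
      a m ^ (μ i + 1 - μ (i + 1)) * a k ^ (μ (i + 1) + (m - 1 - i))
    else a k ^ (μ i + (m - i)) with hB
  rw [det_eq_of_row_eq_smul_add_succ (B := B) (fun i => a m ^ (μ i + 1 - μ (i + 1))),
    det_eq_of_last_column]
  · have h1 : (Matrix.of fun i j : Fin m => B i.castSucc j.castSucc) =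
        Matrix.of fun i k : Fin m => (a k - a m) * (Matrix.of fun i k : Fin m =>
          ∑ p ∈ Finset.Icc (μ (i + 1)) (μ i), a m ^ (μ i - p) * a k ^ (p + (m - 1 - i))) i k := by
      ext i k
      have := sum_Icc_pow_mul_pow (a k) (a m) (hμ (Nat.le_succ i)) (m - 1 - i)
      simp only [hB, Matrix.of_apply, Fin.val_castSucc, i.2, if_true]
      rw [this]
      congr 2
      have := i.2
      omega
    rw [h1, Matrix.det_mul_row]
    have h2 : (Matrix.of fun i k : Fin m =>
          ∑ p ∈ Finset.Icc (μ (i + 1)) (μ i), a m ^ (μ i - p) * a k ^ (p + (m - 1 - i))).det =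
        ∑ r ∈ Fintype.piFinset fun i : Fin m => Finset.Icc (μ (i + 1)) (μ i),
          (∏ i : Fin m, a m ^ (μ i - r i)) * (Matrix.of fun i k : Fin m => a k ^ (r i + (m - 1 - i))).det := by
      -- Multilinearity in the rows: the determinant of row sums is a sum over one choice per row.
      have h3 := (Matrix.detRowAlternating (R := R) (n := Fin m)).toMultilinearMap.map_sum_finset
        (fun (i : Fin m) (p : ℕ) (k : Fin m) => a m ^ (μ i - p) * a k ^ (p + (m - 1 - i)))
        (fun i => Finset.Icc (μ (i + 1)) (μ i))
      have h4 : (Matrix.of fun i k : Fin m =>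
          ∑ p ∈ Finset.Icc (μ (i + 1)) (μ i), a m ^ (μ i - p) * a k ^ (p + (m - 1 - i))) =
          fun i : Fin m => ∑ p ∈ Finset.Icc (μ (i + 1)) (μ i),
            fun k : Fin m => a m ^ (μ i - p) * a k ^ (p + (m - 1 - i)) := by
        ext i k
        simp
      rw [h4]
      refine h3.trans (Finset.sum_congr rfl fun r _ => ?_)
      exact Matrix.det_mul_column (fun i : Fin m => a m ^ (μ i - r i))
        (Matrix.of fun i k : Fin m => a k ^ (r i + (m - 1 - i)))
    rw [h2, ← sum_strips hm hμ (fun r => (∏ i : Fin m, a m ^ (μ i - r i)) *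
      (Matrix.of fun i k : Fin m => a k ^ (r i + (m - 1 - i))).det), mul_left_comm, Finset.mul_sum]
    congr 1
    refine Finset.sum_congr rfl fun l hl => ?_
    rw [← mul_assoc]
    congr 1
    rw [Finset.mem_filter] at hl
    have hd1 : μ.degree = ∑ i : Fin m, μ i + μ m := by
      rw [degree_eq_sum_fin (m := m + 1) (fun k hk => apply_eq_zero_of_antitone hμ hm hk),
        Fin.sum_univ_castSucc]
      simp
    have hd2 : l.degree = ∑ i : Fin m, l i := degree_eq_sum_fin
      fun k hk => apply_eq_zero_of_antitone (antitone_of_mem_strips hl.1) hl.2 hk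
    have hd3 : ∑ i : Fin m, (μ i - l i) + ∑ i : Fin m, l i = ∑ i : Fin m, μ i := by
      rw [← Finset.sum_add_distrib]
      exact Finset.sum_congr rfl fun i _ => Nat.sub_add_cancel ((mem_strips.1 hl.1 i).2)
    rw [Finset.prod_pow_eq_pow_sum]
    simp only [hB, Matrix.of_apply, Fin.val_last, lt_irrefl, if_false, Nat.sub_self, add_zero]
    rw [← pow_add]
    congr 1
    omega
  · intro i
    simp only [hB, Matrix.of_apply, Fin.val_castSucc, i.2, if_true, Fin.val_last]
    rw [← pow_add, sub_eq_zero]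
    congr 1
    have := hμ (Nat.le_succ i)
    have := i.2
    simp only [Nat.succ_eq_add_one] at *
    omega
  · intro j
    simp [hB]
  · intro i j
    simp only [hB, Matrix.of_apply, Fin.val_castSucc, i.2, if_true, Fin.val_succ]
    rw [show m + 1 - 1 - (i : ℕ) = m - i by omega,
      show m + 1 - 1 - ((i : ℕ) + 1) = m - 1 - i by omega]
    ring

/-- The bialternant formula without division. By `det_alternant_succ` both sides satisfy the same
recursion, since shapes with more than `m` parts contribute nothing in `m` variables. -/
theorem schur_mul_prod_sub (a : ℕ → R) {m : ℕ} {μ : ℕ →₀ ℕ} (hμ : Antitone μ) (hm : μ m = 0) :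
    schur a m μ * ∏ j ∈ Finset.range m, ∏ k : Fin j, (a k - a j) =
      (Matrix.of fun i k : Fin m => a k ^ (μ i + (m - 1 - i))).det := by
  induction m generalizing μ with
  | zero =>
    have : μ = 0 := by ext k; exact apply_eq_zero_of_antitone hμ hm (Nat.zero_le _)
    simp [schur, this]
  | succ m ih =>
    rw [det_alternant_succ a hμ hm, Finset.prod_range_succ, schur]
    have h1 : ∑ l ∈ strips μ, a m ^ (μ.degree - l.degree) * schur a m l =
        ∑ l ∈ strips μ with l m = 0, a m ^ (μ.degree - l.degree) * schur a m l := by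
      rw [Finset.sum_filter]
      refine Finset.sum_congr rfl fun l _ => ?_
      split_ifs with h
      · rfl
      · rw [schur_eq_zero a h, mul_zero]
    rw [h1, ← mul_assoc, mul_comm, Finset.sum_mul]
    congr 1
    refine Finset.sum_congr rfl fun l hl => ?_
    rw [Finset.mem_filter] at hl
    rw [mul_assoc, ih (antitone_of_mem_strips hl.1) hl.2]

theorem schur_zero_right (a : ℕ → R) (m : ℕ) : schur a m 0 = 1 := by
  induction m with
  | zero => simp [schur]
  | succ m ih =>
    have : strips 0 = {0} := by ext l; simp [mem_strips_zero]
    rw [schur, this]; simp [ih]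

/-- The Vandermonde product of the numbers `t ^ (μ_i + m - i)`. -/
def vprod (t : R) (m : ℕ) (μ : ℕ →₀ ℕ) : R :=
  ∏ i : Fin m, ∏ j ∈ Finset.Ioi i, (t ^ (μ j + (m - 1 - j)) - t ^ (μ i + (m - 1 - i)))

/-- Since `(t ^ k) ^ h = (t ^ h) ^ k`, the variables and the exponents change roles and the
alternant is a Vandermonde determinant in the numbers `t ^ h`. -/
theorem det_alternant_geometric (z t : R) {m : ℕ} {μ : ℕ →₀ ℕ} (hμ : Antitone μ) (hm : μ m = 0) :
    (Matrix.of fun i k : Fin m => (z * t ^ (k : ℕ)) ^ (μ i + (m - 1 - i))).det =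
      z ^ (∑ i : Fin m, (m - 1 - i)) * (z ^ μ.degree * vprod t m μ) := by
  have h1 : (Matrix.of fun i k : Fin m => (z * t ^ (k : ℕ)) ^ (μ i + (m - 1 - i))) =
      Matrix.of fun i k : Fin m => z ^ (μ i + (m - 1 - i)) *
        Matrix.vandermonde (fun i : Fin m => t ^ (μ i + (m - 1 - i))) i k := by
    ext i k
    simp only [Matrix.of_apply, Matrix.vandermonde_apply, mul_pow, ← pow_mul]
    rw [mul_comm (k : ℕ)]
  rw [h1, Matrix.det_mul_column, Matrix.det_vandermonde, Finset.prod_pow_eq_pow_sum,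
    Finset.sum_add_distrib, pow_add,
    degree_eq_sum_fin fun k hk => apply_eq_zero_of_antitone hμ hm hk, vprod]
  ring

theorem prod_Ioi_castSucc {M : Type*} [CommMonoid M] {m : ℕ} (f : Fin (m + 1) → Fin (m + 1) → M) :
    ∏ i, ∏ j ∈ Finset.Ioi i, f i j =
      (∏ i : Fin m, ∏ j ∈ Finset.Ioi i, f i.castSucc j.castSucc) *
        ∏ i : Fin m, f i.castSucc (Fin.last m) := by
  have h : ∀ {n : ℕ} (g : Fin n → Fin n → M),
      ∏ i, ∏ j ∈ Finset.Ioi i, g i j = ∏ i, ∏ j, if i < j then g i j else 1 := by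
    intro n g
    refine Finset.prod_congr rfl fun i _ => ?_
    rw [← Finset.prod_filter]
    congr 1
    ext j; simp
  rw [h, h, Fin.prod_univ_castSucc, ← Finset.prod_mul_distrib]
  have h2 : (∏ j, if Fin.last m < j then f (Fin.last m) j else 1) = 1 :=
    Finset.prod_eq_one fun j _ => by simp [Fin.le_last]
  rw [h2, mul_one]
  refine Finset.prod_congr rfl fun i _ => ?_
  rw [Fin.prod_univ_castSucc]
  simp [Fin.castSucc_lt_last]

/-- Regarding `μ` as having one more, empty, part raises the old exponents by one. Each old pair
yields a factor `t`, and the new exponent `0` contributes the factors `1 - t ^ h`. -/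
theorem vprod_succ (t : R) {m : ℕ} {μ : ℕ →₀ ℕ} (hm : μ m = 0) :
    vprod t (m + 1) μ = t ^ (∑ i : Fin m, (m - 1 - i)) * vprod t m μ *
      ∏ i : Fin m, (1 - t ^ (μ i + (m - i))) := by
  rw [vprod, prod_Ioi_castSucc]
  congr 1
  · rw [vprod, ← Finset.prod_pow_eq_pow_sum, ← Finset.prod_mul_distrib]
    refine Finset.prod_congr rfl fun i _ => ?_
    have hc : m - 1 - (i : ℕ) = (Finset.Ioi i).card := by simp
    rw [hc, ← Finset.prod_const, ← Finset.prod_mul_distrib]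
    refine Finset.prod_congr rfl fun j hj => ?_
    rw [mul_sub, ← pow_succ', ← pow_succ']
    have h1 := i.2
    have h2 := j.2
    congr 2 <;> simp <;> omega
  · refine Finset.prod_congr rfl fun i _ => ?_
    simp [hm]

theorem qPoch_succ (t : ℝ) (l : ℕ) : qPoch t (l + 1) = qPoch t l * (1 - t ^ (l + 1)) := by
  rw [qPoch, Finset.prod_Icc_succ_top (by omega), qPoch]

@[simp] theorem qPoch_zero (t : ℝ) : qPoch t 0 = 1 := by simp [qPoch]

theorem pow_ne_one_of_ne_one {t : ℝ} (ht : 0 < t) (ht1 : t ≠ 1) {k : ℕ} (hk : k ≠ 0) :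
    t ^ k ≠ 1 := by
  rwa [Ne, pow_eq_one_iff_of_nonneg ht.le hk]

theorem qPoch_ne_zero {t : ℝ} (ht : 0 < t) (ht1 : t ≠ 1) (l : ℕ) : qPoch t l ≠ 0 := by
  rw [qPoch, Finset.prod_ne_zero_iff]
  intro k hk
  rw [Finset.mem_Icc] at hk
  exact sub_ne_zero.2 (pow_ne_one_of_ne_one ht ht1 (by omega)).symm

theorem pow_sub_pow_ne_zero {t : ℝ} (ht : 0 < t) (ht1 : t ≠ 1) {k l : ℕ} (hk : k ≠ l) :
    t ^ k - t ^ l ≠ 0 :=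
  sub_ne_zero.2 fun h => hk (pow_right_injective₀ ht ht1 h)

theorem vprod_ne_zero {t : ℝ} (ht : 0 < t) (ht1 : t ≠ 1) (m : ℕ) {μ : ℕ →₀ ℕ}
    (hμ : Antitone μ) : vprod t m μ ≠ 0 := by
  rw [vprod, Finset.prod_ne_zero_iff]
  intro i _
  rw [Finset.prod_ne_zero_iff]
  intro j hj
  rw [Finset.mem_Ioi] at hj
  have h1 : μ j ≤ μ i := hμ (Fin.le_def.1 hj.le)
  have h2 : (i : ℕ) < j := hj
  have := j.2
  exact pow_sub_pow_ne_zero ht ht1 (by omega)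

/-- The bialternant formula is used for `μ` and for the empty shape, whose Schur polynomial is `1`.
The latter evaluates the product of differences of the variables. -/
theorem schur_geometric {z t : ℝ} (hz : z ≠ 0) (m : ℕ) {μ : ℕ →₀ ℕ}
    (hμ : Antitone μ) (hm : μ m = 0) :
    schur (fun k => z * t ^ k) m μ * vprod t m 0 = z ^ μ.degree * vprod t m μ := by
  have h1 := schur_mul_prod_sub (fun k => z * t ^ k) hμ hm
  have h2 := schur_mul_prod_sub (fun k => z * t ^ k) (m := m) (μ := 0) (by intro i j _; simp)
    (by simp)
  rw [det_alternant_geometric z t hμ hm] at h1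
  rw [det_alternant_geometric z t (by intro i j _; simp) (by simp), schur_zero_right] at h2
  simp only [map_zero, pow_zero, one_mul] at h2
  rw [h2] at h1
  have hz' : z ^ (∑ i : Fin m, (m - 1 - (i : ℕ))) ≠ 0 := pow_ne_zero _ hz
  apply mul_left_cancel₀ hz'
  rw [← h1]; ring

theorem schur_geometric_succ {z t : ℝ} (hz : z ≠ 0) (ht : 0 < t) (ht1 : t ≠ 1) (m : ℕ)
    {μ : ℕ →₀ ℕ} (hμ : Antitone μ) (hm : μ m = 0) :
    schur (fun k => z * t ^ k) (m + 1) μ * ∏ i : Fin m, (1 - t ^ (m - i : ℕ)) =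
      schur (fun k => z * t ^ k) m μ * ∏ i : Fin m, (1 - t ^ (μ i + (m - i))) := by
  have h1 := schur_geometric hz (t := t) m hμ hm
  have h2 := schur_geometric hz (t := t) (m + 1) hμ (apply_eq_zero_of_antitone hμ hm (by omega))
  rw [vprod_succ t hm, vprod_succ t (μ := 0) (by simp)] at h2
  have h3 := vprod_ne_zero ht ht1 m (μ := 0) (by intro i j _; simp)
  have h4 : t ^ (∑ i : Fin m, (m - 1 - (i : ℕ))) ≠ 0 := pow_ne_zero _ ht.ne'
  simp only [Finsupp.coe_zero, Pi.zero_apply, zero_add] at h2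
  apply mul_left_cancel₀ h4
  apply mul_left_cancel₀ h3
  calc _ = z ^ μ.degree * (t ^ (∑ i : Fin m, (m - 1 - (i : ℕ))) * vprod t m μ *
        ∏ i : Fin m, (1 - t ^ (μ i + (m - i)))) := by rw [← h2]; ring
    _ = _ := by linear_combination (-t ^ (∑ i : Fin m, (m - 1 - (i : ℕ))) *
        ∏ i : Fin m, (1 - t ^ (μ i + (m - i)))) * h1

/-- Each additional variable multiplies the ratio by one factor per part, and these build up the
`qPoch` quotients. The indices from `n` on carry empty parts and contribute equally to both sides.
-/
theorem schur_geometric_add {z t : ℝ} (hz : z ≠ 0) (ht : 0 < t) (ht1 : t ≠ 1) (n m : ℕ)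
    {μ : ℕ →₀ ℕ} (hμ : Antitone μ) (hn : μ n = 0) :
    schur (fun k => z * t ^ k) (n + m) μ *
        ∏ i : Fin n, qPoch t (n - 1 - i + m) / qPoch t (n - 1 - i) =
      schur (fun k => z * t ^ k) n μ *
        ∏ i : Fin n, qPoch t (μ i + (n - 1 - i) + m) / qPoch t (μ i + (n - 1 - i)) := by
  induction m with
  | zero =>
    simp [div_self (qPoch_ne_zero ht ht1 _)]
  | succ m ih =>
    have hs := schur_geometric_succ hz ht ht1 (n + m) hμ
      (apply_eq_zero_of_antitone hμ hn (by omega))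
    rw [Fin.prod_univ_add, Fin.prod_univ_add] at hs
    have h1 : ∏ i : Fin m, (1 - t ^ (μ (Fin.natAdd n i) + (n + m - Fin.natAdd n i : ℕ))) =
        ∏ i : Fin m, (1 - t ^ (n + m - Fin.natAdd n i : ℕ)) := by
      refine Finset.prod_congr rfl fun i _ => ?_
      rw [apply_eq_zero_of_antitone hμ hn (by simp), zero_add]
    have h2 : ∏ i : Fin m, (1 - t ^ (n + m - Fin.natAdd n i : ℕ)) ≠ 0 := by
      rw [Finset.prod_ne_zero_iff]
      intro i _
      refine sub_ne_zero.2 (pow_ne_one_of_ne_one ht ht1 ?_).symm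
      have := i.2
      simp only [Fin.val_natAdd]
      omega
    rw [h1, ← mul_assoc, ← mul_assoc] at hs
    have hs := mul_right_cancel₀ h2 hs
    simp only [Fin.val_castAdd] at hs
    have e1 : ∏ i : Fin n, qPoch t (n - 1 - i + (m + 1)) / qPoch t (n - 1 - i) =
        (∏ i : Fin n, qPoch t (n - 1 - i + m) / qPoch t (n - 1 - i)) *
          ∏ i : Fin n, (1 - t ^ (n + m - i : ℕ)) := by
      rw [← Finset.prod_mul_distrib]
      refine Finset.prod_congr rfl fun i _ => ?_
      rw [← add_assoc, qPoch_succ, show n - 1 - (i : ℕ) + m + 1 = n + m - i by have := i.2; omega]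
      ring
    have e2 : ∏ i : Fin n, qPoch t (μ i + (n - 1 - i) + (m + 1)) / qPoch t (μ i + (n - 1 - i)) =
        (∏ i : Fin n, qPoch t (μ i + (n - 1 - i) + m) / qPoch t (μ i + (n - 1 - i))) *
          ∏ i : Fin n, (1 - t ^ (μ i + (n + m - i : ℕ))) := by
      rw [← Finset.prod_mul_distrib]
      refine Finset.prod_congr rfl fun i _ => ?_
      rw [← add_assoc, qPoch_succ,
        show μ i + (n - 1 - (i : ℕ)) + m + 1 = μ i + (n + m - i) by have := i.2; omega]
      ring
    rw [e1, e2, ← add_assoc]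
    linear_combination (∏ i : Fin n, qPoch t (n - 1 - i + m) / qPoch t (n - 1 - i)) * hs +
      (∏ i : Fin n, (1 - t ^ (μ i + (n + m - i : ℕ)))) * ih

end Determinants

end LPP

namespace LPP

/-! ### Matching the explicit constants. -/

section Constants

theorem prod_Icc_qPoch (t : ℝ) (N : ℕ) :
    ∏ l ∈ Finset.Icc 1 (N - 1), qPoch t l = ∏ l ∈ Finset.range N, qPoch t l := by
  cases N with
  | zero => simp
  | succ N =>
    rw [Finset.prod_range_succ', qPoch_zero, mul_one, Nat.add_sub_cancel,
      ← Finset.Ico_succ_right_eq_Icc, Finset.prod_Ico_eq_prod_range]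
    exact Finset.prod_congr (by simp) fun l _ => by rw [add_comm]

theorem prod_fin_one_sub_pow (t : ℝ) (n : ℕ) :
    ∏ i : Fin n, (1 - t ^ (n - i : ℕ)) = qPoch t n := by
  rw [Fin.prod_univ_eq_prod_range (fun i => 1 - t ^ (n - i)) n, ← Finset.prod_range_reflect,
    qPoch, ← Finset.Ico_succ_right_eq_Icc, Finset.prod_Ico_eq_prod_range]
  refine Finset.prod_congr (by simp) fun l hl => ?_
  rw [Finset.mem_range] at hl
  simp only [Nat.succ_eq_succ, Nat.succ_eq_add_one, Nat.add_sub_cancel] at hl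
  rw [show n - (n - 1 - l) = 1 + l by omega]

theorem sum_fin_reflect (n : ℕ) : ∑ i : Fin n, (n - 1 - i : ℕ) = ∑ i ∈ Finset.range n, i := by
  rw [Fin.sum_univ_eq_sum_range (fun i => n - 1 - i) n, Finset.sum_range_reflect (fun i => i) n]

theorem sum_Icc_sub (n : ℕ) :
    ∑ j ∈ Finset.Icc 1 n, ((n : ℤ) - j) = ((∑ i : Fin n, (n - 1 - i) : ℕ) : ℤ) := by
  rw [sum_fin_reflect]
  induction n with
  | zero => simp
  | succ n ih =>
    rw [Finset.sum_Icc_succ_top (by omega), Finset.sum_range_succ]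
    push_cast at ih ⊢
    rw [← ih]
    simp only [add_sub_right_comm, Finset.sum_add_distrib, Finset.sum_const, Nat.card_Icc]
    simp

theorem sum_Icc_mul_sub_succ (n : ℕ) :
    ∑ j ∈ Finset.Icc 1 (n + 1), ((j : ℤ) - 1) * (((n + 1 : ℕ) : ℤ) - j) =
      ∑ j ∈ Finset.Icc 1 n, ((j : ℤ) - 1) * ((n : ℤ) - j) + ((∑ i ∈ Finset.range n, i : ℕ) : ℤ) := by
  have h : ((∑ i ∈ Finset.range n, i : ℕ) : ℤ) = ∑ j ∈ Finset.Icc 1 n, ((j : ℤ) - 1) := by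
    induction n with
    | zero => simp
    | succ n ih =>
      rw [Finset.sum_Icc_succ_top (by omega), Finset.sum_range_succ, ← ih]
      push_cast; ring
  rw [h, Finset.sum_Icc_succ_top (by omega), ← Finset.sum_add_distrib]
  push_cast
  rw [sub_self, mul_zero, add_zero]
  exact Finset.sum_congr rfl fun j _ => by ring

theorem vprod_zero_right {t : ℝ} (ht : 0 < t) (n : ℕ) :
    vprod t n 0 = t ^ (∑ j ∈ Finset.Icc 1 n, ((j : ℤ) - 1) * ((n : ℤ) - j)) *
      ∏ l ∈ Finset.Icc 1 (n - 1), qPoch t l := by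
  induction n with
  | zero => simp [vprod]
  | succ n ih =>
    rw [vprod_succ t (by simp), ih, sum_Icc_mul_sub_succ, zpow_add₀ ht.ne', zpow_natCast,
      prod_Icc_qPoch, prod_Icc_qPoch, Finset.prod_range_succ, sum_fin_reflect]
    simp only [Finsupp.coe_zero, Pi.zero_apply, zero_add, prod_fin_one_sub_pow]
    ring

/-- The powers of `t` in `jointConst` that depend on `n₂` combine into one that does not, namely
that of a second denominator `vprod t n 0`. Raising `m` by one adds `-(m + 1) m - n (m + 1) + (n +
m)(m + 1) = 0`. -/
theorem exponent_identity (n m : ℕ) :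
    -∑ j ∈ Finset.Icc 1 m, (j : ℤ) * ((j : ℤ) - 1) + -(n : ℤ) * ∑ j ∈ Finset.Icc 1 m, (j : ℤ) +
      -∑ j ∈ Finset.Icc 1 (n + m), ((j : ℤ) - 1) * ((n : ℤ) - j) =
      -∑ j ∈ Finset.Icc 1 n, ((j : ℤ) - 1) * ((n : ℤ) - j) := by
  induction m with
  | zero => simp
  | succ m ih =>
    rw [← ih, Finset.sum_Icc_succ_top (by omega), Finset.sum_Icc_succ_top (by omega), ← add_assoc,
      Finset.sum_Icc_succ_top (by omega)]
    push_cast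
    ring

/-- This accounts for the quotient of `qPoch` products in `jointConst`: after reflecting the index,
the left product is a quotient of consecutive ranges. -/
theorem prod_qPoch_div {t : ℝ} (ht : 0 < t) (ht1 : t ≠ 1) (n m : ℕ) :
    (∏ i : Fin n, qPoch t (n - 1 - i + m) / qPoch t (n - 1 - i)) *
      ((∏ l ∈ Finset.Icc 1 (m - 1), qPoch t l) * ∏ l ∈ Finset.Icc 1 (n - 1), qPoch t l) =
      ∏ l ∈ Finset.Icc 1 (n + m - 1), qPoch t l := by
  rw [prod_Icc_qPoch, prod_Icc_qPoch, prod_Icc_qPoch, add_comm n m, Finset.prod_range_add,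
    Fin.prod_univ_eq_prod_range (fun i => qPoch t (n - 1 - i + m) / qPoch t (n - 1 - i)) n,
    Finset.prod_range_reflect (fun i => qPoch t (i + m) / qPoch t i) n, Finset.prod_div_distrib]
  have : ∏ l ∈ Finset.range n, qPoch t l ≠ 0 :=
    Finset.prod_ne_zero_iff.2 fun l _ => qPoch_ne_zero ht ht1 l
  simp only [add_comm m]
  field_simp

theorem jointFormula_eq {z α t : ℝ} (hz : z ≠ 0) (ht : 0 < t) (ht1 : t ≠ 1)
    (n m : ℕ) {μ κ : ℕ →₀ ℕ} (hμ : Antitone μ) (hμn : μ n = 0) (hκ : Antitone κ) (hκn : κ n = 0)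
    (hs : κ ∈ strips μ) :
    jointFormula n (n + m) z α t (fun i => μ i + (n - 1 - i)) (fun i => κ i + (n - 1 - i)) =
      (∏ i ∈ Finset.Icc 1 n, ∏ j ∈ Finset.Icc 1 (n + m), (1 - z ^ 2 * t ^ (i + j - 2))) *
      (∏ i ∈ Finset.Icc 1 n, (1 - α * z * t ^ (i - 1))) *
      (schur (fun k => z * t ^ k) (n + m) κ * α ^ (μ.degree - κ.degree) *
        schur (fun k => z * t ^ k) n μ) := by
  have hV0 := vprod_ne_zero ht ht1 n (μ := 0) (by intro i j _; simp)
  have hV0' := vprod_zero_right ht n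
  have h1 := schur_geometric hz (t := t) n hμ hμn
  have h2 := schur_geometric hz (t := t) n hκ hκn
  have h3 := schur_geometric_add hz ht ht1 n m hκ hκn
  have h4 := prod_qPoch_div ht ht1 n m
  have hq : ∀ N, ∏ l ∈ Finset.Icc 1 N, qPoch t l ≠ 0 := fun N =>
    Finset.prod_ne_zero_iff.2 fun l _ => qPoch_ne_zero ht ht1 l
  have hQ : ∏ i : Fin n, qPoch t (n - 1 - i + m) / qPoch t (n - 1 - i) ≠ 0 :=
    Finset.prod_ne_zero_iff.2 fun i _ =>
      div_ne_zero (qPoch_ne_zero ht ht1 _) (qPoch_ne_zero ht ht1 _)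
  have hdμ : μ.degree = ∑ i : Fin n, μ i :=
    degree_eq_sum_fin fun k hk => apply_eq_zero_of_antitone hμ hμn hk
  have hdκ : κ.degree = ∑ i : Fin n, κ i :=
    degree_eq_sum_fin fun k hk => apply_eq_zero_of_antitone hκ hκn hk
  have hle := degree_le_of_mem_strips hs
  have ez : z ^ (-2 * ∑ j ∈ Finset.Icc 1 n, ((n : ℤ) - j)) *
      z ^ (∑ j : Fin n, (μ j + (n - 1 - j) + (κ j + (n - 1 - j)))) = z ^ μ.degree * z ^ κ.degree := by
    rw [sum_Icc_sub, ← pow_add, ← zpow_natCast, ← zpow_natCast, ← zpow_add₀ hz, hdμ, hdκ]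
    congr 1
    simp only [Finset.sum_add_distrib]
    push_cast
    ring
  have eα : α ^ (∑ j : Fin n, (((μ j + (n - 1 - j) : ℕ) : ℤ) - ((κ j + (n - 1 - j) : ℕ) : ℤ))) =
      α ^ (μ.degree - κ.degree) := by
    rw [← zpow_natCast, Nat.cast_sub hle, hdμ, hdκ]
    congr 1
    push_cast
    rw [Finset.sum_sub_distrib]
    simp only [Finset.sum_add_distrib]
    ring
  have et : t ^ (-∑ j ∈ Finset.Icc 1 m, (j : ℤ) * ((j : ℤ) - 1)) *
      t ^ (-(n : ℤ) * ∑ j ∈ Finset.Icc 1 m, (j : ℤ)) *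
      t ^ (-∑ j ∈ Finset.Icc 1 (n + m), ((j : ℤ) - 1) * ((n : ℤ) - j)) =
      t ^ (-∑ j ∈ Finset.Icc 1 n, ((j : ℤ) - 1) * ((n : ℤ) - j)) := by
    rw [← zpow_add₀ ht.ne', ← zpow_add₀ ht.ne', exponent_identity]
  have eV : ∏ i : Fin n, ∏ j ∈ Finset.Ioi i,
      (t ^ (μ j + (n - 1 - j)) - t ^ (μ i + (n - 1 - i))) *
        (t ^ (κ j + (n - 1 - j)) - t ^ (κ i + (n - 1 - i))) = vprod t n μ * vprod t n κ := by
    simp only [vprod, ← Finset.prod_mul_distrib]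
  have eq : ∏ i : Fin n, qPoch t (κ i + (n - 1 - i) + (n + m) - n) / qPoch t (κ i + (n - 1 - i)) =
      ∏ i : Fin n, qPoch t (κ i + (n - 1 - i) + m) / qPoch t (κ i + (n - 1 - i)) := by
    refine Finset.prod_congr rfl fun i _ => ?_
    rw [show κ i + (n - 1 - (i : ℕ)) + (n + m) - n = κ i + (n - 1 - i) + m by omega]
  set T := t ^ (∑ j ∈ Finset.Icc 1 n, ((j : ℤ) - 1) * ((n : ℤ) - j)) with hT
  have hT0 : T ≠ 0 := zpow_ne_zero _ ht.ne'
  have eT : t ^ (-∑ j ∈ Finset.Icc 1 n, ((j : ℤ) - 1) * ((n : ℤ) - j)) = T⁻¹ := by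
    rw [zpow_neg]
  rw [eT] at et
  set q := ∏ i : Fin n, qPoch t (κ i + (n - 1 - i) + m) / qPoch t (κ i + (n - 1 - i))
  set Q := ∏ i : Fin n, qPoch t (n - 1 - i + m) / qPoch t (n - 1 - i)
  -- Each Schur polynomial supplies one Vandermonde product and one denominator `vprod t n 0`. The
  -- one in `n + m` variables also supplies the quotient `q / Q`.
  have s1 : schur (fun k => z * t ^ k) n μ = z ^ μ.degree * vprod t n μ / vprod t n 0 := by
    rw [eq_div_iff hV0, h1]
  have s2 : schur (fun k => z * t ^ k) (n + m) κ =
      z ^ κ.degree * vprod t n κ / vprod t n 0 * q / Q := by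
    rw [eq_div_iff hQ, h3, ← h2, mul_div_assoc, div_self hV0, mul_one]
  rw [jointFormula, jointConst, eV, eq, eα, s1, s2, Nat.add_sub_cancel_left, eT, ← h4, hV0']
  have hn0 := hq (n - 1)
  have hm0 := hq (m - 1)
  generalize ∏ l ∈ Finset.Icc 1 (n - 1), qPoch t l = Qn at *
  generalize ∏ l ∈ Finset.Icc 1 (m - 1), qPoch t l = Qm at *
  generalize (∏ i ∈ Finset.Icc 1 n, ∏ j ∈ Finset.Icc 1 (n + m), (1 - z ^ 2 * t ^ (i + j - 2))) = Z1
  generalize (∏ i ∈ Finset.Icc 1 n, (1 - α * z * t ^ (i - 1))) = Z2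
  generalize t ^ (-∑ j ∈ Finset.Icc 1 m, (j : ℤ) * ((j : ℤ) - 1)) = t1 at *
  generalize t ^ (-(n : ℤ) * ∑ j ∈ Finset.Icc 1 m, (j : ℤ)) = t2 at *
  generalize t ^ (-∑ j ∈ Finset.Icc 1 (n + m), ((j : ℤ) - 1) * ((n : ℤ) - j)) = t3 at *
  generalize z ^ (-2 * ∑ j ∈ Finset.Icc 1 n, ((n : ℤ) - j)) = z1 at *
  generalize z ^ (∑ j : Fin n, (μ j + (n - 1 - j) + (κ j + (n - 1 - j)))) = z2 at *
  have step : z1 * (T⁻¹ / Qn) * t1 * t2 * (t3 / (Q * (Qm * Qn))) * Qm * Z1 * Z2 * z2 *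
      α ^ (μ.degree - κ.degree) * q * (vprod t n μ * vprod t n κ) =
      (z1 * z2) * (t1 * t2 * t3) * (T⁻¹ / Qn) * (1 / (Q * (Qm * Qn))) * Qm * Z1 * Z2 *
      α ^ (μ.degree - κ.degree) * q * (vprod t n μ * vprod t n κ) := by ring
  rw [step, ez, et]
  field_simp

end Constants

/-! ### The joint law of the two shapes. -/

section Law

theorem schur_nonneg {a : ℕ → ℝ} (ha : ∀ i, 0 ≤ a i) (m : ℕ) (μ : ℕ →₀ ℕ) : 0 ≤ schur a m μ := by
  induction m generalizing μ with
  | zero => rw [schur]; split_ifs <;> simp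
  | succ m ih => exact Finset.sum_nonneg fun l _ => mul_nonneg (pow_nonneg (ha m) _) (ih l)

theorem schur_ofReal {a : ℕ → ℝ} (ha : ∀ i, 0 ≤ a i) (m : ℕ) (μ : ℕ →₀ ℕ) :
    schur (fun i => ENNReal.ofReal (a i)) m μ = ENNReal.ofReal (schur a m μ) := by
  induction m generalizing μ with
  | zero => simp only [schur]; split_ifs <;> simp
  | succ m ih =>
    simp only [schur, ih]
    rw [ENNReal.ofReal_sum_of_nonneg fun l _ => mul_nonneg (pow_nonneg (ha m) _)
      (schur_nonneg ha m l)]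
    refine Finset.sum_congr rfl fun l _ => ?_
    rw [ENNReal.ofReal_mul (pow_nonneg (ha m) _), ENNReal.ofReal_pow (ha m)]

theorem schur_congr {R : Type*} [CommSemiring R] {a b : ℕ → R} {m : ℕ} (h : ∀ i < m, a i = b i)
    (μ : ℕ →₀ ℕ) : schur a m μ = schur b m μ := by
  induction m generalizing μ with
  | zero => rfl
  | succ m ih =>
    simp only [schur, h m (Nat.lt_succ_self m), ih fun i hi => h i (hi.trans (Nat.lt_succ_self m))]

/-- For independent geometric entries with parameters `a i * b j` the probability of a matrix is a
constant times its monomial, so the event has the mass computed in `tsum_colChain_pair`. -/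
theorem measure_hasRSKShape_pair {Ω : Type*} [MeasurableSpace Ω] (P : Measure Ω)
    [IsProbabilityMeasure P] {n₁ n₂ : ℕ} {X : Fin n₁ → Fin (n₂ + 1) → Ω → ℕ}
    {p : Fin n₁ → Fin (n₂ + 1) → ℝ} {a b : ℕ → ℝ≥0∞} (hp0 : ∀ i j, 0 ≤ p i j)
    (hp1 : ∀ i j, p i j ≤ 1) (hpab : ∀ i j, ENNReal.ofReal (p i j) = a i * b j)
    (hX : ∀ i j, Measurable (X i j))
    (hind : iIndepFun (fun q : Fin n₁ × Fin (n₂ + 1) => X q.1 q.2) P)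
    (hlaw : ∀ i j k, P.real {ω | X i j ω = k} = (1 - p i j) * p i j ^ k) (μ κ : YoungDiagram) :
    P {ω | HasRSKShape (Matrix.of fun i j => X i j ω) μ ∧
      HasRSKShape (Matrix.of fun (i : Fin n₁) (j : Fin n₂) => X i j.castSucc ω) κ} =
    (∏ j, ∏ i, ENNReal.ofReal (1 - p i j)) *
      (schur b n₂ (parts κ) * stripWt (b n₂) (parts κ) (parts μ) * schur a n₁ (parts μ)) := by
  classical
  set F : Ω → (Fin (n₂ + 1) → Fin n₁ → ℕ) := fun ω j i => X i j ω with hF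
  have hFm : Measurable F := measurable_pi_lambda _ fun j => measurable_pi_lambda _ fun i => hX i j
  set A : Set (Fin (n₂ + 1) → Fin n₁ → ℕ) := {x | lastShape (colChain x) = parts μ ∧
    lastShape (colChain fun j : Fin n₂ => x j.castSucc) = parts κ} with hA
  have hset : {ω | HasRSKShape (Matrix.of fun i j => X i j ω) μ ∧
      HasRSKShape (Matrix.of fun (i : Fin n₁) (j : Fin n₂) => X i j.castSucc ω) κ} = F ⁻¹' A := by
    ext ω
    -- A single extension by zero serves the matrix and its first `n₂` columns, so both shapes are
    -- read off one growth diagram.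
    set Y : ℕ → ℕ → ℕ := fun i j =>
      if h : i < n₁ ∧ j < n₂ + 1 then X ⟨i, h.1⟩ ⟨j, h.2⟩ ω else 0 with hY
    have hY1 : ∀ (i : Fin n₁) (j : Fin (n₂ + 1)), X i j ω = Y i j := by
      intro i j; rw [hY]; simp only [i.2, j.2, and_self, dif_pos]
    have hY2 : ∀ (i : Fin n₁) (j : Fin n₂), X i j.castSucc ω = Y i j := by
      intro i j; rw [hY1]; simp
    simp only [Set.mem_ofPred_eq, Set.mem_preimage, hA]
    rw [hasRSKShape_iff _ Y (by simpa using hY1), hasRSKShape_iff _ Y (by simpa using hY2),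
      lastShape_colChain _ Y (fun j i => hY1 i j), lastShape_colChain _ Y (fun j i => hY2 i j)]
  have hpt : ∀ x, Measure.map F P {x} = ∏ j, ∏ i, P (X i j ⁻¹' {x j i}) := by
    intro x
    rw [Measure.map_apply hFm (measurableSet_singleton _)]
    have h1 : F ⁻¹' {x} = ⋂ q ∈ (Finset.univ : Finset (Fin n₁ × Fin (n₂ + 1))),
        (fun q : Fin n₁ × Fin (n₂ + 1) => X q.1 q.2) q ⁻¹' {x q.2 q.1} := by
      ext ω
      simp only [Set.mem_preimage, Set.mem_singleton_iff, Finset.mem_univ, Set.iInter_true,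
        Set.mem_iInter, hF, funext_iff]
      exact ⟨fun h q => h q.2 q.1, fun h j i => h (i, j)⟩
    rw [h1, hind.measure_inter_preimage_eq_mul Finset.univ
      (sets := fun q => {x q.2 q.1}) (fun q _ => measurableSet_singleton _),
      Fintype.prod_prod_type_right]
  have hone : ∀ i j k, P (X i j ⁻¹' {k}) = ENNReal.ofReal (1 - p i j) * (a i * b j) ^ k := by
    intro i j k
    have h1 := hlaw i j k
    rw [← hpab, ← ENNReal.ofReal_pow (hp0 i j), ← ENNReal.ofReal_mul (by linarith [hp1 i j]), ← h1,
      ofReal_measureReal]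
    rfl
  rw [hset, ← Measure.map_apply hFm (Set.to_countable A).measurableSet,
    ← Measure.tsum_indicator_apply_singleton _ _ (Set.to_countable A).measurableSet,
    ← tsum_colChain_pair, ← ENNReal.tsum_mul_left]
  refine tsum_congr fun x => ?_
  rw [Set.indicator_apply, ← mul_assoc, ← Finset.prod_mul_distrib]
  simp only [hpt, hone, ← Finset.prod_mul_distrib, hA, Set.mem_ofPred_eq, mul_ite, mul_one, mul_zero]

theorem antitone_parts (μ : YoungDiagram) : Antitone (parts μ) := fun i j h => μ.rowLen_anti i j h

/-- The shift by `n - j` makes `μ (j + 1) ≤ κ j` strict and leaves `κ j ≤ μ j` weak. Parts from `n`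
on are invisible to `shiftedParts`, so they have to vanish. -/
theorem mem_strips_parts_iff {n : ℕ} {μ κ : YoungDiagram} (hμ : μ.rowLen n = 0)
    (hκ : κ.rowLen n = 0) : parts κ ∈ strips (parts μ) ↔
      DiscreteInterlace (shiftedParts n μ) (shiftedParts n κ) := by
  rw [mem_strips, DiscreteInterlace]
  simp only [shiftedParts, parts_apply]
  constructor
  · intro h
    refine ⟨fun i => by have := h i; omega, fun i j hij => ?_⟩
    have := h i
    have := j.2
    rw [hij] at *
    omega
  · rintro ⟨h1, h2⟩ k
    have hz : ∀ ν : YoungDiagram, ν.rowLen n = 0 → ∀ k, n ≤ k → ν.rowLen k = 0 := fun ν hν k hk => by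
      have := ν.rowLen_anti _ _ hk; omega
    rcases lt_or_ge k n with hk | hk
    · refine ⟨?_, by have := h1 ⟨k, hk⟩; simp at this; omega⟩
      rcases lt_or_ge (k + 1) n with hk1 | hk1
      · have := h2 ⟨k, hk⟩ ⟨k + 1, hk1⟩ rfl
        simp at this; omega
      · rw [hz μ hμ _ hk1]; omega
    · rw [hz μ hμ k hk, hz κ hκ k hk, hz μ hμ (k + 1) (by omega)]; simp

theorem prod_Icc_eq_prod_fin (N : ℕ) (f : ℕ → ℝ) :
    ∏ i ∈ Finset.Icc 1 N, f i = ∏ i : Fin N, f (i + 1) := by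
  rw [Fin.prod_univ_eq_prod_range (fun i => f (i + 1)) N, ← Finset.Ico_succ_right_eq_Icc,
    Finset.prod_Ico_eq_prod_range]
  exact Finset.prod_congr (by simp) fun i _ => by rw [add_comm]

theorem prod_one_sub_siteParam (n₁ n₂ : ℕ) (z α t : ℝ) :
    ∏ j : Fin (n₂ + 1), ∏ i : Fin n₁, (1 - siteParam z α t i j) =
      (∏ i ∈ Finset.Icc 1 n₁, ∏ j ∈ Finset.Icc 1 n₂, (1 - z ^ 2 * t ^ (i + j - 2))) *
      (∏ i ∈ Finset.Icc 1 n₁, (1 - α * z * t ^ (i - 1))) := by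
  simp only [prod_Icc_eq_prod_fin]
  rw [Fin.prod_univ_castSucc, Finset.prod_comm]
  congr 1
  · refine Finset.prod_congr rfl fun i _ => Finset.prod_congr rfl fun j _ => ?_
    have : j.castSucc ≠ Fin.last n₂ := (Fin.castSucc_lt_last j).ne
    simp only [siteParam, this, if_false, Fin.val_castSucc]
    rw [show (i : ℕ) + 1 + (j + 1) - 2 = i + j by omega]
  · refine Finset.prod_congr rfl fun i _ => ?_
    simp [siteParam]

theorem prod_one_sub_pos {n₁ n₂ : ℕ} {z α t : ℝ}
    (hp1 : ∀ (i : Fin n₁) (j : Fin (n₂ + 1)), siteParam z α t i j < 1) :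
    0 < (∏ i ∈ Finset.Icc 1 n₁, ∏ j ∈ Finset.Icc 1 n₂, (1 - z ^ 2 * t ^ (i + j - 2))) *
      (∏ i ∈ Finset.Icc 1 n₁, (1 - α * z * t ^ (i - 1))) := by
  rw [← prod_one_sub_siteParam]
  exact Finset.prod_pos fun j _ => Finset.prod_pos fun i _ => sub_pos.2 (hp1 i j)

theorem jointProb_eq {Ω : Type*} [MeasurableSpace Ω] (P : Measure Ω)
    [IsProbabilityMeasure P] {n₁ n₂ : ℕ} {z α t : ℝ} {X : Fin n₁ → Fin (n₂ + 1) → Ω → ℕ}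
    (hz : 0 < z) (hα : 0 < α) (ht : 0 < t)
    (hp1 : ∀ (i : Fin n₁) (j : Fin (n₂ + 1)), siteParam z α t i j < 1)
    (hX : ∀ i j, Measurable (X i j))
    (hind : iIndepFun (fun q : Fin n₁ × Fin (n₂ + 1) => X q.1 q.2) P)
    (hlaw : ∀ i j k, P.real {ω | X i j ω = k} =
      (1 - siteParam z α t i j) * siteParam z α t i j ^ k) (μ κ : YoungDiagram) :
    jointProb P X μ κ =
      (∏ i ∈ Finset.Icc 1 n₁, ∏ j ∈ Finset.Icc 1 n₂, (1 - z ^ 2 * t ^ (i + j - 2))) *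
      (∏ i ∈ Finset.Icc 1 n₁, (1 - α * z * t ^ (i - 1))) *
      (schur (fun k => z * t ^ k) n₂ (parts κ) *
        (if parts κ ∈ strips (parts μ) then α ^ ((parts μ).degree - (parts κ).degree) else 0) *
        schur (fun k => z * t ^ k) n₁ (parts μ)) := by
  have hzt : ∀ k : ℕ, 0 ≤ z * t ^ k := fun k => by positivity
  have hp0 : ∀ (i : Fin n₁) (j : Fin (n₂ + 1)), 0 ≤ siteParam z α t i j := by
    intro i j; rw [siteParam]; split_ifs <;> positivity
  -- The last column is an additional column variable `α`, because `α z t ^ i = (z t ^ i) α`.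
  set b : ℕ → ℝ≥0∞ := fun j => if j < n₂ then ENNReal.ofReal (z * t ^ j) else ENNReal.ofReal α with hb
  have hpab : ∀ (i : Fin n₁) (j : Fin (n₂ + 1)), ENNReal.ofReal (siteParam z α t i j) =
      ENNReal.ofReal (z * t ^ (i : ℕ)) * b j := by
    intro i j
    rw [siteParam]
    refine Fin.lastCases ?_ (fun j => ?_) j
    · simp only [if_true, hb, Fin.val_last, lt_irrefl, if_false]
      rw [← ENNReal.ofReal_mul (hzt _)]; congr 1; ring
    · have : j.castSucc ≠ Fin.last n₂ := (Fin.castSucc_lt_last j).ne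
      simp only [this, if_false, hb, Fin.val_castSucc, j.2, if_true]
      rw [← ENNReal.ofReal_mul (hzt _)]; congr 1; ring
  have key := measure_hasRSKShape_pair P (a := fun i => ENNReal.ofReal (z * t ^ i)) (b := b) hp0
    (fun i j => (hp1 i j).le) hpab hX hind hlaw μ κ
  have e1 : schur b n₂ (parts κ) = ENNReal.ofReal (schur (fun k => z * t ^ k) n₂ (parts κ)) := by
    rw [← schur_ofReal hzt]
    exact schur_congr (fun i hi => by simp [hb, hi]) _
  have e2 : stripWt (b n₂) (parts κ) (parts μ) = ENNReal.ofReal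
      (if parts κ ∈ strips (parts μ) then α ^ ((parts μ).degree - (parts κ).degree) else 0) := by
    rw [stripWt]
    split_ifs
    · simp [hb, ENNReal.ofReal_pow hα.le]
    · simp
  have e3 : ∏ j : Fin (n₂ + 1), ∏ i : Fin n₁, ENNReal.ofReal (1 - siteParam z α t i j) =
      ENNReal.ofReal ((∏ i ∈ Finset.Icc 1 n₁, ∏ j ∈ Finset.Icc 1 n₂, (1 - z ^ 2 * t ^ (i + j - 2))) *
      (∏ i ∈ Finset.Icc 1 n₁, (1 - α * z * t ^ (i - 1)))) := by
    have hpos : ∀ (i : Fin n₁) (j : Fin (n₂ + 1)), 0 ≤ 1 - siteParam z α t i j := fun i j =>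
      (sub_pos.2 (hp1 i j)).le
    rw [← prod_one_sub_siteParam, ENNReal.ofReal_prod_of_nonneg fun j _ =>
      Finset.prod_nonneg fun i _ => hpos i j]
    exact Finset.prod_congr rfl fun j _ => (ENNReal.ofReal_prod_of_nonneg fun i _ => hpos i j).symm
  have hC := (prod_one_sub_pos hp1).le
  have hS₁ := schur_nonneg hzt n₁ (parts μ)
  have hS₂ := schur_nonneg hzt n₂ (parts κ)
  have hite : 0 ≤ (if parts κ ∈ strips (parts μ) then
      α ^ ((parts μ).degree - (parts κ).degree) else 0) := by
    split_ifs <;> positivity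
  rw [jointProb, measureReal_def, key, e1, e2, e3, schur_ofReal hzt, ← ENNReal.ofReal_mul hS₂,
    ← ENNReal.ofReal_mul (mul_nonneg hS₂ hite), ← ENNReal.ofReal_mul hC, ENNReal.toReal_ofReal]
  exact mul_nonneg hC (mul_nonneg (mul_nonneg hS₂ hite) hS₁)

theorem schur_geometric_ne_zero {z t : ℝ} (hz : z ≠ 0) (ht : 0 < t) (ht1 : t ≠ 1) {n : ℕ}
    {μ : ℕ →₀ ℕ} (hμ : Antitone μ) (hn : μ n = 0) : schur (fun k => z * t ^ k) n μ ≠ 0 := by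
  have h := schur_geometric hz (t := t) n hμ hn
  intro h0
  rw [h0, zero_mul] at h
  exact mul_ne_zero (pow_ne_zero _ hz) (vprod_ne_zero ht ht1 n hμ) h.symm

theorem jointProb_law {Ω : Type*} [MeasurableSpace Ω] (P : Measure Ω)
    [IsProbabilityMeasure P] {n₁ n₂ : ℕ} (hn : n₁ ≤ n₂) {z α t : ℝ}
    {X : Fin n₁ → Fin (n₂ + 1) → Ω → ℕ} (hz : 0 < z) (hα : 0 < α) (ht : 0 < t) (ht1 : t ≠ 1)
    (hp1 : ∀ (i : Fin n₁) (j : Fin (n₂ + 1)), siteParam z α t i j < 1)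
    (hX : ∀ i j, Measurable (X i j))
    (hind : iIndepFun (fun q : Fin n₁ × Fin (n₂ + 1) => X q.1 q.2) P)
    (hlaw : ∀ i j k, P.real {ω | X i j ω = k} =
      (1 - siteParam z α t i j) * siteParam z α t i j ^ k) (μ κ : YoungDiagram) :
    (jointProb P X μ κ ≠ 0 ↔ μ.rowLen n₁ = 0 ∧ κ.rowLen n₁ = 0 ∧
        DiscreteInterlace (shiftedParts n₁ μ) (shiftedParts n₁ κ)) ∧
    (μ.rowLen n₁ = 0 → κ.rowLen n₁ = 0 →
      DiscreteInterlace (shiftedParts n₁ μ) (shiftedParts n₁ κ) →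
      jointProb P X μ κ =
        jointFormula n₁ n₂ z α t (shiftedParts n₁ μ) (shiftedParts n₁ κ)) := by
  have hC := prod_one_sub_pos hp1
  rw [jointProb_eq P hz hα ht hp1 hX hind hlaw μ κ]
  constructor
  · constructor
    · intro h
      obtain ⟨h1, h2⟩ := mul_ne_zero_iff.1 (mul_ne_zero_iff.1 h).2
      have hs : parts κ ∈ strips (parts μ) := by
        by_contra hs; simp [hs] at h1
      have hμ : μ.rowLen n₁ = 0 := by
        by_contra hμ; exact h2 (schur_eq_zero _ hμ)
      have hκ : κ.rowLen n₁ = 0 := by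
        have := (mem_strips.1 hs n₁).2
        simp only [parts_apply] at this
        omega
      exact ⟨hμ, hκ, (mem_strips_parts_iff hμ hκ).1 hs⟩
    · rintro ⟨hμ, hκ, hd⟩
      rw [if_pos ((mem_strips_parts_iff hμ hκ).2 hd)]
      refine mul_ne_zero hC.ne' (mul_ne_zero (mul_ne_zero ?_ (pow_ne_zero _ hα.ne')) ?_)
      · exact schur_geometric_ne_zero hz.ne' ht ht1 (antitone_parts κ)
          (apply_eq_zero_of_antitone (antitone_parts κ) hκ hn)
      · exact schur_geometric_ne_zero hz.ne' ht ht1 (antitone_parts μ) hμ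
  · intro hμ hκ hd
    have hs := (mem_strips_parts_iff hμ hκ).2 hd
    obtain ⟨m, rfl⟩ := Nat.exists_eq_add_of_le hn
    rw [if_pos hs]
    exact (jointFormula_eq hz.ne' ht ht1 n₁ m (antitone_parts μ) hμ (antitone_parts κ) hκ hs).symm

end Law

end LPP

namespace LPP

/-! ### The Jacobi limit of the explicit formula. -/

section Limit

open Filter Topology

/-- The slope of `1 - exp (-c u)` at `u = 0`, taken along `u = 1 / L`. -/
theorem tendsto_mul_one_sub_exp (c : ℝ) :
    Tendsto (fun L : ℝ => L * (1 - Real.exp (-c / L))) atTop (𝓝 c) := by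
  have h1 : HasDerivAt (fun u : ℝ => 1 - Real.exp (-c * u)) c 0 := by
    have := (((hasDerivAt_id (0 : ℝ)).const_mul (-c)).exp).const_sub 1
    simpa using this
  have h2 := (hasDerivAt_iff_tendsto_slope_zero.1 h1).comp
    (tendsto_inv_atTop_nhdsGT_zero.mono_right (nhdsWithin_mono (0 : ℝ) fun x hx => ne_of_gt hx))
  refine h2.congr fun L => ?_
  simp [div_eq_mul_inv]

theorem tendsto_exp_div (c : ℝ) : Tendsto (fun L : ℝ => Real.exp (-c / L)) atTop (𝓝 1) := by
  have : Tendsto (fun L : ℝ => -c / L) atTop (𝓝 0) := tendsto_const_nhds.div_atTop tendsto_id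
  simpa using this.rexp

theorem tendsto_exp_div_zpow (c : ℝ) (k : ℤ) :
    Tendsto (fun L : ℝ => Real.exp (-c / L) ^ k) atTop (𝓝 1) := by
  simpa using (tendsto_exp_div c).zpow₀ k (Or.inl one_ne_zero)

theorem tendsto_pow_mul_qPoch (l : ℕ) :
    Tendsto (fun L : ℝ => L ^ l * qPoch (Real.exp (-1 / L)) l) atTop (𝓝 (l.factorial : ℝ)) := by
  induction l with
  | zero => simp
  | succ l ih =>
    have h := ih.mul (tendsto_mul_one_sub_exp ((l + 1 : ℕ) : ℝ))
    rw [Nat.factorial_succ, mul_comm (l + 1), Nat.cast_mul]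
    refine h.congr fun L => ?_
    rw [qPoch_succ, ← Real.exp_nat_mul, pow_succ,
      show ((l + 1 : ℕ) : ℝ) * (-1 / L) = -((l + 1 : ℕ) : ℝ) / L by ring]
    ring

/-- The quotient has a fixed number `m` of factors while `r` grows like `L`, so its limit can be
taken factor by factor. -/
theorem qPoch_add_div {t : ℝ} (ht : 0 < t) (ht1 : t ≠ 1) (r m : ℕ) :
    qPoch t (r + m) / qPoch t r = ∏ k ∈ Finset.range m, (1 - t ^ (r + (k + 1))) := by
  induction m with
  | zero => simp [div_self (qPoch_ne_zero ht ht1 r)]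
  | succ m ih =>
    rw [Finset.prod_range_succ, ← ih, ← add_assoc, qPoch_succ]
    ring

theorem Gamma_add_nat_div {s : ℝ} (hs : 0 < s) (N : ℕ) :
    Real.Gamma (s + N) / Real.Gamma s = ∏ k ∈ Finset.range N, (s + k) := by
  induction N with
  | zero => simp [div_self (Real.Gamma_pos_of_pos hs).ne']
  | succ N ih =>
    rw [Finset.prod_range_succ, ← ih, Nat.cast_succ, ← add_assoc,
      Real.Gamma_add_one (by positivity)]
    ring

theorem tendsto_exp_div_pow {h : ℝ → ℕ} {x : ℝ}
    (hh : Tendsto (fun L : ℝ => (h L : ℝ) / L) atTop (𝓝 x)) :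
    Tendsto (fun L : ℝ => Real.exp (-1 / L) ^ h L) atTop (𝓝 (Real.exp (-x))) := by
  refine hh.neg.rexp.congr fun L => ?_
  rw [← Real.exp_nat_mul]
  congr 1; ring

/-- Both sides count powers of `L`. Each `qPoch t l` in a denominator costs `l` of them, and the
numerator absorbs one per site parameter together with those of its own `qPoch` factors. -/
theorem power_count (n m : ℕ) :
    2 * n + ∑ l ∈ Finset.Icc 1 (n - 1), l + ∑ l ∈ Finset.Icc 1 (n + m - 1), l =
      n * (n + m) + n + ∑ l ∈ Finset.Icc 1 (m - 1), l := by
  have h : ∀ N : ℕ, 2 * (∑ l ∈ Finset.Icc 1 (N - 1), l) + N = N * N := by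
    intro N
    cases N with
    | zero => simp
    | succ N =>
      rw [Nat.add_sub_cancel]
      induction N with
      | zero => simp
      | succ N ih => rw [Finset.sum_Icc_succ_top (by omega)]; linarith
  have h1 := h n
  have h2 := h m
  have h3 := h (n + m)
  linarith

theorem prod_pow_mul_qPoch (L t : ℝ) (N : ℕ) :
    ∏ l ∈ Finset.Icc 1 N, (L ^ l * qPoch t l) =
      L ^ (∑ l ∈ Finset.Icc 1 N, l) * ∏ l ∈ Finset.Icc 1 N, qPoch t l := by
  rw [Finset.prod_mul_distrib, Finset.prod_pow_eq_pow_sum]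

theorem pow_mul_jointFormula {L : ℝ} (hL : 0 < L) (n m : ℕ) (z α t : ℝ) (h r : Fin n → ℕ) :
    L ^ (2 * n) * jointFormula n (n + m) z α t h r =
      z ^ (-2 * ∑ j ∈ Finset.Icc 1 n, ((n : ℤ) - j))
      * (t ^ (-∑ j ∈ Finset.Icc 1 n, ((j : ℤ) - 1) * ((n : ℤ) - j))
          / ∏ l ∈ Finset.Icc 1 (n - 1), (L ^ l * qPoch t l))
      * t ^ (-∑ j ∈ Finset.Icc 1 m, (j : ℤ) * ((j : ℤ) - 1))
      * t ^ (-(n : ℤ) * ∑ j ∈ Finset.Icc 1 m, (j : ℤ))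
      * (t ^ (-∑ j ∈ Finset.Icc 1 (n + m), ((j : ℤ) - 1) * ((n : ℤ) - j))
          / ∏ l ∈ Finset.Icc 1 (n + m - 1), (L ^ l * qPoch t l))
      * (∏ l ∈ Finset.Icc 1 (m - 1), (L ^ l * qPoch t l))
      * (∏ i ∈ Finset.Icc 1 n, ∏ j ∈ Finset.Icc 1 (n + m), (L * (1 - z ^ 2 * t ^ (i + j - 2))))
      * (∏ i ∈ Finset.Icc 1 n, (L * (1 - α * z * t ^ (i - 1))))
      * z ^ (∑ j, (h j + r j))
      * α ^ (∑ j, ((h j : ℤ) - r j))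
      * (∏ i, qPoch t (r i + m) / qPoch t (r i))
      * ∏ i, ∏ j ∈ Finset.Ioi i, (t ^ h j - t ^ h i) * (t ^ r j - t ^ r i) := by
  have hq : ∏ i, qPoch t (r i + (n + m) - n) / qPoch t (r i) =
      ∏ i, qPoch t (r i + m) / qPoch t (r i) := by
    refine Finset.prod_congr rfl fun i _ => ?_
    rw [show r i + (n + m) - n = r i + m by omega]
  have hp : L ^ (2 * n) = L ^ (n * (n + m)) * L ^ n * L ^ (∑ l ∈ Finset.Icc 1 (m - 1), l) *
      (L ^ (∑ l ∈ Finset.Icc 1 (n - 1), l))⁻¹ * (L ^ (∑ l ∈ Finset.Icc 1 (n + m - 1), l))⁻¹ := by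
    have := power_count n m
    rw [← pow_add, ← pow_add, ← this, pow_add, pow_add]
    field_simp
  have hZ : ∏ i ∈ Finset.Icc 1 n, ∏ j ∈ Finset.Icc 1 (n + m),
      (L * (1 - z ^ 2 * t ^ (i + j - 2))) = L ^ (n * (n + m)) *
        ∏ i ∈ Finset.Icc 1 n, ∏ j ∈ Finset.Icc 1 (n + m), (1 - z ^ 2 * t ^ (i + j - 2)) := by
    simp only [Finset.prod_mul_distrib, Finset.prod_const, Nat.card_Icc, ← pow_mul,
      Nat.add_sub_cancel]
    rw [mul_comm n]
  have hZ' : ∏ i ∈ Finset.Icc 1 n, (L * (1 - α * z * t ^ (i - 1))) =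
      L ^ n * ∏ i ∈ Finset.Icc 1 n, (1 - α * z * t ^ (i - 1)) := by
    simp only [Finset.prod_mul_distrib, Finset.prod_const, Nat.card_Icc, Nat.add_sub_cancel]
  rw [jointFormula, jointConst, hq, Nat.add_sub_cancel_left, prod_pow_mul_qPoch,
    prod_pow_mul_qPoch, prod_pow_mul_qPoch, hZ, hZ', hp]
  simp only [div_eq_mul_inv, mul_inv]
  ring

/-- The Gamma quotients have integer shifts, so they are the finite products of linear factors that
arise as limits of `L (1 - t ^ c)`. -/
theorem limitConst_eq {a a₁ : ℝ} (ha : 0 < a) (ha₁ : 0 < a + a₁) (n m : ℕ) :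
    limitConst n (n + m) a a₁ =
      (∏ l ∈ Finset.Icc 1 (m - 1), (l.factorial : ℝ))
      / ((∏ l ∈ Finset.Icc 1 (n - 1), (l.factorial : ℝ))
        * ∏ l ∈ Finset.Icc 1 (n + m - 1), (l.factorial : ℝ))
      * (∏ k ∈ Finset.range n, (a + a₁ + k))
      * ∏ k ∈ Finset.range n, ∏ j ∈ Finset.range (n + m), (2 * a + k + j) := by
  rw [limitConst, Nat.add_sub_cancel_left, Gamma_add_nat_div ha₁, ← Finset.Ico_succ_right_eq_Icc 1 n,
    Finset.prod_Ico_eq_prod_range]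
  congr 1
  refine Finset.prod_congr (by simp) fun k _ => ?_
  rw [show 2 * a + ((1 + k : ℕ) : ℝ) - 1 = 2 * a + k by push_cast; ring,
    Gamma_add_nat_div (by positivity)]

theorem tendsto_jointFormula {a a₁ : ℝ} (ha : 0 < a) (ha₁ : 0 < a + a₁) (n m : ℕ)
    {x y : Fin n → ℝ} {h r : ℝ → Fin n → ℕ} (hxy : Interlace x y)
    (hh : ∀ j, Tendsto (fun L : ℝ => (h L j : ℝ) / L) atTop (𝓝 (x j)))
    (hr : ∀ j, Tendsto (fun L : ℝ => (r L j : ℝ) / L) atTop (𝓝 (y j))) :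
    Tendsto (fun L : ℝ => L ^ (2 * n) * jointFormula n (n + m) (Real.exp (-a / L))
      (Real.exp (-a₁ / L)) (Real.exp (-1 / L)) (h L) (r L)) atTop
      (𝓝 (limitDensity n (n + m) a a₁ x y)) := by
  have hlim : limitDensity n (n + m) a a₁ x y =
      1 * (1 / ∏ l ∈ Finset.Icc 1 (n - 1), (l.factorial : ℝ)) * 1 * 1 *
      (1 / ∏ l ∈ Finset.Icc 1 (n + m - 1), (l.factorial : ℝ)) *
      (∏ l ∈ Finset.Icc 1 (m - 1), (l.factorial : ℝ)) *
      (∏ i ∈ Finset.Icc 1 n, ∏ j ∈ Finset.Icc 1 (n + m), (2 * a + ((i + j - 2 : ℕ) : ℝ))) *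
      (∏ i ∈ Finset.Icc 1 n, (a + a₁ + ((i - 1 : ℕ) : ℝ))) *
      Real.exp (-a * ∑ j, (x j + y j)) * Real.exp (-a₁ * ∑ j, (x j - y j)) *
      (∏ i, ∏ _k ∈ Finset.range m, (1 - Real.exp (-y i))) *
      ∏ i, ∏ j ∈ Finset.Ioi i, (Real.exp (-x j) - Real.exp (-x i)) *
        (Real.exp (-y j) - Real.exp (-y i)) := by
    have e1 : ∏ i ∈ Finset.Icc 1 n, ∏ j ∈ Finset.Icc 1 (n + m), (2 * a + ((i + j - 2 : ℕ) : ℝ)) =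
        ∏ k ∈ Finset.range n, ∏ j ∈ Finset.range (n + m), (2 * a + k + j) := by
      simp only [prod_Icc_eq_prod_fin]
      rw [← Fin.prod_univ_eq_prod_range
        (fun k => ∏ j ∈ Finset.range (n + m), (2 * a + (k : ℝ) + j)) n]
      refine Finset.prod_congr rfl fun i _ => ?_
      rw [← Fin.prod_univ_eq_prod_range (fun j => (2 * a + (i : ℝ) + j)) (n + m)]
      refine Finset.prod_congr rfl fun j _ => ?_
      rw [show (i : ℕ) + 1 + (j + 1) - 2 = i + j by omega]
      push_cast; ring
    have e2 : ∏ i ∈ Finset.Icc 1 n, (a + a₁ + ((i - 1 : ℕ) : ℝ)) =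
        ∏ k ∈ Finset.range n, (a + a₁ + k) := by
      rw [prod_Icc_eq_prod_fin n (fun i => a + a₁ + ((i - 1 : ℕ) : ℝ)),
        ← Fin.prod_univ_eq_prod_range (fun k => (a + a₁ + (k : ℝ))) n]
      simp
    have e3 : ∏ i : Fin n, ∏ j ∈ Finset.Ioi i, (Real.exp (-x j) - Real.exp (-x i)) *
        (Real.exp (-y j) - Real.exp (-y i)) = ∏ i : Fin n, ∏ j ∈ Finset.Ioi i,
        (Real.exp (-y j) - Real.exp (-y i)) * (Real.exp (-x j) - Real.exp (-x i)) := by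
      simp only [mul_comm]
    rw [limitDensity, if_pos hxy, limitConst_eq ha ha₁, e1, e2, e3, Nat.add_sub_cancel_left]
    simp only [Finset.prod_const, Finset.card_range]
    ring
  rw [hlim]
  have hpos : ∀ᶠ L : ℝ in atTop, 0 < L := eventually_gt_atTop 0
  have hfact : ∀ N, ∏ l ∈ Finset.Icc 1 N, (l.factorial : ℝ) ≠ 0 := fun N =>
    Finset.prod_ne_zero_iff.2 fun l _ => by exact_mod_cast l.factorial_ne_zero
  have hQ : ∀ N, Tendsto (fun L : ℝ => ∏ l ∈ Finset.Icc 1 N, (L ^ l * qPoch (Real.exp (-1 / L)) l))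
      atTop (𝓝 (∏ l ∈ Finset.Icc 1 N, (l.factorial : ℝ))) := fun N =>
    tendsto_finsetProd _ fun l _ => tendsto_pow_mul_qPoch l
  have hZ1 : Tendsto (fun L : ℝ => ∏ i ∈ Finset.Icc 1 n, ∏ j ∈ Finset.Icc 1 (n + m),
      (L * (1 - Real.exp (-a / L) ^ 2 * Real.exp (-1 / L) ^ (i + j - 2)))) atTop
      (𝓝 (∏ i ∈ Finset.Icc 1 n, ∏ j ∈ Finset.Icc 1 (n + m), (2 * a + ((i + j - 2 : ℕ) : ℝ)))) := by
    refine tendsto_finsetProd _ fun i _ => tendsto_finsetProd _ fun j _ => ?_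
    refine (tendsto_mul_one_sub_exp (2 * a + ((i + j - 2 : ℕ) : ℝ))).congr fun L => ?_
    rw [← Real.exp_nat_mul, ← Real.exp_nat_mul, ← Real.exp_add]
    congr 3
    push_cast
    ring
  have hZ2 : Tendsto (fun L : ℝ => ∏ i ∈ Finset.Icc 1 n,
      (L * (1 - Real.exp (-a₁ / L) * Real.exp (-a / L) * Real.exp (-1 / L) ^ (i - 1)))) atTop
      (𝓝 (∏ i ∈ Finset.Icc 1 n, (a + a₁ + ((i - 1 : ℕ) : ℝ)))) := by
    refine tendsto_finsetProd _ fun i _ => ?_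
    refine (tendsto_mul_one_sub_exp (a + a₁ + ((i - 1 : ℕ) : ℝ))).congr fun L => ?_
    rw [← Real.exp_nat_mul, ← Real.exp_add, ← Real.exp_add]
    congr 3
    ring
  have hz : Tendsto (fun L : ℝ => Real.exp (-a / L) ^ (∑ j, (h L j + r L j))) atTop
      (𝓝 (Real.exp (-a * ∑ j, (x j + y j)))) := by
    have := ((tendsto_finsetSum Finset.univ fun j _ => (hh j).add (hr j)).const_mul (-a)).rexp
    refine this.congr fun L => ?_
    rw [← Real.exp_nat_mul]
    congr 1
    push_cast
    simp only [← add_div, ← Finset.sum_div]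
    ring
  have hα : Tendsto (fun L : ℝ => Real.exp (-a₁ / L) ^ (∑ j, ((h L j : ℤ) - r L j))) atTop
      (𝓝 (Real.exp (-a₁ * ∑ j, (x j - y j)))) := by
    have := ((tendsto_finsetSum Finset.univ fun j _ => (hh j).sub (hr j)).const_mul (-a₁)).rexp
    refine this.congr fun L => ?_
    rw [← Real.rpow_intCast, ← Real.exp_mul]
    congr 1
    push_cast
    simp only [← sub_div, ← Finset.sum_div]
    ring
  have hq : Tendsto (fun L : ℝ => ∏ i, qPoch (Real.exp (-1 / L)) (r L i + m) /
      qPoch (Real.exp (-1 / L)) (r L i)) atTop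
      (𝓝 (∏ i, ∏ _k ∈ Finset.range m, (1 - Real.exp (-y i)))) := by
    refine tendsto_finsetProd _ fun i _ => ?_
    have h1 : Tendsto (fun L : ℝ => ∏ k ∈ Finset.range m,
        (1 - Real.exp (-1 / L) ^ (r L i + (k + 1)))) atTop
        (𝓝 (∏ _k ∈ Finset.range m, (1 - Real.exp (-y i)))) := by
      refine tendsto_finsetProd _ fun k _ => ?_
      have h2 := (tendsto_exp_div_pow (hr i)).mul (tendsto_exp_div_zpow 1 ((k + 1 : ℕ) : ℤ))
      rw [mul_one] at h2
      refine (h2.const_sub 1).congr fun L => ?_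
      rw [pow_add, zpow_natCast]
    refine h1.congr' ?_
    -- Positivity of `L` ensures `exp (-1 / L) ≠ 1`, so that no `qPoch` in the quotient is zero.
    filter_upwards [hpos] with L hL
    rw [qPoch_add_div (Real.exp_pos _)]
    rw [Ne, Real.exp_eq_one_iff]
    exact div_ne_zero (by norm_num) hL.ne'
  have hV : Tendsto (fun L : ℝ => ∏ i, ∏ j ∈ Finset.Ioi i,
      (Real.exp (-1 / L) ^ h L j - Real.exp (-1 / L) ^ h L i) *
        (Real.exp (-1 / L) ^ r L j - Real.exp (-1 / L) ^ r L i)) atTop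
      (𝓝 (∏ i, ∏ j ∈ Finset.Ioi i, (Real.exp (-x j) - Real.exp (-x i)) *
        (Real.exp (-y j) - Real.exp (-y i)))) :=
    tendsto_finsetProd _ fun i _ => tendsto_finsetProd _ fun j _ =>
      ((tendsto_exp_div_pow (hh j)).sub (tendsto_exp_div_pow (hh i))).mul
        ((tendsto_exp_div_pow (hr j)).sub (tendsto_exp_div_pow (hr i)))
  have hall := (((((((((((tendsto_exp_div_zpow a (-2 * ∑ j ∈ Finset.Icc 1 n, ((n : ℤ) - j))).mul
    ((tendsto_exp_div_zpow 1 (-∑ j ∈ Finset.Icc 1 n, ((j : ℤ) - 1) * ((n : ℤ) - j))).div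
      (hQ (n - 1)) (hfact _))).mul
    (tendsto_exp_div_zpow 1 (-∑ j ∈ Finset.Icc 1 m, (j : ℤ) * ((j : ℤ) - 1)))).mul
    (tendsto_exp_div_zpow 1 (-(n : ℤ) * ∑ j ∈ Finset.Icc 1 m, (j : ℤ)))).mul
    ((tendsto_exp_div_zpow 1 (-∑ j ∈ Finset.Icc 1 (n + m), ((j : ℤ) - 1) * ((n : ℤ) - j))).div
      (hQ (n + m - 1)) (hfact _))).mul (hQ (m - 1))).mul hZ1).mul hZ2).mul hz).mul hα).mul hq).mul
    hV
  refine hall.congr' ?_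
  filter_upwards [hpos] with L hL
  rw [pow_mul_jointFormula hL]
  rfl

end Limit

end LPP

namespace LPP

/-! ### Integrals of determinants and the Beta determinant. -/

section DeterminantIntegrals

variable {n : ℕ}

theorem integrable_prod_coord {ν : Fin n → Measure ℝ} [∀ i, SigmaFinite (ν i)]
    {F : Fin n → ℝ → ℝ} (hF : ∀ i, Integrable (F i) (ν i)) :
    Integrable (fun x : Fin n → ℝ => ∏ i, F i (x i)) (Measure.pi ν) :=
  Integrable.fintype_prod_dep hF

theorem integrable_det {ν : Fin n → Measure ℝ} [∀ i, SigmaFinite (ν i)]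
    {F : Fin n → Fin n → ℝ → ℝ} (hF : ∀ i k, Integrable (F i k) (ν i)) :
    Integrable (fun x : Fin n → ℝ => (Matrix.of fun i k => F i k (x i)).det) (Measure.pi ν) := by
  simp only [← Matrix.det_transpose (Matrix.of _), Matrix.det_apply', Matrix.transpose_apply,
    Matrix.of_apply]
  exact integrable_finsetSum _ fun σ _ => (integrable_prod_coord fun i => hF i (σ i)).const_mul _

/-- Row `i` involves only `x i`, so every Leibniz term factors under Fubini. The measures may vary
with the row, as needed for the interlacing intervals. -/
theorem integral_det {ν : Fin n → Measure ℝ} [∀ i, SigmaFinite (ν i)]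
    {F : Fin n → Fin n → ℝ → ℝ} (hF : ∀ i k, Integrable (F i k) (ν i)) :
    ∫ x : Fin n → ℝ, (Matrix.of fun i k => F i k (x i)).det ∂(Measure.pi ν) =
      (Matrix.of fun i k => ∫ u, F i k u ∂(ν i)).det := by
  simp only [← Matrix.det_transpose (Matrix.of _), Matrix.det_apply', Matrix.transpose_apply,
    Matrix.of_apply]
  rw [integral_finsetSum _ fun σ _ => (integrable_prod_coord fun i => hF i (σ i)).const_mul _]
  refine Finset.sum_congr rfl fun σ _ => ?_
  rw [integral_const_mul, integral_fintype_prod_eq_prod (μ := ν) (fun i => F i (σ i))]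

/-- Expanding the first determinant and absorbing its factors into the rows of the second leaves
determinants whose row `i` depends only on `y i`. -/
theorem det_mul_det_eq_sum (p q : Fin n → ℝ → ℝ) (y : Fin n → ℝ) :
    (Matrix.of fun i k => p k (y i)).det * (Matrix.of fun i l => q l (y i)).det =
      ∑ σ : Equiv.Perm (Fin n), ((σ.sign : ℤ) : ℝ) *
        (Matrix.of fun i l => p (σ i) (y i) * q l (y i)).det := by
  rw [← Matrix.det_transpose, Matrix.det_apply', Finset.sum_mul]
  refine Finset.sum_congr rfl fun σ _ => ?_
  rw [mul_assoc]
  congr 1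
  exact (Matrix.det_mul_column (fun i => p (σ i) (y i)) (Matrix.of fun i l => q l (y i))).symm

theorem integrable_det_mul_det {ν : Measure ℝ} [SigmaFinite ν] {p q : Fin n → ℝ → ℝ}
    (h : ∀ k l, Integrable (fun u => p k u * q l u) ν) :
    Integrable (fun y : Fin n → ℝ => (Matrix.of fun i k => p k (y i)).det *
      (Matrix.of fun i l => q l (y i)).det) (Measure.pi fun _ => ν) := by
  simp only [det_mul_det_eq_sum]
  exact integrable_finsetSum _ fun σ _ =>
    (integrable_det (F := fun i l u => p (σ i) u * q l u) fun i l => h (σ i) l).const_mul _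

/-- **Andréief's identity.** -/
theorem integral_det_mul_det {ν : Measure ℝ} [SigmaFinite ν] {p q : Fin n → ℝ → ℝ}
    (h : ∀ k l, Integrable (fun u => p k u * q l u) ν) :
    ∫ y : Fin n → ℝ, (Matrix.of fun i k => p k (y i)).det *
      (Matrix.of fun i l => q l (y i)).det ∂(Measure.pi fun _ => ν) =
      n.factorial * (Matrix.of fun k l => ∫ u, p k u * q l u ∂ν).det := by
  simp only [det_mul_det_eq_sum]
  rw [integral_finsetSum _ fun σ _ =>
    (integrable_det (F := fun i l u => p (σ i) u * q l u) fun i l => h (σ i) l).const_mul _]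
  have key : ∀ σ : Equiv.Perm (Fin n), ∫ y : Fin n → ℝ, ((σ.sign : ℤ) : ℝ) *
        (Matrix.of fun i l => p (σ i) (y i) * q l (y i)).det ∂(Measure.pi fun _ => ν) =
      (Matrix.of fun k l => ∫ u, p k u * q l u ∂ν).det := by
    intro σ
    rw [integral_const_mul,
      integral_det (F := fun i l u => p (σ i) u * q l u) fun i l => h (σ i) l]
    -- After integration the term of `σ` is a row permutation of one fixed matrix. Its sign cancels
    -- the explicit one, so all `n!` terms agree.
    have := Matrix.det_permute σ (Matrix.of fun k l => ∫ u, p k u * q l u ∂ν)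
    refine (congrArg _ this).trans ?_
    rw [← mul_assoc, ← Int.cast_mul, Int.units_coe_mul_self, Int.cast_one, one_mul]
  simp only [key, Finset.sum_const, Finset.card_univ, Fintype.card_perm, Fintype.card_fin,
    nsmul_eq_mul]

/-- Exactly one permutation arranges pairwise distinct coordinates in decreasing order, and at the
other points `Φ` vanishes. -/
theorem sum_indicator_strictAnti_perm {Φ : (Fin n → ℝ) → ℝ≥0∞}
    (hz : ∀ y, ¬ Function.Injective y → Φ y = 0) (y : Fin n → ℝ) :
    ∑ σ : Equiv.Perm (Fin n), {y : Fin n → ℝ | StrictAnti (y ∘ σ)}.indicator Φ y = Φ y := by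
  classical
  by_cases hy : Function.Injective y
  · have hex : StrictAnti (y ∘ (Tuple.sort y * Fin.revPerm : Equiv.Perm (Fin n))) := by
      have h1 : StrictMono (y ∘ Tuple.sort y) :=
        (Tuple.monotone_sort y).strictMono_of_injective (hy.comp (Tuple.sort y).injective)
      intro i j hij
      exact h1 (Fin.rev_lt_rev.2 hij)
    rw [Finset.sum_eq_single (Tuple.sort y * Fin.revPerm : Equiv.Perm (Fin n))]
    · exact Set.indicator_of_mem (s := {y : Fin n → ℝ | _}) hex Φ
    · intro σ _ hσ
      refine Set.indicator_of_notMem (fun h => hσ ?_) Φ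
      have h2 := Tuple.unique_antitone (StrictAnti.antitone h) hex.antitone
      ext i
      exact congrArg Fin.val (hy (congrFun h2 i))
    · simp
  · rw [hz y hy]
    refine Finset.sum_eq_zero fun σ _ => ?_
    by_cases h : y ∈ {y : Fin n → ℝ | StrictAnti (y ∘ σ)}
    · rw [Set.indicator_of_mem h, hz y hy]
    · rw [Set.indicator_of_notMem h]

theorem measurableSet_strictAnti : MeasurableSet {y : Fin n → ℝ | StrictAnti y} := by
  have : {y : Fin n → ℝ | StrictAnti y} =
      ⋂ (i : Fin n) (j : Fin n) (_ : i < j), {y | y j < y i} := by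
    ext y; simp [StrictAnti]
  rw [this]
  exact MeasurableSet.iInter fun i => MeasurableSet.iInter fun j => MeasurableSet.iInter fun _ =>
    measurableSet_lt (measurable_pi_apply j) (measurable_pi_apply i)

theorem lintegral_symmetric {Φ : (Fin n → ℝ) → ℝ≥0∞} (hΦ : Measurable Φ)
    (hz : ∀ y, ¬ Function.Injective y → Φ y = 0)
    (hs : ∀ (σ : Equiv.Perm (Fin n)) y, Φ (y ∘ σ) = Φ y) :
    ∫⁻ y, Φ y = n.factorial * ∫⁻ y in {y | StrictAnti y}, Φ y := by
  have hm : Measurable ({y : Fin n → ℝ | StrictAnti y}.indicator Φ) :=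
    hΦ.indicator measurableSet_strictAnti
  have hmp : ∀ σ : Equiv.Perm (Fin n), MeasurePreserving (fun y : Fin n → ℝ => y ∘ σ) :=
    fun σ => volume_preserving_arrowCongr' σ.symm (.refl ℝ) (.id volume)
  have hσ : ∀ σ : Equiv.Perm (Fin n),
      {y : Fin n → ℝ | StrictAnti (y ∘ σ)}.indicator Φ =
        fun y => {y : Fin n → ℝ | StrictAnti y}.indicator Φ (y ∘ σ) := by
    intro σ; ext y
    simp only [Set.indicator_apply, Set.mem_ofPred_eq, hs]
  calc ∫⁻ y, Φ y = ∫⁻ y, ∑ σ : Equiv.Perm (Fin n),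
        {y : Fin n → ℝ | StrictAnti (y ∘ σ)}.indicator Φ y := by
        simp only [sum_indicator_strictAnti_perm hz]
    _ = ∑ σ : Equiv.Perm (Fin n), ∫⁻ y,
        {y : Fin n → ℝ | StrictAnti (y ∘ σ)}.indicator Φ y := by
        refine lintegral_finsetSum _ fun σ _ => ?_
        rw [hσ]
        exact hm.comp (hmp σ).measurable
    _ = ∑ σ : Equiv.Perm (Fin n), ∫⁻ y in {y | StrictAnti y}, Φ y := by
        refine Finset.sum_congr rfl fun σ _ => ?_
        rw [hσ, (hmp σ).lintegral_comp hm, lintegral_indicator measurableSet_strictAnti]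
    _ = _ := by
        simp [Finset.card_univ, Fintype.card_perm]

theorem integrableOn_exp_mul_one_sub_pow {s : ℝ} (hs : 0 < s) (p : ℕ) :
    IntegrableOn (fun u : ℝ => Real.exp (-s * u) * (1 - Real.exp (-u)) ^ p) (Set.Ioi 0) := by
  induction p generalizing s with
  | zero => simpa using integrableOn_exp_mul_Ioi (neg_lt_zero.2 hs) 0
  | succ p ih =>
    refine ((ih hs).sub (ih (s := s + 1) (by linarith))).congr_fun (fun u _ => ?_)
      measurableSet_Ioi
    simp only [Pi.sub_apply]
    rw [show -(s + 1) * u = -s * u + -u by ring, Real.exp_add]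
    ring

/-- The Beta integral in the variable `exp (-u)`. Splitting off one factor `1 - exp (-u)` gives a
recursion from `s` and `s + 1`. -/
theorem integral_exp_mul_one_sub_pow {s : ℝ} (hs : 0 < s) (p : ℕ) :
    ∫ u in Set.Ioi (0 : ℝ), Real.exp (-s * u) * (1 - Real.exp (-u)) ^ p =
      Real.Gamma s * p.factorial / Real.Gamma (s + p + 1) := by
  induction p generalizing s with
  | zero =>
    have := integral_exp_mul_Ioi (neg_lt_zero.2 hs) 0
    have hG := (Real.Gamma_pos_of_pos hs).ne'
    simp only [pow_zero, mul_one, this, mul_zero, Real.exp_zero, Nat.factorial_zero, Nat.cast_one,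
      Nat.cast_zero, add_zero, Real.Gamma_add_one hs.ne']
    field_simp
  | succ p ih =>
    have h1 : ∀ u : ℝ, Real.exp (-s * u) * (1 - Real.exp (-u)) ^ (p + 1) =
        Real.exp (-s * u) * (1 - Real.exp (-u)) ^ p -
          Real.exp (-(s + 1) * u) * (1 - Real.exp (-u)) ^ p := by
      intro u
      rw [show -(s + 1) * u = -s * u + -u by ring, Real.exp_add]
      ring
    simp only [h1]
    rw [integral_sub (integrableOn_exp_mul_one_sub_pow hs p)
      (integrableOn_exp_mul_one_sub_pow (by linarith) p), ih hs, ih (by linarith),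
      Real.Gamma_add_one hs.ne', show s + 1 + (p : ℝ) + 1 = (s + p + 1) + 1 by ring,
      show s + ((p + 1 : ℕ) : ℝ) + 1 = (s + p + 1) + 1 by push_cast; ring,
      Real.Gamma_add_one (show s + p + 1 ≠ 0 by positivity), Nat.factorial_succ]
    have hG := (Real.Gamma_pos_of_pos (show 0 < s + p + 1 by positivity)).ne'
    have : s + p + 1 ≠ 0 := by positivity
    push_cast
    field_simp
    ring

theorem Gamma_add_nat_eq_ascPochhammer {s : ℝ} (hs : 0 < s) (l : ℕ) :
    Real.Gamma (s + l) = Real.Gamma s * (ascPochhammer ℝ l).eval s := by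
  induction l with
  | zero => simp
  | succ l ih =>
    rw [ascPochhammer_succ_eval, Nat.cast_succ, ← add_assoc, Real.Gamma_add_one (by positivity), ih]
    ring

/-- `Γ(s + k + l)` is `Γ(s + k)` times a monic polynomial of degree `l` in `s + k`. The determinant
is therefore a Vandermonde determinant at consecutive points, that is, a superfactorial. -/
theorem det_Gamma {s : ℝ} (hs : 0 < s) (n : ℕ) :
    (Matrix.of fun k l : Fin n => Real.Gamma (s + k + l)).det =
      (∏ k : Fin n, Real.Gamma (s + k)) * ∏ l ∈ Finset.Icc 1 (n - 1), (l.factorial : ℝ) := by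
  have h1 : (Matrix.of fun k l : Fin n => Real.Gamma (s + k + l)) =
      Matrix.of fun k l : Fin n => Real.Gamma (s + k) *
        (Matrix.of fun k l : Fin n => (ascPochhammer ℝ l).eval (s + (k : ℝ))) k l := by
    ext k l
    exact Gamma_add_nat_eq_ascPochhammer (by positivity) l
  rw [h1, Matrix.det_mul_column]
  congr 1
  rw [← Matrix.det_eval_matrixOfPolynomials_eq_det_vandermonde (fun k : Fin n => s + (k : ℝ))
    (fun l => ascPochhammer ℝ l) (fun l => ascPochhammer_natDegree ℝ l)
    (fun l => monic_ascPochhammer ℝ l)]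
  simp only [add_comm s]
  rw [Matrix.det_vandermonde_add]
  cases n with
  | zero => simp
  | succ n =>
    rw [Matrix.det_vandermonde_id_eq_superFactorial, Nat.add_sub_cancel, ← Nat.prod_Icc_factorial]
    push_cast
    rfl

/-- The basis `v ^ l (1 - v) ^ (n - 1 - l)` makes the denominator of the Beta integral independent
of `l` (`hc`). Denominators leave by rows, factorials by columns, and `det_Gamma` remains. -/
theorem det_beta {s : ℝ} (hs : 0 < s) (n m : ℕ) :
    (Matrix.of fun k l : Fin n => ∫ u in Set.Ioi (0 : ℝ),
      (Real.exp (-(s + k) * u) * (1 - Real.exp (-u)) ^ m) *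
        (Real.exp (-u) ^ (l : ℕ) * (1 - Real.exp (-u)) ^ (n - 1 - l))).det =
    (∏ k : Fin n, Real.Gamma (s + k) / Real.Gamma (s + k + (n + m : ℕ))) *
      (∏ l : Fin n, ((n - 1 - l + m).factorial : ℝ)) *
      ∏ l ∈ Finset.Icc 1 (n - 1), (l.factorial : ℝ) := by
  have h1 : (Matrix.of fun k l : Fin n => ∫ u in Set.Ioi (0 : ℝ),
      (Real.exp (-(s + k) * u) * (1 - Real.exp (-u)) ^ m) *
        (Real.exp (-u) ^ (l : ℕ) * (1 - Real.exp (-u)) ^ (n - 1 - l))) =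
      Matrix.of fun k l : Fin n => (Real.Gamma (s + k + (n + m : ℕ)))⁻¹ *
        (Matrix.of fun k l : Fin n => ((n - 1 - l + m).factorial : ℝ) *
          (Matrix.of fun k l : Fin n => Real.Gamma (s + k + l)) k l) k l := by
    ext k l
    have e : ∀ u : ℝ, (Real.exp (-(s + k) * u) * (1 - Real.exp (-u)) ^ m) *
        (Real.exp (-u) ^ (l : ℕ) * (1 - Real.exp (-u)) ^ (n - 1 - l : ℕ)) =
        Real.exp (-(s + k + l) * u) * (1 - Real.exp (-u)) ^ (n - 1 - l + m) := by
      intro u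
      rw [← Real.exp_nat_mul, show -(s + k + l) * u = -(s + k) * u + (l : ℕ) * -u by ring,
        Real.exp_add, pow_add]
      ring
    have hc : s + (k : ℝ) + l + ((n - 1 - l + m : ℕ) : ℝ) + 1 = s + k + (n + m : ℕ) := by
      have : (l : ℕ) + (n - 1 - l + m) + 1 = n + m := by have := l.2; omega
      rw [← this]; push_cast; ring
    simp only [Matrix.of_apply, e]
    rw [integral_exp_mul_one_sub_pow (by positivity), hc]
    ring
  rw [h1, Matrix.det_mul_column, Matrix.det_mul_row, det_Gamma hs, Finset.prod_div_distrib,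
    Finset.prod_inv_distrib]
  ring

end DeterminantIntegrals

end LPP

namespace LPP

/-! ### Total mass of the limiting density. -/

section TotalMass

theorem det_exp {n : ℕ} (c : ℝ) (x : Fin n → ℝ) :
    (Matrix.of fun i k : Fin n => Real.exp (-(c + k) * x i)).det =
      Real.exp (-c * ∑ i, x i) *
        ∏ i, ∏ j ∈ Finset.Ioi i, (Real.exp (-x j) - Real.exp (-x i)) := by
  have h : (Matrix.of fun i k : Fin n => Real.exp (-(c + k) * x i)) =
      Matrix.of fun i k : Fin n => Real.exp (-c * x i) *
        Matrix.vandermonde (fun i => Real.exp (-x i)) i k := by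
    ext i k
    rw [Matrix.of_apply, Matrix.of_apply, Matrix.vandermonde_apply, ← Real.exp_nat_mul,
      ← Real.exp_add]
    congr 1; ring
  rw [h, Matrix.det_mul_column, Matrix.det_vandermonde, Finset.mul_sum, Real.exp_sum]

/-- A homogeneous Vandermonde determinant at the points `(v i, 1 - v i)`, whose two-by-two minors `v
j (1 - v i) - v i (1 - v j)` simplify to `v j - v i`. -/
theorem det_pow_mul_one_sub_pow {n : ℕ} (v : Fin n → ℝ) :
    (Matrix.of fun i l : Fin n => v i ^ (l : ℕ) * (1 - v i) ^ (n - 1 - l : ℕ)).det =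
      ∏ i, ∏ j ∈ Finset.Ioi i, (v j - v i) := by
  have h : (Matrix.of fun i l : Fin n => v i ^ (l : ℕ) * (1 - v i) ^ (n - 1 - l : ℕ)) =
      Matrix.projVandermonde v (fun i => 1 - v i) := by
    ext i l
    rw [Matrix.projVandermonde_apply, Matrix.of_apply, Fin.val_rev]
    congr 2
    omega
  rw [h, Matrix.det_projVandermonde]
  refine Finset.prod_congr rfl fun i _ => Finset.prod_congr rfl fun j _ => ?_
  ring

theorem Interlace.strictAnti {n : ℕ} {x y : Fin n → ℝ} (h : Interlace x y) : StrictAnti y := by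
  cases n with
  | zero => intro i; exact i.elim0
  | succ n =>
    rw [Fin.strictAnti_iff_succ_lt]
    exact fun i => (h.1 i.succ).trans (h.2.1 i.castSucc i.succ (by simp))

theorem Interlace.strictAnti_left {n : ℕ} {x y : Fin n → ℝ} (h : Interlace x y) :
    StrictAnti x := by
  cases n with
  | zero => intro i; exact i.elim0
  | succ n =>
    rw [Fin.strictAnti_iff_succ_lt]
    exact fun i => (h.2.1 i.castSucc i.succ (by simp)).trans (h.1 i.castSucc)

theorem limitConst_pos {a a₁ : ℝ} (ha : 0 < a) (ha₁ : 0 < a + a₁) (n m : ℕ) :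
    0 < limitConst n (n + m) a a₁ := by
  have hfact : ∀ N, 0 < ∏ l ∈ Finset.Icc 1 N, (l.factorial : ℝ) := fun N =>
    Finset.prod_pos fun l _ => by exact_mod_cast l.factorial_pos
  rw [limitConst_eq ha ha₁]
  refine mul_pos (mul_pos (div_pos (hfact _) (mul_pos (hfact _) (hfact _))) ?_) ?_
  · exact Finset.prod_pos fun k _ => by positivity
  · exact Finset.prod_pos fun k _ => Finset.prod_pos fun j _ => by positivity

theorem limitDensity_nonneg {a a₁ : ℝ} (ha : 0 < a) (ha₁ : 0 < a + a₁) (n m : ℕ)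
    (x y : Fin n → ℝ) : 0 ≤ limitDensity n (n + m) a a₁ x y := by
  rw [limitDensity]
  split_ifs with h
  · have hV : 0 ≤ ∏ i, ∏ j ∈ Finset.Ioi i,
        (Real.exp (-y j) - Real.exp (-y i)) * (Real.exp (-x j) - Real.exp (-x i)) := by
      refine Finset.prod_nonneg fun i _ => Finset.prod_nonneg fun j hj => ?_
      have hij := Finset.mem_Ioi.1 hj
      refine mul_nonneg (sub_nonneg.2 (Real.exp_le_exp.2 ?_)) (sub_nonneg.2 (Real.exp_le_exp.2 ?_))
      · exact neg_le_neg (h.strictAnti hij).le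
      · exact neg_le_neg (h.strictAnti_left hij).le
    have hB : 0 ≤ ∏ i, (1 - Real.exp (-y i)) ^ (n + m - n) := by
      refine Finset.prod_nonneg fun i _ => pow_nonneg (sub_nonneg.2 ?_) _
      exact Real.exp_le_one_iff.2 (neg_nonpos.2 (h.2.2 i).le)
    have := (limitConst_pos ha ha₁ n m).le
    positivity
  · exact le_rfl

theorem measurableSet_interlace (n : ℕ) :
    MeasurableSet {p : (Fin n → ℝ) × (Fin n → ℝ) | Interlace p.1 p.2} := by
  have : {p : (Fin n → ℝ) × (Fin n → ℝ) | Interlace p.1 p.2} =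
      (⋂ i, {p | p.2 i < p.1 i}) ∩ (⋂ (i : Fin n) (j : Fin n) (_ : (j : ℕ) = i + 1),
        {p | p.1 j < p.2 i}) ∩ ⋂ i, {p | 0 < p.2 i} := by
    ext p; simp [Interlace, and_assoc]
  rw [this]
  refine (MeasurableSet.inter ?_ ?_).inter ?_
  · exact MeasurableSet.iInter fun i => measurableSet_lt (by fun_prop) (by fun_prop)
  · exact MeasurableSet.iInter fun i => MeasurableSet.iInter fun j => MeasurableSet.iInter fun _ =>
      measurableSet_lt (by fun_prop) (by fun_prop)
  · exact MeasurableSet.iInter fun i => measurableSet_lt (by fun_prop) (by fun_prop)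

theorem measurable_limitDensity (n₁ n₂ : ℕ) (a a₁ : ℝ) :
    Measurable fun p : (Fin n₁ → ℝ) × (Fin n₁ → ℝ) => limitDensity n₁ n₂ a a₁ p.1 p.2 := by
  classical
  unfold limitDensity
  refine Measurable.ite (measurableSet_interlace n₁) ?_ measurable_const
  exact Continuous.measurable (by fun_prop)

/-- The interval of the coordinate `i` of the points that interlace with `y`. -/
def box {n : ℕ} (y : Fin (n + 1) → ℝ) : Fin (n + 1) → Set ℝ :=
  Fin.cases (Set.Ioi (y 0)) fun i => Set.Ioo (y i.succ) (y i.castSucc)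

@[simp] theorem box_zero {n : ℕ} (y : Fin (n + 1) → ℝ) : box y 0 = Set.Ioi (y 0) := rfl

@[simp] theorem box_succ {n : ℕ} (y : Fin (n + 1) → ℝ) (i : Fin n) :
    box y i.succ = Set.Ioo (y i.succ) (y i.castSucc) := rfl

theorem box_subset_Ioi {n : ℕ} (y : Fin (n + 1) → ℝ) (i : Fin (n + 1)) :
    box y i ⊆ Set.Ioi (y i) := by
  refine Fin.cases ?_ (fun i => ?_) i
  · simp
  · exact Set.Ioo_subset_Ioi_self

theorem measurableSet_box {n : ℕ} (y : Fin (n + 1) → ℝ) (i : Fin (n + 1)) :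
    MeasurableSet (box y i) := by
  refine Fin.cases ?_ (fun i => ?_) i
  · exact measurableSet_Ioi
  · exact measurableSet_Ioo

theorem interlace_iff_mem_box {n : ℕ} {x y : Fin (n + 1) → ℝ} (hy : ∀ i, 0 < y i) :
    Interlace x y ↔ x ∈ Set.univ.pi (box y) := by
  rw [Set.mem_univ_pi, Fin.forall_fin_succ]
  simp only [box_zero, box_succ, Set.mem_Ioi, Set.mem_Ioo, Interlace]
  constructor
  · rintro ⟨h1, h2, -⟩
    exact ⟨h1 0, fun i => ⟨h1 _, h2 i.castSucc i.succ (by simp)⟩⟩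
  · rintro ⟨h1, h2⟩
    refine ⟨Fin.cases h1 fun i => (h2 i).1, fun i j hij => ?_, hy⟩
    have hj : j ≠ 0 := by rintro rfl; simp at hij
    obtain ⟨k, rfl⟩ := Fin.exists_succ_eq.2 hj
    have : i = k.castSucc := by ext; simpa using hij.symm
    rw [this]
    exact (h2 k).2

theorem integrableOn_exp_box {n : ℕ} {s : ℝ} (hs : 0 < s) (y : Fin (n + 1) → ℝ) (i : Fin (n + 1)) :
    IntegrableOn (fun u : ℝ => Real.exp (-s * u)) (box y i) :=
  (integrableOn_exp_mul_Ioi (neg_lt_zero.2 hs) (y i)).mono_set (box_subset_Ioi y i)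

theorem setIntegral_exp_Ioi {s : ℝ} (hs : 0 < s) (u₀ : ℝ) :
    ∫ u in Set.Ioi u₀, Real.exp (-s * u) = s⁻¹ * Real.exp (-s * u₀) := by
  rw [integral_exp_mul_Ioi (neg_lt_zero.2 hs)]
  field_simp

theorem setIntegral_exp_Ioo {s : ℝ} (hs : 0 < s) {u₀ u₁ : ℝ} (h : u₀ ≤ u₁) :
    s⁻¹ * Real.exp (-s * u₀) =
      (∫ u in Set.Ioo u₀ u₁, Real.exp (-s * u)) + s⁻¹ * Real.exp (-s * u₁) := by
  have hi := integrableOn_exp_mul_Ioi (neg_lt_zero.2 hs) u₀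
  rw [← setIntegral_exp_Ioi hs, ← setIntegral_exp_Ioi hs, ← Set.Ioc_union_Ioi_eq_Ioi h,
    setIntegral_union (Set.Ioc_disjoint_Ioi le_rfl) measurableSet_Ioi
      (hi.mono_set Set.Ioc_subset_Ioi_self) (hi.mono_set (Set.Ioi_subset_Ioi h)),
    integral_Ioc_eq_integral_Ioo]

/-- Integrating row `i` gives the difference of `exp (-s u) / s` at `y i` and at the preceding `y`,
with no second term in row `0`. Adding to each row the one above it removes the differences without
changing the determinant. -/
theorem integral_det_exp_box {n : ℕ} {c : ℝ} (hc : 0 < c) {y : Fin (n + 1) → ℝ}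
    (hy : StrictAnti y) :
    ∫ x in Set.univ.pi (box y), (Matrix.of fun i k : Fin (n + 1) => Real.exp (-(c + k) * x i)).det =
      (∏ k : Fin (n + 1), (c + k)⁻¹) *
        (Matrix.of fun i k : Fin (n + 1) => Real.exp (-(c + k) * y i)).det := by
  have hck : ∀ k : Fin (n + 1), 0 < c + (k : ℕ) := fun k => by positivity
  rw [volume_pi, Measure.restrict_pi_pi,
    integral_det (F := fun _ k u => Real.exp (-(c + k) * u))
      fun i k => integrableOn_exp_box (hck k) y i,
    ← Matrix.det_mul_row]
  symm
  refine Matrix.det_eq_of_forall_row_eq_smul_add_pred (fun _ => 1) ?_ ?_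
  · intro k
    simp only [Matrix.of_apply, box_zero]
    rw [setIntegral_exp_Ioi (hck k)]
  · intro i k
    simp only [Matrix.of_apply, box_succ, one_mul]
    exact setIntegral_exp_Ioo (hck k) (hy i.castSucc_lt_succ).le

/-- Collecting exponents gives `a + a₁` for `x` and `a - a₁` for `y`. The first merges with the
Vandermonde product in `x` into one determinant. -/
theorem limitDensity_eq_indicator {n : ℕ} (m : ℕ) (a a₁ : ℝ) (x : Fin (n + 1) → ℝ)
    {y : Fin (n + 1) → ℝ} (hy : ∀ i, 0 < y i) :
    limitDensity (n + 1) (n + 1 + m) a a₁ x y = (Set.univ.pi (box y)).indicator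
      (fun x => limitConst (n + 1) (n + 1 + m) a a₁ * (∏ i, (1 - Real.exp (-y i)) ^ m) *
        (∏ i, ∏ j ∈ Finset.Ioi i, (Real.exp (-y j) - Real.exp (-y i))) *
        Real.exp (-(a - a₁) * ∑ i, y i) *
        (Matrix.of fun i k : Fin (n + 1) => Real.exp (-(a + a₁ + k) * x i)).det) x := by
  classical
  rw [limitDensity, Set.indicator_apply]
  simp only [interlace_iff_mem_box hy]
  refine if_congr Iff.rfl ?_ rfl
  rw [det_exp, Nat.add_sub_cancel_left]
  have e : Real.exp (-a * ∑ j, (x j + y j)) * Real.exp (-a₁ * ∑ j, (x j - y j)) =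
      Real.exp (-(a - a₁) * ∑ i, y i) * Real.exp (-(a + a₁) * ∑ i, x i) := by
    rw [← Real.exp_add, ← Real.exp_add, Finset.sum_add_distrib, Finset.sum_sub_distrib]
    congr 1; ring
  simp only [Finset.prod_mul_distrib]
  rw [mul_assoc _ (Real.exp _) (Real.exp _), e]
  ring

/-- The marginal density of `y` before normalisation and restriction to decreasing vectors. -/
noncomputable def jacobiProd (n m : ℕ) (s : ℝ) (y : Fin n → ℝ) : ℝ :=
  (Matrix.of fun i k : Fin n => Real.exp (-(s + k) * y i) * (1 - Real.exp (-y i)) ^ m).det *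
    (Matrix.of fun i l : Fin n =>
      Real.exp (-y i) ^ (l : ℕ) * (1 - Real.exp (-y i)) ^ (n - 1 - l : ℕ)).det

theorem jacobiProd_eq (n m : ℕ) (s : ℝ) (y : Fin n → ℝ) :
    jacobiProd n m s y = (∏ i, (1 - Real.exp (-y i)) ^ m) * Real.exp (-s * ∑ i, y i) *
      (∏ i, ∏ j ∈ Finset.Ioi i, (Real.exp (-y j) - Real.exp (-y i))) ^ 2 := by
  have h : (Matrix.of fun i k : Fin n => Real.exp (-(s + k) * y i) * (1 - Real.exp (-y i)) ^ m) =
      Matrix.of fun i k : Fin n => (1 - Real.exp (-y i)) ^ m *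
        (Matrix.of fun i k : Fin n => Real.exp (-(s + k) * y i)) i k := by
    ext i k; simp [mul_comm]
  rw [jacobiProd, h, Matrix.det_mul_column, det_exp, det_pow_mul_one_sub_pow]
  ring

/-- The integral over `x` returns the exponent `a + a₁` and a second Vandermonde product in `y`. The
exponents add up to `2 a`, so `a₁` survives only in the constant. -/
theorem lintegral_limitDensity_left {n : ℕ} (m : ℕ) {a a₁ : ℝ} (ha : 0 < a) (ha₁ : 0 < a + a₁)
    {y : Fin (n + 1) → ℝ} (hy : ∀ i, 0 < y i) (hya : StrictAnti y) :
    ∫⁻ x, ENNReal.ofReal (limitDensity (n + 1) (n + 1 + m) a a₁ x y) =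
      ENNReal.ofReal (limitConst (n + 1) (n + 1 + m) a a₁ * (∏ k : Fin (n + 1), (a + a₁ + k)⁻¹)) *
        ENNReal.ofReal (jacobiProd (n + 1) m (2 * a) y) := by
  have hck : ∀ k : Fin (n + 1), 0 < a + a₁ + (k : ℕ) := fun k => by positivity
  have hbox : MeasurableSet (Set.univ.pi (box y)) :=
    MeasurableSet.univ_pi fun i => measurableSet_box y i
  have hint : IntegrableOn (fun x : Fin (n + 1) → ℝ =>
      (Matrix.of fun i k : Fin (n + 1) => Real.exp (-(a + a₁ + k) * x i)).det)
      (Set.univ.pi (box y)) := by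
    rw [IntegrableOn, volume_pi, Measure.restrict_pi_pi]
    exact integrable_det (F := fun _ k u => Real.exp (-(a + a₁ + k) * u))
      fun i k => integrableOn_exp_box (hck k) y i
  have hfun : (fun x => limitDensity (n + 1) (n + 1 + m) a a₁ x y) = _ :=
    funext fun x => limitDensity_eq_indicator m a a₁ x hy
  rw [← ofReal_integral_eq_lintegral_ofReal]
  · have hD := jacobiProd_eq (n + 1) m (2 * a) y
    rw [hfun, integral_indicator hbox, integral_const_mul, integral_det_exp_box ha₁ hya,
      ← ENNReal.ofReal_mul (mul_nonneg (limitConst_pos ha ha₁ _ m).le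
        (Finset.prod_nonneg fun k _ => (inv_pos.2 (hck k)).le)), hD, det_exp]
    congr 1
    have e : Real.exp (-(2 * a) * ∑ i, y i) =
        Real.exp (-(a - a₁) * ∑ i, y i) * Real.exp (-(a + a₁) * ∑ i, y i) := by
      rw [← Real.exp_add]; congr 1; ring
    rw [e]
    ring
  · rw [hfun, integrable_indicator_iff hbox]
    exact hint.const_mul _
  · exact Filter.Eventually.of_forall fun x => limitDensity_nonneg ha ha₁ _ m x y

/-- `jacobiProd` is symmetric and vanishes at coincident points, so its integral over decreasing
vectors is the full one divided by `n!`. Andréief's identity produces the same `n!`. -/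
theorem lintegral_jacobiProd (n m : ℕ) {s : ℝ} (hs : 0 < s) :
    ∫⁻ y in {y : Fin n → ℝ | StrictAnti y}, (Set.univ.pi fun _ => Set.Ioi (0 : ℝ)).indicator
      (fun y => ENNReal.ofReal (jacobiProd n m s y)) y =
    ENNReal.ofReal ((∏ k : Fin n, Real.Gamma (s + k) / Real.Gamma (s + k + (n + m : ℕ))) *
      (∏ l : Fin n, ((n - 1 - l + m).factorial : ℝ)) *
      ∏ l ∈ Finset.Icc 1 (n - 1), (l.factorial : ℝ)) := by
  set p : Fin n → ℝ → ℝ := fun k u => Real.exp (-(s + k) * u) * (1 - Real.exp (-u)) ^ m with hp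
  set q : Fin n → ℝ → ℝ := fun l u =>
    Real.exp (-u) ^ (l : ℕ) * (1 - Real.exp (-u)) ^ (n - 1 - l : ℕ) with hq
  have hpos : MeasurableSet (Set.univ.pi fun _ : Fin n => Set.Ioi (0 : ℝ)) :=
    MeasurableSet.univ_pi fun _ => measurableSet_Ioi
  have hcont : Continuous (jacobiProd n m s) := by
    have : jacobiProd n m s = _ := funext fun y => jacobiProd_eq n m s y
    rw [this]
    fun_prop
  have hpq : ∀ k l, Integrable (fun u => p k u * q l u) (volume.restrict (Set.Ioi 0)) := by
    intro k l
    have h := integrableOn_exp_mul_one_sub_pow (show 0 < s + k + l by positivity) (n - 1 - l + m)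
    refine h.congr_fun (fun u _ => ?_) measurableSet_Ioi
    simp only [hp, hq]
    rw [← Real.exp_nat_mul, show -(s + k + l) * u = -(s + k) * u + (l : ℕ) * -u by ring,
      Real.exp_add, pow_add]
    ring
  have hsym := lintegral_symmetric
    (Φ := (Set.univ.pi fun _ => Set.Ioi (0 : ℝ)).indicator
      (fun y : Fin n → ℝ => ENNReal.ofReal (jacobiProd n m s y)))
    (hcont.measurable.ennreal_ofReal.indicator hpos) ?_ ?_
  · have hI : ∫⁻ y, (Set.univ.pi fun _ => Set.Ioi (0 : ℝ)).indicator
        (fun y : Fin n → ℝ => ENNReal.ofReal (jacobiProd n m s y)) y = n.factorial *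
        ENNReal.ofReal (Matrix.of fun k l => ∫ u in Set.Ioi 0, p k u * q l u).det := by
      rw [lintegral_indicator hpos, ← ofReal_integral_eq_lintegral_ofReal, volume_pi,
        Measure.restrict_pi_pi]
      · have := integral_det_mul_det hpq
        refine (congrArg ENNReal.ofReal this).trans ?_
        rw [ENNReal.ofReal_mul (by positivity), ENNReal.ofReal_natCast]
      · rw [volume_pi, Measure.restrict_pi_pi]
        exact integrable_det_mul_det hpq
      · refine (ae_restrict_mem hpos).mono fun y hy => ?_
        rw [jacobiProd_eq]
        refine mul_nonneg (mul_nonneg (Finset.prod_nonneg fun i _ => pow_nonneg ?_ _)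
          (Real.exp_pos _).le) (sq_nonneg _)
        have := hy i (Set.mem_univ i)
        exact sub_nonneg.2 (Real.exp_le_one_iff.2 (neg_nonpos.2 (Set.mem_Ioi.1 this).le))
    rw [hI, det_beta hs n m] at hsym
    exact ((ENNReal.mul_right_inj (by exact_mod_cast n.factorial_ne_zero)
      (ENNReal.natCast_ne_top _)).1 hsym).symm
  · intro y hy
    rw [Function.Injective] at hy
    push Not at hy
    obtain ⟨i, j, hij, hne⟩ := hy
    refine Set.indicator_apply_eq_zero.2 fun _ => ?_
    rw [jacobiProd, Matrix.det_zero_of_row_eq hne (by ext k; simp [hij]), zero_mul,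
      ENNReal.ofReal_zero]
  · intro σ y
    classical
    simp only [Set.indicator_apply, Set.mem_univ_pi, Set.mem_Ioi, Function.comp_apply]
    refine if_congr ?_ ?_ rfl
    · exact ⟨fun h i => by simpa using h (σ.symm i), fun h i => h _⟩
    · have h1 := Matrix.det_permute σ (Matrix.of fun i k : Fin n =>
        Real.exp (-(s + k) * y i) * (1 - Real.exp (-y i)) ^ m)
      have h2 := Matrix.det_permute σ (Matrix.of fun i l : Fin n =>
        Real.exp (-y i) ^ (l : ℕ) * (1 - Real.exp (-y i)) ^ (n - 1 - l : ℕ))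
      congr 1
      refine (congrArg₂ (· * ·) h1 h2).trans ?_
      rw [mul_mul_mul_comm, ← Int.cast_mul, Int.units_coe_mul_self, Int.cast_one, one_mul]
      rfl

theorem lintegral_limitDensity (n m : ℕ) {a a₁ : ℝ} (ha : 0 < a) (ha₁ : 0 < a + a₁) :
    ∫⁻ p : (Fin (n + 1) → ℝ) × (Fin (n + 1) → ℝ),
      ENNReal.ofReal (limitDensity (n + 1) (n + 1 + m) a a₁ p.1 p.2) = 1 := by
  have hck : ∀ k : Fin (n + 1), 0 < a + a₁ + (k : ℕ) := fun k => by positivity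
  have hm := (measurable_limitDensity (n + 1) (n + 1 + m) a a₁).ennreal_ofReal
  -- The variable `x` is integrated first, with `y` fixed.
  rw [Measure.volume_eq_prod, lintegral_prod_symm' _ hm]
  set C := limitConst (n + 1) (n + 1 + m) a a₁ * (∏ k : Fin (n + 1), (a + a₁ + k)⁻¹) with hC
  have hC0 : 0 ≤ C := mul_nonneg (limitConst_pos ha ha₁ _ m).le
        (Finset.prod_nonneg fun k _ => (inv_pos.2 (hck k)).le)
  have hinner : ∀ y : Fin (n + 1) → ℝ,
      ∫⁻ x, ENNReal.ofReal (limitDensity (n + 1) (n + 1 + m) a a₁ x y) =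
      {y : Fin (n + 1) → ℝ | StrictAnti y}.indicator (fun y => ENNReal.ofReal C *
        (Set.univ.pi fun _ => Set.Ioi (0 : ℝ)).indicator
          (fun y => ENNReal.ofReal (jacobiProd (n + 1) m (2 * a) y)) y) y := by
    intro y
    by_cases hy : (∀ i, 0 < y i) ∧ StrictAnti y
    · rw [lintegral_limitDensity_left m ha ha₁ hy.1 hy.2,
        Set.indicator_of_mem (show y ∈ {y : Fin (n + 1) → ℝ | StrictAnti y} from hy.2),
        Set.indicator_of_mem (by simpa [Set.mem_univ_pi] using hy.1)]
    · have h0 : ∀ x, limitDensity (n + 1) (n + 1 + m) a a₁ x y = 0 := fun x => by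
        rw [limitDensity, if_neg]
        exact fun h => hy ⟨h.2.2, h.strictAnti⟩
      simp only [h0, ENNReal.ofReal_zero, lintegral_zero]
      symm
      refine Set.indicator_apply_eq_zero.2 fun h1 => ?_
      rw [Set.indicator_of_notMem, mul_zero]
      intro h2
      exact hy ⟨by simpa [Set.mem_univ_pi] using h2, h1⟩
  simp only [hinner]
  rw [lintegral_indicator measurableSet_strictAnti, lintegral_const_mul' _ _ ENNReal.ofReal_ne_top,
    lintegral_jacobiProd _ _ (by positivity), ← ENNReal.ofReal_mul hC0, ENNReal.ofReal_eq_one, hC,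
    limitConst_eq ha ha₁]
  have hF : ∀ N, ∏ l ∈ Finset.Icc 1 (N - 1), (l.factorial : ℝ) =
      ∏ l ∈ Finset.range N, (l.factorial : ℝ) := by
    intro N
    cases N with
    | zero => simp
    | succ N =>
      rw [Finset.prod_range_succ', Nat.factorial_zero, Nat.cast_one, mul_one, Nat.add_sub_cancel,
        prod_Icc_eq_prod_fin N (fun l => (l.factorial : ℝ)),
        Fin.prod_univ_eq_prod_range (fun l => ((l + 1).factorial : ℝ)) N]
  have hF0 : ∀ N, ∏ l ∈ Finset.range N, (l.factorial : ℝ) ≠ 0 := fun N =>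
    Finset.prod_ne_zero_iff.2 fun l _ => by exact_mod_cast l.factorial_ne_zero
  have e1 : ∏ l : Fin (n + 1), ((n + 1 - 1 - l + m).factorial : ℝ) =
      ∏ l ∈ Finset.range (n + 1), ((m + l).factorial : ℝ) := by
    rw [Fin.prod_univ_eq_prod_range (fun l => ((n + 1 - 1 - l + m).factorial : ℝ)) (n + 1),
      Finset.prod_range_reflect (fun l => ((l + m).factorial : ℝ)) (n + 1)]
    simp only [add_comm m]
  have e2 : ∏ k : Fin (n + 1), (a + a₁ + k)⁻¹ = (∏ k ∈ Finset.range (n + 1), (a + a₁ + k))⁻¹ := by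
    rw [Finset.prod_inv_distrib, Fin.prod_univ_eq_prod_range (fun k => a + a₁ + (k : ℝ)) (n + 1)]
  have e3 : ∏ k : Fin (n + 1), Real.Gamma (2 * a + k) /
      Real.Gamma (2 * a + k + (n + 1 + m : ℕ)) =
      (∏ k ∈ Finset.range (n + 1), ∏ j ∈ Finset.range (n + 1 + m), (2 * a + k + j))⁻¹ := by
    rw [← Finset.prod_inv_distrib, Fin.prod_univ_eq_prod_range (fun k => Real.Gamma (2 * a + k) /
      Real.Gamma (2 * a + k + (n + 1 + m : ℕ))) (n + 1)]
    refine Finset.prod_congr rfl fun k _ => ?_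
    rw [← Gamma_add_nat_div (by positivity), inv_div]
  have n1 : ∏ k ∈ Finset.range (n + 1), (a + a₁ + k) ≠ 0 :=
    Finset.prod_ne_zero_iff.2 fun k _ => by positivity
  have n2 : ∏ k ∈ Finset.range (n + 1), ∏ j ∈ Finset.range (n + 1 + m), (2 * a + (k : ℝ) + j) ≠ 0 :=
    Finset.prod_ne_zero_iff.2 fun k _ => Finset.prod_ne_zero_iff.2 fun j _ => by positivity
  have n3 := hF0 (n + 1)
  have n4 := hF0 m
  have n5 : ∏ l ∈ Finset.range (n + 1), ((m + l).factorial : ℝ) ≠ 0 :=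
    Finset.prod_ne_zero_iff.2 fun l _ => by exact_mod_cast (m + l).factorial_ne_zero
  rw [e1, e2, e3, hF, hF, hF, show n + 1 + m = m + (n + 1) by ring,
    Finset.prod_range_add (fun l => (l.factorial : ℝ)) m (n + 1)]
  rw [show n + 1 + m = m + (n + 1) by ring] at n2
  field_simp

end TotalMass

end LPP

namespace LPP

/-! ### The change of variables to the Jacobi ensemble. -/

section ChangeOfVariables

/-- The map acts on each coordinate separately, so its derivative is diagonal. Its image is the open
positive orthant, which contains the support of `G`. -/
theorem lintegral_exp_neg_pi (m : ℕ) (G : (Fin m → ℝ) → ℝ≥0∞)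
    (hG : ∀ u, G u ≠ 0 → ∀ k, 0 < u k) :
    ∫⁻ v : Fin m → ℝ, ENNReal.ofReal (∏ k, Real.exp (-v k)) * G (fun k => Real.exp (-v k)) =
      ∫⁻ u, G u := by
  set E : (Fin m → ℝ) → (Fin m → ℝ) := fun v k => Real.exp (-v k) with hE
  set E' : (Fin m → ℝ) → (Fin m → ℝ) →L[ℝ] (Fin m → ℝ) := fun v =>
    ContinuousLinearMap.pi fun k => (-Real.exp (-v k)) • ContinuousLinearMap.proj k with hE'
  have hder : ∀ v ∈ Set.univ, HasFDerivWithinAt E (E' v) Set.univ v := by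
    intro v _
    rw [hasFDerivWithinAt_univ, hasFDerivAt_pi]
    intro k
    have h := ((hasFDerivAt_apply (𝕜 := ℝ) k v).neg).exp
    have h' : HasFDerivAt (fun v : Fin m → ℝ => Real.exp (-v k))
        (Real.exp (-v k) • -ContinuousLinearMap.proj k) v := h
    refine h'.congr_fderiv ?_
    ext w
    simp
  have hinj : Set.InjOn E Set.univ := by
    intro v _ w _ h
    ext k
    have := congrFun h k
    simpa [hE] using this
  have hdet : ∀ v, |(E' v).det| = ∏ k, Real.exp (-v k) := by
    intro v
    have h1 : ((E' v : (Fin m → ℝ) →L[ℝ] (Fin m → ℝ)) : (Fin m → ℝ) →ₗ[ℝ] (Fin m → ℝ)) =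
        Matrix.toLin' (Matrix.diagonal fun k => -Real.exp (-v k)) := by
      ext w k
      simp [hE', Matrix.toLin'_apply, Matrix.mulVec_diagonal]
    rw [ContinuousLinearMap.det, h1, LinearMap.det_toLin', Matrix.det_diagonal, Finset.abs_prod]
    simp
  have key := lintegral_image_eq_lintegral_abs_det_fderiv_mul volume MeasurableSet.univ hder hinj G
  simp only [Measure.restrict_univ, hdet] at key
  rw [← key, ← lintegral_indicator]
  · refine lintegral_congr fun u => ?_
    by_cases hu : u ∈ E '' Set.univ
    · rw [Set.indicator_of_mem hu]
    · rw [Set.indicator_of_notMem hu]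
      by_contra h
      refine hu ⟨fun k => -Real.log (u k), Set.mem_univ _, ?_⟩
      ext k
      simp [hE, Real.exp_log (hG u (Ne.symm h) k)]
  · exact measurable_image_of_fderivWithin MeasurableSet.univ hder hinj

/-- The position in `u` of `x_i` (left) and of `y_i` (right). -/
def posEquiv (n : ℕ) : Fin n ⊕ Fin n ≃ Fin (2 * n) where
  toFun := Sum.elim (fun i => ⟨2 * i.rev + 1, by have := i.rev.2; omega⟩)
    (fun i => ⟨2 * i.rev, by have := i.rev.2; omega⟩)
  invFun k := if (k : ℕ) % 2 = 0 then Sum.inr (Fin.rev ⟨k / 2, by omega⟩)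
    else Sum.inl (Fin.rev ⟨k / 2, by omega⟩)
  left_inv := by
    rintro (i | i)
    · have h1 : (2 * (i.rev : ℕ) + 1) % 2 ≠ 0 := by omega
      have h2 : (2 * (i.rev : ℕ) + 1) / 2 = i.rev := by omega
      simp only [Sum.elim_inl, h1, if_false, h2, Fin.eta, Fin.rev_rev]
    · have h1 : (2 * (i.rev : ℕ)) % 2 = 0 := by omega
      have h2 : (2 * (i.rev : ℕ)) / 2 = i.rev := by omega
      simp only [Sum.elim_inr, h1, if_true, h2, Fin.eta, Fin.rev_rev]
  right_inv k := by
    dsimp only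
    split_ifs with h
    · ext; simp only [Sum.elim_inr, Fin.rev_rev]; omega
    · ext; simp only [Sum.elim_inl, Fin.rev_rev]; omega

theorem toJacobi_eq (n : ℕ) (p : (Fin n → ℝ) × (Fin n → ℝ)) (k : Fin (2 * n)) :
    toJacobi n p k = Real.exp (-Sum.elim p.1 p.2 ((posEquiv n).symm k)) := by
  rw [toJacobi]
  simp only [posEquiv, Equiv.coe_fn_symm_mk]
  split_ifs <;> rfl

theorem toJacobi_inl (n : ℕ) (p : (Fin n → ℝ) × (Fin n → ℝ)) (i : Fin n) :
    toJacobi n p (posEquiv n (Sum.inl i)) = Real.exp (-p.1 i) := by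
  rw [toJacobi_eq, Equiv.symm_apply_apply, Sum.elim_inl]

theorem toJacobi_inr (n : ℕ) (p : (Fin n → ℝ) × (Fin n → ℝ)) (i : Fin n) :
    toJacobi n p (posEquiv n (Sum.inr i)) = Real.exp (-p.2 i) := by
  rw [toJacobi_eq, Equiv.symm_apply_apply, Sum.elim_inr]

theorem evenEntry_toJacobi (n : ℕ) (p : (Fin n → ℝ) × (Fin n → ℝ)) (i : Fin n) :
    evenEntry (toJacobi n p) i = Real.exp (-p.1 i.rev) := by
  rw [← toJacobi_inl, evenEntry]
  simp only [posEquiv, Equiv.coe_fn_mk, Sum.elim_inl, Fin.rev_rev]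

theorem oddEntry_toJacobi (n : ℕ) (p : (Fin n → ℝ) × (Fin n → ℝ)) (i : Fin n) :
    oddEntry (toJacobi n p) i = Real.exp (-p.2 i.rev) := by
  rw [← toJacobi_inr, oddEntry]
  simp only [posEquiv, Equiv.coe_fn_mk, Sum.elim_inr, Fin.rev_rev]

theorem measurePreserving_reindex (n : ℕ) :
    MeasurePreserving (fun (p : (Fin n → ℝ) × (Fin n → ℝ)) (k : Fin (2 * n)) =>
      Sum.elim p.1 p.2 ((posEquiv n).symm k)) := by
  have h1 := volume_measurePreserving_sumPiEquivProdPi_symm (fun _ : Fin n ⊕ Fin n => ℝ)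
  have h2 := volume_preserving_arrowCongr' (posEquiv n) (.refl ℝ) (.id volume)
  refine (congrArg (fun f => MeasurePreserving f volume volume) ?_).mpr (h2.comp h1)
  refine funext fun p => funext fun k => ?_
  change _ = Sum.rec (motive := fun _ => ℝ) p.1 p.2 ((posEquiv n).symm k)
  cases (posEquiv n).symm k <;> rfl

theorem measurable_toJacobi (n : ℕ) : Measurable (toJacobi n) := by
  have h : toJacobi n = fun p k => Real.exp (-Sum.elim p.1 p.2 ((posEquiv n).symm k)) := by
    ext p k; exact toJacobi_eq n p k
  rw [h]
  exact measurable_pi_lambda _ fun k => Real.measurable_exp.comp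
    ((measurable_pi_apply k).comp (measurePreserving_reindex n).measurable).neg

theorem map_toJacobi_withDensity {n : ℕ} {f : (Fin n → ℝ) × (Fin n → ℝ) → ℝ≥0∞}
    {g : (Fin (2 * n) → ℝ) → ℝ≥0∞} (hgm : Measurable g) (hg : ∀ u, g u ≠ 0 → ∀ k, 0 < u k)
    (hfg : ∀ p, f p = ENNReal.ofReal (∏ k, toJacobi n p k) * g (toJacobi n p)) :
    Measure.map (toJacobi n) (volume.withDensity f) = volume.withDensity g := by
  have hJ := measurable_toJacobi n
  ext s hs
  rw [Measure.map_apply hJ hs, withDensity_apply _ (hJ hs), withDensity_apply _ hs,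
    ← lintegral_indicator (hJ hs), ← lintegral_indicator hs,
    ← lintegral_exp_neg_pi (2 * n) (s.indicator g)]
  · rw [← (measurePreserving_reindex n).lintegral_comp]
    · refine lintegral_congr fun p => ?_
      simp only [← toJacobi_eq]
      change _ = ENNReal.ofReal (∏ k, toJacobi n p k) * s.indicator g (toJacobi n p)
      by_cases h : toJacobi n p ∈ s
      · rw [Set.indicator_of_mem (show p ∈ toJacobi n ⁻¹' s from h), Set.indicator_of_mem h, hfg]
      · rw [Set.indicator_of_notMem (show p ∉ toJacobi n ⁻¹' s from h), Set.indicator_of_notMem h,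
          mul_zero]
    · refine Measurable.mul (by fun_prop) ((hgm.indicator hs).comp (by fun_prop))
  · intro u hu
    refine hg u fun h => hu ?_
    by_cases hus : u ∈ s
    · rw [Set.indicator_of_mem hus, h]
    · rw [Set.indicator_of_notMem hus]

theorem strictAnti_of_succ_lt {m : ℕ} {f : Fin m → ℝ}
    (h : ∀ k l : Fin m, (l : ℕ) = k + 1 → f l < f k) : StrictAnti f := by
  cases m with
  | zero => intro i; exact i.elim0
  | succ m => exact Fin.strictAnti_iff_succ_lt.2 fun i => h _ _ (by simp)

theorem interlace_iff_toJacobi {n : ℕ} (p : (Fin n → ℝ) × (Fin n → ℝ)) :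
    Interlace p.1 p.2 ↔ StrictAnti (toJacobi n p) ∧
      ∀ k, 0 < toJacobi n p k ∧ toJacobi n p k < 1 := by
  have hl : ∀ i : Fin n, (posEquiv n (Sum.inl i) : ℕ) = 2 * i.rev + 1 := fun i => rfl
  have hr : ∀ i : Fin n, (posEquiv n (Sum.inr i) : ℕ) = 2 * i.rev := fun i => rfl
  have hrev : ∀ i : Fin n, (i.rev : ℕ) = n - (i + 1) := Fin.val_rev
  constructor
  · intro h
    refine ⟨strictAnti_of_succ_lt fun k l hkl => ?_, fun k => ?_⟩
    · obtain ⟨k, rfl⟩ := (posEquiv n).surjective k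
      obtain ⟨l, rfl⟩ := (posEquiv n).surjective l
      rcases k with i | i <;> rcases l with j | j
      · rw [hl, hl] at hkl; omega
      · rw [hl, hr, hrev, hrev] at hkl
        rw [toJacobi_inl, toJacobi_inr, Real.exp_lt_exp, neg_lt_neg_iff]
        refine h.2.1 j i ?_
        have := i.2; have := j.2; omega
      · rw [hl, hr, hrev, hrev] at hkl
        have : i = j := by ext; have := i.2; have := j.2; omega
        subst this
        rw [toJacobi_inl, toJacobi_inr, Real.exp_lt_exp, neg_lt_neg_iff]
        exact h.1 i
      · rw [hr, hr] at hkl; omega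
    · obtain ⟨k, rfl⟩ := (posEquiv n).surjective k
      rcases k with i | i
      · rw [toJacobi_inl]
        exact ⟨Real.exp_pos _, Real.exp_lt_one_iff.2 (neg_lt_zero.2 ((h.2.2 i).trans (h.1 i)))⟩
      · rw [toJacobi_inr]
        exact ⟨Real.exp_pos _, Real.exp_lt_one_iff.2 (neg_lt_zero.2 (h.2.2 i))⟩
  · rintro ⟨h1, h2⟩
    refine ⟨fun i => ?_, fun i j hij => ?_, fun i => ?_⟩
    · have := h1 (show posEquiv n (Sum.inr i) < posEquiv n (Sum.inl i) by
        rw [Fin.lt_def, hl, hr]; omega)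
      rwa [toJacobi_inl, toJacobi_inr, Real.exp_lt_exp, neg_lt_neg_iff] at this
    · have := h1 (show posEquiv n (Sum.inl j) < posEquiv n (Sum.inr i) by
        rw [Fin.lt_def, hl, hr, hrev, hrev]; have := j.2; omega)
      rwa [toJacobi_inl, toJacobi_inr, Real.exp_lt_exp, neg_lt_neg_iff] at this
    · have := (h2 (posEquiv n (Sum.inr i))).2
      rw [toJacobi_inr, Real.exp_lt_one_iff] at this
      linarith

/-- The substitution in `toJacobi` reverses the order of the indices, and `(i, j) ↦ (rev j, rev i)`
permutes the pairs `i < j`. -/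
theorem prod_Ioi_rev {M : Type*} [CommMonoid M] {n : ℕ} (F : Fin n → Fin n → M) :
    ∏ j : Fin n, ∏ k ∈ Finset.Ioi j, F k.rev j.rev =
      ∏ i : Fin n, ∏ j ∈ Finset.Ioi i, F i j := by
  rw [Finset.prod_sigma', Finset.prod_sigma']
  refine Finset.prod_nbij' (fun s : (_ : Fin n) × Fin n => ⟨Fin.rev s.2, Fin.rev s.1⟩)
    (fun s : (_ : Fin n) × Fin n => ⟨Fin.rev s.2, Fin.rev s.1⟩) ?_ ?_ ?_ ?_ ?_
  all_goals simp

theorem limitDensity_eq_jacobiWeight (n : ℕ) (a A : ℝ) (p : (Fin n → ℝ) × (Fin n → ℝ)) :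
    limitDensity n n ((a + 1) / 2) (-A / 2) p.1 p.2 = (∏ k, toJacobi n p k) *
      (limitConst n n ((a + 1) / 2) (-A / 2) * jacobiWeight n a A (toJacobi n p)) := by
  classical
  rw [limitDensity, jacobiWeight]
  by_cases h : Interlace p.1 p.2
  · rw [if_pos h, if_pos ((interlace_iff_toJacobi p).1 h)]
    have e1 : ∀ F : ℝ → ℝ, ∏ k, F (toJacobi n p k) =
        (∏ i, F (Real.exp (-p.1 i))) * ∏ i, F (Real.exp (-p.2 i)) := by
      intro F
      rw [← (posEquiv n).prod_comp, Fintype.prod_sum_type]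
      simp only [toJacobi_inl, toJacobi_inr]
    have e2 : ∏ l, (evenEntry (toJacobi n p) l / oddEntry (toJacobi n p) l) ^ (-A / 2) =
        Real.exp (-(-A / 2) * ∑ j, (p.1 j - p.2 j)) := by
      simp only [evenEntry_toJacobi, oddEntry_toJacobi]
      refine (Equiv.prod_comp Fin.revPerm
        fun l => (Real.exp (-p.1 l) / Real.exp (-p.2 l)) ^ (-A / 2)).trans ?_
      rw [Finset.mul_sum, Real.exp_sum]
      refine Finset.prod_congr rfl fun i _ => ?_
      rw [← Real.exp_sub, ← Real.exp_mul]
      congr 1; ring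
    have e3 : ∏ j, ∏ k ∈ Finset.Ioi j, (oddEntry (toJacobi n p) j - oddEntry (toJacobi n p) k) *
        (evenEntry (toJacobi n p) j - evenEntry (toJacobi n p) k) =
        ∏ i, ∏ j ∈ Finset.Ioi i, (Real.exp (-p.2 j) - Real.exp (-p.2 i)) *
          (Real.exp (-p.1 j) - Real.exp (-p.1 i)) := by
      simp only [evenEntry_toJacobi, oddEntry_toJacobi]
      exact prod_Ioi_rev fun i j => (Real.exp (-p.2 j) - Real.exp (-p.2 i)) *
          (Real.exp (-p.1 j) - Real.exp (-p.1 i))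
    -- The Jacobian contributes one extra power of each `u`: `1 + (a - 1) / 2 = (a + 1) / 2`.
    have e4 : (∏ k, toJacobi n p k) * ∏ k, toJacobi n p k ^ ((a - 1) / 2) =
        Real.exp (-((a + 1) / 2) * ∑ j, (p.1 j + p.2 j)) := by
      rw [← Finset.prod_mul_distrib, e1 (fun u => u * u ^ ((a - 1) / 2)), ← Finset.prod_mul_distrib,
        Finset.mul_sum, Real.exp_sum]
      refine Finset.prod_congr rfl fun i _ => ?_
      rw [← Real.exp_mul, ← Real.exp_mul, ← Real.exp_add, ← Real.exp_add, ← Real.exp_add]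
      congr 1; ring
    rw [e2, e3, ← e4]
    simp only [Nat.sub_self, pow_zero, Finset.prod_const_one]
    ring
  · rw [if_neg h, if_neg fun h' => h ((interlace_iff_toJacobi p).2 h')]
    simp

theorem jacobiWeight_nonneg (n : ℕ) (a A : ℝ) (u : Fin (2 * n) → ℝ) : 0 ≤ jacobiWeight n a A u := by
  rw [jacobiWeight]
  split_ifs with h
  · refine mul_nonneg (mul_nonneg ?_ ?_) ?_
    · exact Finset.prod_nonneg fun k _ => Real.rpow_nonneg (h.2 k).1.le _
    · exact Finset.prod_nonneg fun l _ =>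
        Real.rpow_nonneg (div_nonneg (h.2 _).1.le (h.2 _).1.le) _
    · refine Finset.prod_nonneg fun j _ => Finset.prod_nonneg fun k hk => ?_
      have hjk : (j : ℕ) < k := Fin.lt_def.1 (Finset.mem_Ioi.1 hk)
      refine mul_nonneg (sub_nonneg.2 (h.1 ?_).le) (sub_nonneg.2 (h.1 ?_).le)
      · rw [Fin.lt_def]; simp only; omega
      · rw [Fin.lt_def]; simp only; omega
  · exact le_rfl

theorem measurable_jacobiWeight (n : ℕ) (a A : ℝ) : Measurable (jacobiWeight n a A) := by
  classical
  unfold jacobiWeight oddEntry evenEntry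
  refine Measurable.ite ?_ ?_ measurable_const
  · refine MeasurableSet.inter measurableSet_strictAnti ?_
    have : {u : Fin (2 * n) → ℝ | ∀ k, 0 < u k ∧ u k < 1} =
        ⋂ k, {u | 0 < u k} ∩ {u | u k < 1} := by ext u; simp
    rw [show (fun u : Fin (2 * n) → ℝ => ∀ k, 0 < u k ∧ u k < 1) =
      {u : Fin (2 * n) → ℝ | ∀ k, 0 < u k ∧ u k < 1} from rfl, this]
    exact MeasurableSet.iInter fun k => (measurableSet_lt (by fun_prop) (by fun_prop)).inter
      (measurableSet_lt (by fun_prop) (by fun_prop))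
  · fun_prop

theorem map_toJacobi_limitDensity {n : ℕ} (hn : 0 < n) {a A : ℝ} (ha : -1 < a) (hA : A < a + 1) :
    Measure.map (toJacobi n) (volume.withDensity fun p : (Fin n → ℝ) × (Fin n → ℝ) =>
        ENNReal.ofReal (limitDensity n n ((a + 1) / 2) (-A / 2) p.1 p.2)) =
      volume.withDensity fun u : Fin (2 * n) → ℝ => ENNReal.ofReal (jacobiDensity n a A u) := by
  have ha' : 0 < (a + 1) / 2 := by linarith
  have ha₁' : 0 < (a + 1) / 2 + -A / 2 := by linarith
  set C := limitConst n n ((a + 1) / 2) (-A / 2) with hC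
  have hC0 : 0 < C := limitConst_pos ha' ha₁' n 0
  have hmeas := measurable_jacobiWeight n a A
  have hmap : Measure.map (toJacobi n) (volume.withDensity fun p : (Fin n → ℝ) × (Fin n → ℝ) =>
        ENNReal.ofReal (limitDensity n n ((a + 1) / 2) (-A / 2) p.1 p.2)) =
      volume.withDensity fun u : Fin (2 * n) → ℝ => ENNReal.ofReal (C * jacobiWeight n a A u) := by
    refine map_toJacobi_withDensity (hmeas.const_mul C).ennreal_ofReal ?_ ?_
    · intro u hu k
      by_contra h
      apply hu
      rw [jacobiWeight, if_neg (fun h' => h (h'.2 k).1), mul_zero, ENNReal.ofReal_zero]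
    · intro p
      rw [← ENNReal.ofReal_mul, ← limitDensity_eq_jacobiWeight]
      exact Finset.prod_nonneg fun k _ => by rw [toJacobi_eq]; exact (Real.exp_pos _).le
  have hmass : ∫⁻ u : Fin (2 * n) → ℝ, ENNReal.ofReal (C * jacobiWeight n a A u) = 1 := by
    obtain ⟨N, rfl⟩ := Nat.exists_eq_succ_of_ne_zero hn.ne'
    have h1 := lintegral_limitDensity N 0 ha' ha₁'
    have h2 := congrArg (fun ν => ν Set.univ) hmap
    simp only [Measure.map_apply (measurable_toJacobi _) MeasurableSet.univ, Set.preimage_univ,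
      withDensity_apply _ MeasurableSet.univ, Measure.restrict_univ] at h2
    exact h2.symm.trans h1
  -- The mass of the image is already known to be `1`, so the normalisation is `C⁻¹` and no integral
  -- over the `u` has to be evaluated.
  have hint : ∫ u, jacobiWeight n a A u = C⁻¹ := by
    have h1 : ∫ u, C * jacobiWeight n a A u = 1 := by
      rw [integral_eq_lintegral_of_nonneg_ae
        (Filter.Eventually.of_forall fun u => mul_nonneg hC0.le (jacobiWeight_nonneg n a A u))
        (hmeas.const_mul C).aestronglyMeasurable, hmass, ENNReal.toReal_one]
    rw [integral_const_mul] at h1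
    exact eq_inv_of_mul_eq_one_right h1
  rw [hmap]
  congr 1
  ext u
  rw [jacobiDensity, hint, div_inv_eq_mul, mul_comm]

end ChangeOfVariables

end LPP

theorem mainTheorem7 (n₁ n₂ : ℕ) (hn₁ : 0 < n₁) (hn : n₁ ≤ n₂) :
    -- the joint law of the two shapes
    (∀ (Ω : Type*) [MeasurableSpace Ω] (P : Measure Ω) [IsProbabilityMeasure P]
      (z α t : ℝ) (X : Fin n₁ → Fin (n₂ + 1) → Ω → ℕ),
      0 < z → 0 < α → 0 < t → t ≠ 1 →
      (∀ (i : Fin n₁) (j : Fin (n₂ + 1)), LPP.siteParam z α t i j < 1) →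
      (∀ i j, Measurable (X i j)) →
      iIndepFun (fun p : Fin n₁ × Fin (n₂ + 1) => X p.1 p.2) P →
      (∀ i j k, P.real {ω | X i j ω = k} =
        (1 - LPP.siteParam z α t i j) * LPP.siteParam z α t i j ^ k) →
      ∀ μ κ : YoungDiagram,
        (LPP.jointProb P X μ κ ≠ 0 ↔
          μ.rowLen n₁ = 0 ∧ κ.rowLen n₁ = 0 ∧
            LPP.DiscreteInterlace (LPP.shiftedParts n₁ μ) (LPP.shiftedParts n₁ κ)) ∧
        (μ.rowLen n₁ = 0 → κ.rowLen n₁ = 0 →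
          LPP.DiscreteInterlace (LPP.shiftedParts n₁ μ) (LPP.shiftedParts n₁ κ) →
          LPP.jointProb P X μ κ =
            LPP.jointFormula n₁ n₂ z α t (LPP.shiftedParts n₁ μ) (LPP.shiftedParts n₁ κ))) ∧
    -- the Jacobi limit
    (∀ a a₁ : ℝ, 0 < a → 0 < a + a₁ →
      (∀ (x y : Fin n₁ → ℝ) (h r : ℝ → Fin n₁ → ℕ), LPP.Interlace x y →
        (∀ j, Filter.Tendsto (fun L : ℝ => (h L j : ℝ) / L) Filter.atTop (nhds (x j))) →
        (∀ j, Filter.Tendsto (fun L : ℝ => (r L j : ℝ) / L) Filter.atTop (nhds (y j))) →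
        Filter.Tendsto
          (fun L : ℝ => L ^ (2 * n₁) *
            LPP.jointFormula n₁ n₂ (Real.exp (-a / L)) (Real.exp (-a₁ / L)) (Real.exp (-1 / L))
              (h L) (r L))
          Filter.atTop (nhds (LPP.limitDensity n₁ n₂ a a₁ x y))) ∧
      -- the limit is a probability density
      (∀ x y, 0 ≤ LPP.limitDensity n₁ n₂ a a₁ x y) ∧
      ∫⁻ p : (Fin n₁ → ℝ) × (Fin n₁ → ℝ),
        ENNReal.ofReal (LPP.limitDensity n₁ n₂ a a₁ p.1 p.2) = 1) ∧
    -- reduction to the parameter dependent Jacobi ensemble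
    (n₂ = n₁ → ∀ a A : ℝ, -1 < a → A < a + 1 →
      Measure.map (LPP.toJacobi n₁)
        (volume.withDensity fun p : (Fin n₁ → ℝ) × (Fin n₁ → ℝ) =>
          ENNReal.ofReal (LPP.limitDensity n₁ n₂ ((a + 1) / 2) (-A / 2) p.1 p.2)) =
      volume.withDensity fun u : Fin (2 * n₁) → ℝ =>
        ENNReal.ofReal (LPP.jacobiDensity n₁ a A u)) := by
  refine ⟨?_, ?_, ?_⟩
  · intro Ω _ P _ z α t X hz hα ht ht1 hp1 hX hind hlaw μ κ
    exact LPP.jointProb_law P hn hz hα ht ht1 hp1 hX hind hlaw μ κ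
  · intro a a₁ ha ha₁
    obtain ⟨m, rfl⟩ := Nat.exists_eq_add_of_le hn
    refine ⟨fun x y h r hxy hh hr => LPP.tendsto_jointFormula ha ha₁ n₁ m hxy hh hr,
      LPP.limitDensity_nonneg ha ha₁ n₁ m, ?_⟩
    -- The interlacing intervals single out the unbounded first coordinate, so the size is written
    -- as `N + 1`.
    obtain ⟨N, rfl⟩ := Nat.exists_eq_succ_of_ne_zero hn₁.ne'
    exact LPP.lintegral_limitDensity N m ha ha₁
  · rintro rfl a A ha hA
    exact LPP.map_toJacobi_limitDensity hn₁ ha hA
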